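/- **Setting.** Let $N\ge 1$, $0<s,t<1<p\le q<\infty$ with $tq\le sp$ and $tq\le N$, and let $\Omega\subset\mathbb R^N$ be a bounded open set. For $(\sigma,r,\Lambda)\in\{(s,p,\Lambda_1),(t,q,\Lambda_2)\}$ let $K_{\sigma,r}(x,y)$ be symmetric, translation invariant ($K(x+z,y+z)=K(x,y)$), continuous in $y\ne x$, with $\Lambda^{-1}|x-y|^{-N-\sigma r}\le K_{\sigma,r}(x,y)\le\Lambda|x-y|^{-N-\sigma r}$ for $x\neq y$. Let $a:\mathbb R^N\times\mathbb R^N\to(0,M]$ be continuous, symmetric and translation invariant, and let $a_0>0$ denote a lower bound of $a$ on $\Omega\times\Omega$ (one exists since $\overline\Omega$ is compact). Put $h_r(\tau)=|\tau|^{r-2}\tau$, $r_\sigma^*=\frac{Nr}{N-\sigma r}$ if $\sigma r<N$ and $r_\sigma^*=\infty$ if $\sigma r\ge N$, and $$H_a(u,v)=\iint h_p(u(x)-u(y))(v(x)-v(y))K_{s,p}(x,y)\,dy\,dx+\iint a(x,y)h_q(u(x)-u(y))(v(x)-v(y))K_{t,q}(x,y)\,dy\,dx .$$ $L^{p-1}_{s,p}(\mathbb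 R^N)$ is the set of $v\in L^{p-1}_{loc}$ with $\int\frac{|v(y)|^{p-1}}{(1+|y|)^{N+sp}}dy<\infty$, and $L^{q-1}_{a,t,q}(\mathbb R^N)$ the set of $v\in L^{q-1}_{loc}$ with $\sup_x\int a(x,y)\frac{|v(y)|^{q-1}}{(1+|y|)^{N+tq}}dy<\infty$. The tails are $$\mathrm{Tail}_{s,p}(v,x_0,R)=\Big(R^{sp}\int_{\mathbb R^N\setminus B_R(x_0)}\frac{|v(y)|^{p-1}}{|x_0-y|^{N+sp}}dy\Big)^{\frac1{p-1}},$$ $$\mathrm{Tail}_{a,t,q}(v,x_0,R)=\Big(R^{tq}\sup_{z}\int_{\mathbb R^N\setminus B_R(x_0)}a(z,y)\frac{|v(y)|^{q-1}}{|x_0-y|^{N+tq}}dy\Big)^{\frac1{q-1}}.$$ **Theorem.** Let $u\in W^{t,q}_{loc}(\mathbb R^N)\cap W^{s,p}(\mathbb R^N)\cap L^{p-1}_{s,p}(\mathbb R^N)\cap L^{q-1}_{a,t,q}(\mathbb R^N)$ be a weak solution of $L_au=f(x,u)$ in $\Omega$, i.e. $x\mapsto f(x,u(x))$ is measurable on $\Omega$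 and $H_a(u,v)=\int_\Omega f(x,u)v\,dx$ for all $v\in C_c^\infty(\Omega)$, where $|f(x,\tau)|\le c_1+c_2|\tau|^{l-1}$ for all $x\in\Omega$, $\tau\in\mathbb R$, with $c_1,c_2\ge0$ and $1<l<q_t^*$. Then $u$ is locally bounded in $\Omega$ (essentially bounded on every compact subset of $\Omega$). Moreover there are $\tilde R\in(0,\infty]$ and $C\ge1$ such that for every $x_0\in\Omega$ and $0<2R<\min\{\operatorname{dist}(x_0,\partial\Omega),\tilde R\}$, $$\|u_+\|_{L^\infty(B_R(x_0))}\le \mathcal B(u),\qquad \|u_-\|_{L^\infty(B_R(x_0))}\le\mathcal B(-u),\qquad \|u\|_{L^\infty(B_R(x_0))}\le\max\{\mathcal B(u),\mathcal B(-u)\},$$ where $$\mathcal B(w)=\mathrm{Tail}_{s,p}((w-k')_+,x_0,R)+\mathrm{Tail}_{a,t,q}((w-k')_+,x_0,R)+R^{\frac{\rho+N\tilde\epsilon}{q}}\theta+2k'$$ $$\qquad\qquad+C\Big[\tfrac1{R^N}\Big(\|(w-k')_+\|^p_{L^p(B_{2R}(x_0))}+\big(\tfrac R2\big)^{sp-tq}\|(w-k')_+\|^q_{L^q(B_{2R}(x_0))}\Big)\Big]^{\frac1p},$$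 with $\theta=c_1^{1/(q-1)}$, $\rho=\frac{tq}{q-1}$, and: - if $c_2=0$: $k'=0$, $\tilde\epsilon=\frac{tq}N$, $\tilde R=\infty$, and $C$ depends only on $N,s,p,t,q,\Lambda_1,\Lambda_2,M,a_0$; - if $c_2>0$ and $1<l\le q$: $k'=1$, $\tilde\epsilon=\frac{tq}N$, $\tilde R=1$, and $C$ depends only on these quantities and $c_2$; - if $c_2>0$ and $q<l<q_t^*$: for every fixed $0<\alpha\le t$ with $\alpha q<N$ and $l<q_\alpha^*$ (for instance $\alpha=t$ if $tq<N$), $k'=0$, $\tilde\epsilon=1-\frac{l}{q_\alpha^*}=1-\frac{l(N-\alpha q)}{Nq}$, $\tilde R>0$ depends only on $N,t,q,l,\alpha,\Lambda_2,a_0,c_2$ and $\|u\|_{L^{q_\alpha^*}(\Omega)}$, and $C$ depends only on $N,s,p,t,q,l,\alpha,\Lambda_1,\Lambda_2,M,a_0,c_2$. -/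

import Mathlib

open MeasureTheory Set
open scoped ENNReal

noncomputable section

/-- Euclidean space of dimension `N`. -/
abbrev RN (N : ℕ) : Type := EuclideanSpace ℝ (Fin N)

/-- The odd power `h_r(τ) = |τ|^(r-2) τ`. -/
def hPow (r τ : ℝ) : ℝ := |τ| ^ (r - 2) * τ

/-- The Gagliardo energy `∫_D ∫_D |u(x)-u(y)|^r / |x-y|^(N+σr) dy dx` (the `r`-th power of the
seminorm of `W^{σ,r}(D)`). -/
def gagliardo {N : ℕ} (σ r : ℝ) (D : Set (RN N)) (u : RN N → ℝ) : ℝ≥0∞ :=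
  ∫⁻ x in D, ∫⁻ y in D, ENNReal.ofReal (|u x - u y| ^ r / ‖x - y‖ ^ ((N : ℝ) + σ * r))

/-- `u ∈ W^{σ,r}(D)`. -/
structure MemFracSobolev {N : ℕ} (σ r : ℝ) (D : Set (RN N)) (u : RN N → ℝ) : Prop where
  memLp : MemLp u (ENNReal.ofReal r) (volume.restrict D)
  energy_lt_top : gagliardo σ r D u < ⊤

/-- `u ∈ W^{σ,r}_loc(ℝ^N)`. -/
def MemFracSobolevLoc {N : ℕ} (σ r : ℝ) (u : RN N → ℝ) : Prop :=
  ∀ U : Set (RN N), IsOpen U → Bornology.IsBounded U → MemFracSobolev σ r U u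

/-- The tail space `L^{r-1}_{σ,r}(ℝ^N)`. -/
structure MemTailSpace {N : ℕ} (σ r : ℝ) (u : RN N → ℝ) : Prop where
  memLp_loc : ∀ K : Set (RN N), IsCompact K →
    MemLp u (ENNReal.ofReal (r - 1)) (volume.restrict K)
  tail_lt_top :
    ∫⁻ y, ENNReal.ofReal (|u y| ^ (r - 1) / (1 + ‖y‖) ^ ((N : ℝ) + σ * r)) < ⊤

/-- The weighted tail space `L^{r-1}_{a,σ,r}(ℝ^N)`. -/
structure MemWeightedTailSpace {N : ℕ} (a : RN N → RN N → ℝ) (σ r : ℝ) (u : RN N → ℝ) :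
    Prop where
  memLp_loc : ∀ K : Set (RN N), IsCompact K →
    MemLp u (ENNReal.ofReal (r - 1)) (volume.restrict K)
  tail_lt_top :
    ⨆ x : RN N, ∫⁻ y,
      ENNReal.ofReal (a x y * (|u y| ^ (r - 1) / (1 + ‖y‖) ^ ((N : ℝ) + σ * r))) < ⊤

/-- `Tail_{σ,r}(v; x, R)`. -/
def tail {N : ℕ} (σ r : ℝ) (v : RN N → ℝ) (x : RN N) (R : ℝ) : ℝ≥0∞ :=
  (ENNReal.ofReal (R ^ (σ * r)) *
    ∫⁻ y in (Metric.ball x R)ᶜ,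
      ENNReal.ofReal (|v y| ^ (r - 1) / ‖x - y‖ ^ ((N : ℝ) + σ * r))) ^ (1 / (r - 1))

/-- `Tail_{a,σ,r}(v; x, R)`. -/
def weightedTail {N : ℕ} (a : RN N → RN N → ℝ) (σ r : ℝ) (v : RN N → ℝ) (x : RN N) (R : ℝ) :
    ℝ≥0∞ :=
  (ENNReal.ofReal (R ^ (σ * r)) *
    ⨆ z : RN N, ∫⁻ y in (Metric.ball x R)ᶜ,
      ENNReal.ofReal (a z y * (|v y| ^ (r - 1) / ‖x - y‖ ^ ((N : ℝ) + σ * r)))) ^ (1 / (r - 1))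

/-- The standing assumptions on a kernel `K_{σ,r}` with ellipticity constant `Λ`.
Positivity off the diagonal follows from `lower`; the diagonal is a null set. -/
structure IsKernel {N : ℕ} (σ r Λ : ℝ) (K : RN N → RN N → ℝ) : Prop where
  const_pos : 0 < Λ
  lower : ∀ x y, x ≠ y → 1 / (Λ * ‖x - y‖ ^ ((N : ℝ) + σ * r)) ≤ K x y
  upper : ∀ x y, x ≠ y → K x y ≤ Λ / ‖x - y‖ ^ ((N : ℝ) + σ * r)
  symm : ∀ x y, K x y = K y x
  cont : ∀ x, ContinuousOn (K x) {x}ᶜ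
  transl : ∀ x y z, K (x + z) (y + z) = K x y

/-- The standing assumptions on the weight `a`, with upper bound `M`. -/
structure IsWeight {N : ℕ} (M : ℝ) (a : RN N → RN N → ℝ) : Prop where
  pos : ∀ x y, 0 < a x y
  le : ∀ x y, a x y ≤ M
  symm : ∀ x y, a x y = a y x
  cont : Continuous (Function.uncurry a)
  transl : ∀ x y z, a (x + z) (y + z) = a x y

/-- The form `H_a(u,v)` of the operator `L_a`. -/
def formH {N : ℕ} (p q : ℝ) (Ksp Ktq a : RN N → RN N → ℝ) (u v : RN N → ℝ) : ℝ :=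
  (∫ x, ∫ y, hPow p (u x - u y) * (v x - v y) * Ksp x y) +
    ∫ x, ∫ y, a x y * hPow q (u x - u y) * (v x - v y) * Ktq x y

/-- `u` is a weak solution of `L_a u = f(x,u)` in `Ω`. The measurability of `x ↦ f(x,u(x))` on
`Ω` is what gives the right-hand side of the weak formulation a meaning. -/
structure IsWeakSolution {N : ℕ} (s p t q : ℝ) (Ω : Set (RN N))
    (Ksp Ktq a : RN N → RN N → ℝ) (f : RN N → ℝ → ℝ) (u : RN N → ℝ) : Prop where
  memSobolev : MemFracSobolev s p univ u
  memTail : MemTailSpace s p u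
  memWeightedTail : MemWeightedTailSpace a t q u
  rhs_measurable : AEStronglyMeasurable (fun x => f x (u x)) (volume.restrict Ω)
  weak : ∀ v : RN N → ℝ, ContDiff ℝ ((⊤ : ℕ∞) : WithTop ℕ∞) v → HasCompactSupport v →
    tsupport v ⊆ Ω → formH p q Ksp Ktq a u v = ∫ x in Ω, f x (u x) * v x

/-- The critical exponent `r_σ^* = Nr/(N-σr)`, equal to `∞` if `σr ≥ N`. -/
def critExp (N : ℕ) (σ r : ℝ) : ℝ≥0∞ :=
  if σ * r < N then ENNReal.ofReal ((N : ℝ) * r / ((N : ℝ) - σ * r)) else ⊤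

/-- The assumptions on the exponents. (They imply `t ≤ s` and `1 ≤ N`.) -/
structure Exponents (N : ℕ) (s p t q : ℝ) : Prop where
  s_pos : 0 < s
  s_lt_one : s < 1
  t_pos : 0 < t
  t_lt_one : t < 1
  one_lt_p : 1 < p
  p_le_q : p ≤ q
  tq_le_sp : t * q ≤ s * p
  tq_le_N : t * q ≤ N

/-- `u ∈ W^{t,q}_loc(ℝ^N)` is a weak solution of `L_a u = f(x,u)` in the bounded open set `Ω`,
where `|f(x,τ)| ≤ c₁ + c₂|τ|^(l-1)` and `1 < l < q_t^*`. -/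
structure SolvesDoublePhase {N : ℕ} (s p t q Λ₁ Λ₂ M c₁ c₂ l : ℝ) (Ω : Set (RN N))
    (Ksp Ktq a : RN N → RN N → ℝ) (f : RN N → ℝ → ℝ) (u : RN N → ℝ) : Prop where
  isOpen : IsOpen Ω
  isBounded : Bornology.IsBounded Ω
  kernel_sp : IsKernel s p Λ₁ Ksp
  kernel_tq : IsKernel t q Λ₂ Ktq
  weight : IsWeight M a
  c₁_nonneg : 0 ≤ c₁
  c₂_nonneg : 0 ≤ c₂
  one_lt_l : 1 < l
  l_lt_critExp : ENNReal.ofReal l < critExp N t q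
  growth : ∀ x ∈ Ω, ∀ τ : ℝ, |f x τ| ≤ c₁ + c₂ * |τ| ^ (l - 1)
  memSobolevLoc : MemFracSobolevLoc t q u
  solution : IsWeakSolution s p t q Ω Ksp Ktq a f u

/-- The right-hand side of the sup estimate for `w`, with `(w-k)_+` in the tails and norms:
`Tail_{s,p} + Tail_{a,t,q} + R^((ρ+Nε)/q) θ + 2k
  + C [R^(-N) (‖(w-k)_+‖_{L^p(B_{2R})}^p + (R/2)^(sp-tq) ‖(w-k)_+‖_{L^q(B_{2R})}^q)]^(1/p)`. -/
def supBound {N : ℕ} (s p t q : ℝ) (a : RN N → RN N → ℝ) (k θ ε ρ C : ℝ)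
    (w : RN N → ℝ) (x₀ : RN N) (R : ℝ) : ℝ≥0∞ :=
  tail s p (fun x => max (w x - k) 0) x₀ R
    + weightedTail a t q (fun x => max (w x - k) 0) x₀ R
    + ENNReal.ofReal (R ^ ((ρ + N * ε) / q) * θ) + ENNReal.ofReal (2 * k)
    + ENNReal.ofReal C *
      (ENNReal.ofReal (1 / R ^ N) *
        (eLpNorm (fun x => max (w x - k) 0) (ENNReal.ofReal p)
            (volume.restrict (Metric.ball x₀ (2 * R))) ^ p
          + ENNReal.ofReal ((R / 2) ^ (s * p - t * q)) *
            eLpNorm (fun x => max (w x - k) 0) (ENNReal.ofReal q)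
              (volume.restrict (Metric.ball x₀ (2 * R))) ^ q)) ^ (1 / p)

/-- The sup estimate on `B_R(x₀)`: the positive part of `u` is controlled by `supBound` of `u`,
the negative part by `supBound` of `-u`, and the full `L^∞` norm by the larger of the two. -/
def SupEstimate {N : ℕ} (s p t q : ℝ) (a : RN N → RN N → ℝ) (k θ ε ρ C : ℝ)
    (u : RN N → ℝ) (x₀ : RN N) (R : ℝ) : Prop :=
  eLpNorm (fun x => max (u x) 0) ⊤ (volume.restrict (Metric.ball x₀ R))
      ≤ supBound s p t q a k θ ε ρ C u x₀ R ∧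
  eLpNorm (fun x => max (-u x) 0) ⊤ (volume.restrict (Metric.ball x₀ R))
      ≤ supBound s p t q a k θ ε ρ C (fun x => -u x) x₀ R ∧
  eLpNorm u ⊤ (volume.restrict (Metric.ball x₀ R))
      ≤ max (supBound s p t q a k θ ε ρ C u x₀ R)
          (supBound s p t q a k θ ε ρ C (fun x => -u x) x₀ R)

end

/-! ### The radial kernel integral -/

theorem integrable_min_one_rpow_div {N : ℕ} (hN : 1 ≤ N) {r τ : ℝ} (hτ : 0 < τ) (hτr : τ < r) :
    Integrable (fun z : RN N => (min 1 ‖z‖) ^ r / ‖z‖ ^ ((N : ℝ) + τ)) := by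
  have : Nontrivial (RN N) := by
    have : Nonempty (Fin N) := ⟨⟨0, hN⟩⟩
    infer_instance
  have key := (integrable_fun_norm_addHaar (E := RN N) (volume : Measure (RN N))
    (f := fun ρ : ℝ => (min 1 ρ) ^ r / ρ ^ ((N : ℝ) + τ)))
  rw [key]
  simp only [finrank_euclideanSpace, Fintype.card_fin, smul_eq_mul]
  rw [← Ioc_union_Ioi_eq_Ioi (zero_le_one (α := ℝ)), integrableOn_union]
  constructor
  · have h1 : IntegrableOn (fun ρ : ℝ => ρ ^ (r - τ - 1)) (Ioc 0 1) := by
      have := intervalIntegral.intervalIntegrable_rpow' (a := 0) (b := 1) (r := r - τ - 1)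
        (by linarith)
      rwa [intervalIntegrable_iff_integrableOn_Ioc_of_le zero_le_one] at this
    refine h1.congr_fun ?_ measurableSet_Ioc
    intro ρ hρ
    have h0 : 0 < ρ := hρ.1
    simp only
    rw [min_eq_right hρ.2, ← Real.rpow_natCast, Nat.cast_sub hN, ← Real.rpow_sub h0,
      ← Real.rpow_add h0]
    congr 1
    push_cast
    ring
  · have h1 : IntegrableOn (fun ρ : ℝ => ρ ^ (-τ - 1)) (Ioi 1) :=
      integrableOn_Ioi_rpow_of_lt (by linarith) one_pos
    refine h1.congr_fun ?_ measurableSet_Ioi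
    intro ρ hρ
    have h0 : (0 : ℝ) < ρ := lt_trans one_pos hρ
    simp only
    rw [min_eq_left (le_of_lt hρ), Real.one_rpow, ← Real.rpow_natCast, Nat.cast_sub hN,
      one_div, ← Real.rpow_neg h0.le, ← Real.rpow_add h0]
    congr 1
    push_cast
    ring

theorem exists_lintegral_min_rpow_div_le {N : ℕ} (hN : 1 ≤ N) {r τ : ℝ} (hτ : 0 < τ)
    (hτr : τ < r) :
    ∃ K : ℝ, 0 < K ∧ ∀ L : ℝ, 0 < L → ∀ x : RN N,
      ∫⁻ y, ENNReal.ofReal ((min 1 (L * ‖x - y‖)) ^ r / ‖x - y‖ ^ ((N : ℝ) + τ))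
        ≤ ENNReal.ofReal (K * L ^ τ) := by
  set f : RN N → ℝ := fun z => (min 1 ‖z‖) ^ r / ‖z‖ ^ ((N : ℝ) + τ) with hf
  have hfi : Integrable f := integrable_min_one_rpow_div hN hτ hτr
  have hf0 : ∀ z, 0 ≤ f z := fun z => by
    have : 0 ≤ min 1 ‖z‖ := le_min zero_le_one (norm_nonneg z)
    simp only [hf]; positivity
  have hf1 : 0 ≤ ∫ z, f z := integral_nonneg fun z => hf0 z
  refine ⟨(∫ z, f z) + 1, by linarith, ?_⟩
  intro L hL x
  have h1 : ∫⁻ y, ENNReal.ofReal ((min 1 (L * ‖x - y‖)) ^ r / ‖x - y‖ ^ ((N : ℝ) + τ))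
      = ∫⁻ z : RN N, ENNReal.ofReal ((min 1 (L * ‖z‖)) ^ r / ‖z‖ ^ ((N : ℝ) + τ)) :=
    lintegral_sub_left_eq_self
      (fun z : RN N => ENNReal.ofReal ((min 1 (L * ‖z‖)) ^ r / ‖z‖ ^ ((N : ℝ) + τ))) x
  have h2 : ∀ z : RN N, (min 1 (L * ‖z‖)) ^ r / ‖z‖ ^ ((N : ℝ) + τ)
      = L ^ ((N : ℝ) + τ) * f (L • z) := by
    intro z
    simp only [hf, norm_smul, Real.norm_eq_abs, abs_of_pos hL]
    rw [Real.mul_rpow hL.le (norm_nonneg z)]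
    have : L ^ ((N : ℝ) + τ) ≠ 0 := (Real.rpow_pos_of_pos hL _).ne'
    field_simp
  rw [h1]
  simp_rw [h2]
  rw [← ofReal_integral_eq_lintegral_ofReal ((hfi.comp_smul hL.ne').const_mul _)
    (Filter.Eventually.of_forall fun z => mul_nonneg (Real.rpow_nonneg hL.le _) (hf0 _))]
  apply ENNReal.ofReal_le_ofReal
  rw [integral_const_mul, Measure.integral_comp_smul]
  simp only [finrank_euclideanSpace, Fintype.card_fin, smul_eq_mul]
  rw [abs_of_pos (by positivity), Real.rpow_add hL, Real.rpow_natCast]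
  have hLN : L ^ N ≠ 0 := (pow_pos hL N).ne'
  have : 0 < L ^ τ := Real.rpow_pos_of_pos hL _
  have e : L ^ N * L ^ τ * ((L ^ N)⁻¹ * ∫ z, f z) = (∫ z, f z) * L ^ τ := by
    field_simp
  rw [e]
  nlinarith

/-! ### Pointwise inequalities -/

theorem hPow_of_nonneg {r τ : ℝ} (hr : 1 < r) (hτ : 0 ≤ τ) : hPow r τ = τ ^ (r - 1) := by
  unfold hPow
  rcases hτ.eq_or_lt with rfl | h
  · simp [Real.zero_rpow (by linarith : r - 1 ≠ 0)]
  · rw [abs_of_pos h, ← Real.rpow_add_one h.ne']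
    congr 1; ring

theorem hPow_neg (r τ : ℝ) : hPow r (-τ) = -hPow r τ := by
  simp [hPow]

theorem abs_hPow {r : ℝ} (hr : 1 < r) (τ : ℝ) : |hPow r τ| = |τ| ^ (r - 1) := by
  rw [← hPow_of_nonneg hr (abs_nonneg τ)]
  simp [hPow, abs_mul, abs_of_nonneg (Real.rpow_nonneg (abs_nonneg τ) _)]

theorem measurable_hPow (r : ℝ) : Measurable (hPow r) := by
  unfold hPow; fun_prop

theorem rpow_add_le_two_rpow_mul {r a b : ℝ} (hr : 0 ≤ r) (ha : 0 ≤ a) (hb : 0 ≤ b) :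
    (a + b) ^ r ≤ 2 ^ r * (a ^ r + b ^ r) := by
  have h2 : (0 : ℝ) < 2 ^ r := by positivity
  have hA := Real.rpow_nonneg ha r
  have hB := Real.rpow_nonneg hb r
  rcases le_total a b with h | h
  · calc (a + b) ^ r ≤ (2 * b) ^ r := Real.rpow_le_rpow (by positivity) (by linarith) hr
      _ = 2 ^ r * b ^ r := Real.mul_rpow (by norm_num) hb
      _ ≤ _ := by nlinarith
  · calc (a + b) ^ r ≤ (2 * a) ^ r := Real.rpow_le_rpow (by positivity) (by linarith) hr
      _ = 2 ^ r * a ^ r := Real.mul_rpow (by norm_num) ha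
      _ ≤ _ := by nlinarith

theorem rpow_sub_rpow_le_mul {r a b : ℝ} (hr : 1 ≤ r) (ha : 0 ≤ a) (hab : a ≤ b) :
    b ^ r - a ^ r ≤ r * b ^ (r - 1) * (b - a) := by
  rcases (ha.trans hab).eq_or_lt with rfl | hb
  · have : a = 0 := le_antisymm hab ha
    subst this; simp
  have h := one_add_mul_self_le_rpow_one_add (s := (a - b) / b) (p := r)
    (by rw [le_div_iff₀ hb]; linarith) hr
  have e : 1 + (a - b) / b = a / b := by field_simp; ring
  rw [e, Real.div_rpow ha hb.le, le_div_iff₀ (Real.rpow_pos_of_pos hb r)] at h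
  have e2 : b ^ r = b ^ (r - 1) * b := by
    rw [← Real.rpow_add_one hb.ne']; congr 1; ring
  have e3 : (1 + r * ((a - b) / b)) * b ^ r = b ^ r + r * b ^ (r - 1) * (a - b) := by
    rw [add_mul, one_mul]
    congr 1
    rw [e2]; field_simp
  rw [e3] at h
  linarith

theorem mul_rpow_mul_le_half_add {r P Q : ℝ} (hr : 1 < r) (hP : 0 ≤ P) (hQ : 0 ≤ Q) :
    r * P ^ (r - 1) * Q ≤ P ^ r / 2 + (2 * r) ^ r * Q ^ r := by
  have hPr := Real.rpow_nonneg hP r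
  have hQr := Real.rpow_nonneg hQ r
  have split : ∀ {x : ℝ}, 0 ≤ x → x ^ r = x ^ (r - 1) * x := by
    intro x hx
    rw [← Real.rpow_add_one' hx (by linarith)]; congr 1; ring
  rcases le_total (2 * r * Q) P with h | h
  · have : r * P ^ (r - 1) * Q ≤ P ^ r / 2 := by
      rw [split hP]
      have := Real.rpow_nonneg hP (r - 1)
      nlinarith
    have h3 : 0 ≤ (2 * r) ^ r * Q ^ r := by positivity
    linarith
  · have h1 : P ^ (r - 1) ≤ (2 * r * Q) ^ (r - 1) := Real.rpow_le_rpow hP h (by linarith)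
    have h2 : r * P ^ (r - 1) * Q ≤ (2 * r * Q) ^ r := by
      rw [split (by positivity : 0 ≤ 2 * r * Q)]
      have h0 := Real.rpow_nonneg hP (r - 1)
      calc r * P ^ (r - 1) * Q = P ^ (r - 1) * (r * Q) := by ring
        _ ≤ (2 * r * Q) ^ (r - 1) * (2 * r * Q) := by
          apply mul_le_mul h1 _ (by positivity) (by positivity)
          nlinarith
    rw [Real.mul_rpow (by positivity) hQ] at h2
    linarith

theorem rpow_sub_mul_sub_lower {r w z α β : ℝ} (hr : 1 < r) (hz : 0 ≤ z) (hzw : z ≤ w)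
    (hα : 0 ≤ α) (hβ : 0 ≤ β) :
    2⁻¹ * (2 ^ r)⁻¹ * |w * α - z * β| ^ r - ((2 * r) ^ r + 1) * (w ^ r * |α - β| ^ r)
      ≤ (w - z) ^ (r - 1) * (w * α ^ r - z * β ^ r) := by
  have hw : 0 ≤ w := hz.trans hzw
  have hwz : 0 ≤ w - z := sub_nonneg.2 hzw
  have h2 : (0 : ℝ) < 2 ^ r := by positivity
  have hαr := Real.rpow_nonneg hα r
  have hβr := Real.rpow_nonneg hβ r
  have hwz1 := Real.rpow_nonneg hwz (r - 1)
  have hr2 : 0 < (2 * r) ^ r := by positivity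
  have esplit : (w - z) ^ r = (w - z) ^ (r - 1) * (w - z) := by
    rw [← Real.rpow_add_one' hwz (by linarith)]; congr 1; ring
  rcases le_total β α with h | h
  · have hQ : 0 ≤ w ^ r * |α - β| ^ r := by positivity
    have hP : 0 ≤ (w - z) ^ r * α ^ r := by positivity
    have l1 : (w - z) ^ r * α ^ r ≤ (w - z) ^ (r - 1) * (w * α ^ r - z * β ^ r) := by
      rw [esplit, mul_assoc]
      apply mul_le_mul_of_nonneg_left _ hwz1
      have : z * β ^ r ≤ z * α ^ r :=
        mul_le_mul_of_nonneg_left (Real.rpow_le_rpow hβ h (by linarith)) hz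
      linarith
    have l2 : |w * α - z * β| ^ r ≤ 2 ^ r * ((w - z) ^ r * α ^ r + w ^ r * |α - β| ^ r) := by
      calc |w * α - z * β| ^ r ≤ ((w - z) * α + w * |α - β|) ^ r := by
            apply Real.rpow_le_rpow (abs_nonneg _) _ (by linarith)
            have h3 : 0 ≤ α - β := by linarith
            rw [abs_of_nonneg h3, abs_le]
            constructor <;> nlinarith [mul_nonneg hwz hα, mul_nonneg hwz h3, mul_nonneg hz h3]
        _ ≤ _ := by
            have := rpow_add_le_two_rpow_mul (r := r) (a := (w - z) * α) (b := w * |α - β|)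
              (by linarith) (by positivity) (by positivity)
            rwa [Real.mul_rpow hwz hα, Real.mul_rpow hw (abs_nonneg _)] at this
    have l3 : (2 ^ r)⁻¹ * |w * α - z * β| ^ r ≤ (w - z) ^ r * α ^ r + w ^ r * |α - β| ^ r := by
      rw [inv_mul_le_iff₀ h2]; exact l2
    have : 0 ≤ (2 * r) ^ r * (w ^ r * |α - β| ^ r) := by positivity
    linarith
  · have h3 : 0 ≤ β - α := by linarith
    have eab : |α - β| = β - α := by rw [abs_sub_comm, abs_of_nonneg h3]
    rw [eab]
    set P := (w - z) * β with hPdef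
    set Q := w * (β - α) with hQdef
    have hP0 : 0 ≤ P := mul_nonneg hwz hβ
    have hQ0 : 0 ≤ Q := mul_nonneg hw h3
    have eQ : w ^ r * (β - α) ^ r = Q ^ r := (Real.mul_rpow hw h3).symm
    have eP : P ^ r = (w - z) ^ r * β ^ r := Real.mul_rpow hwz hβ
    have eP1 : P ^ (r - 1) = (w - z) ^ (r - 1) * β ^ (r - 1) := Real.mul_rpow hwz hβ
    rw [eQ]
    have y := mul_rpow_mul_le_half_add hr hP0 hQ0
    have b := rpow_sub_rpow_le_mul hr.le hα h
    have l1 : P ^ r - r * P ^ (r - 1) * Q ≤ (w - z) ^ (r - 1) * (w * α ^ r - z * β ^ r) := by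
      rw [eP, eP1, esplit, hQdef]
      have := mul_le_mul_of_nonneg_left b (mul_nonneg hwz1 hw)
      linarith
    have l2 : |w * α - z * β| ^ r ≤ 2 ^ r * (P ^ r + Q ^ r) := by
      refine le_trans ?_ (rpow_add_le_two_rpow_mul (by linarith) hP0 hQ0)
      apply Real.rpow_le_rpow (abs_nonneg _) _ (by linarith)
      rw [abs_le, hPdef, hQdef]
      constructor <;> nlinarith [mul_nonneg hwz hα, mul_nonneg hwz h3, mul_nonneg hz h3,
        mul_nonneg hw h3]
    have l3 : (2 ^ r)⁻¹ * |w * α - z * β| ^ r ≤ P ^ r + Q ^ r := by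
      rw [inv_mul_le_iff₀ h2]; exact l2
    have hQr := Real.rpow_nonneg hQ0 r
    have hPr := Real.rpow_nonneg hP0 r
    linarith

theorem hPow_mul_sub_lower_of_le {r a b α β : ℝ} (hr : 1 < r) (hba : b ≤ a)
    (hα : 0 ≤ α) (hβ : 0 ≤ β) :
    2⁻¹ * (2 ^ r)⁻¹ * |max a 0 * α - max b 0 * β| ^ r
        - ((2 * r) ^ r + 1) * ((max (max a 0) (max b 0)) ^ r * |α - β| ^ r)
      ≤ hPow r (a - b) * (max a 0 * α ^ r - max b 0 * β ^ r) := by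
  have hzw : max b 0 ≤ max a 0 := max_le_max_right 0 hba
  rw [max_eq_left hzw]
  have key := rpow_sub_mul_sub_lower hr (le_max_right b 0) hzw hα hβ
  refine key.trans ?_
  rw [hPow_of_nonneg hr (sub_nonneg.2 hba)]
  rcases le_total (max b 0 * β ^ r) (max a 0 * α ^ r) with h | h
  · apply mul_le_mul_of_nonneg_right _ (sub_nonneg.2 h)
    apply Real.rpow_le_rpow (sub_nonneg.2 hzw) _ (by linarith)
    rcases le_total a 0 with ha | ha <;> rcases le_total b 0 with hb | hb <;>
      simp [ha, hb] <;> linarith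
  · rcases le_or_gt b 0 with hb | hb
    · have : max a 0 * α ^ r = 0 := by
        apply le_antisymm
        · rw [max_eq_right hb] at h; simpa using h
        · have := Real.rpow_nonneg hα r
          positivity
      rw [this, max_eq_right hb]; simp
    · rw [max_eq_left hb.le, max_eq_left (hb.le.trans hba)]

/-- The pointwise inequality behind the Caccioppoli estimate. -/
theorem hPow_mul_sub_lower {r : ℝ} (a b : ℝ) {α β : ℝ} (hr : 1 < r)
    (hα : 0 ≤ α) (hβ : 0 ≤ β) :
    2⁻¹ * (2 ^ r)⁻¹ * |max a 0 * α - max b 0 * β| ^ r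
        - ((2 * r) ^ r + 1) * ((max (max a 0) (max b 0)) ^ r * |α - β| ^ r)
      ≤ hPow r (a - b) * (max a 0 * α ^ r - max b 0 * β ^ r) := by
  rcases le_total b a with h | h
  · exact hPow_mul_sub_lower_of_le hr h hα hβ
  · have := hPow_mul_sub_lower_of_le hr h hβ hα
    rw [abs_sub_comm, abs_sub_comm α β, max_comm (max a 0)]
    refine this.trans (le_of_eq ?_)
    rw [← neg_sub a b, hPow_neg]; ring

/-- The sign of the long-range interaction. -/
theorem hPow_mul_max_lower {r : ℝ} (a b : ℝ) {η : ℝ} (hr : 1 < r) (hη : 0 ≤ η) :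
    -((max b 0) ^ (r - 1) * (max a 0 * η)) ≤ hPow r (a - b) * (max a 0 * η) := by
  have h0 : 0 ≤ max a 0 * η := mul_nonneg (le_max_right _ _) hη
  have hb0 : 0 ≤ (max b 0) ^ (r - 1) := Real.rpow_nonneg (le_max_right _ _) _
  rcases le_total b a with h | h
  · have h1 : 0 ≤ hPow r (a - b) := by
      rw [hPow_of_nonneg hr (sub_nonneg.2 h)]
      exact Real.rpow_nonneg (sub_nonneg.2 h) _
    nlinarith [mul_nonneg h1 h0, mul_nonneg hb0 h0]
  · rcases le_total a 0 with ha | ha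
    · simp [max_eq_right ha]
    · rw [← neg_sub b a, hPow_neg, hPow_of_nonneg hr (sub_nonneg.2 h), neg_mul]
      apply neg_le_neg
      apply mul_le_mul_of_nonneg_right _ h0
      rw [max_eq_left (ha.trans h)]
      exact Real.rpow_le_rpow (sub_nonneg.2 h) (by linarith) (by linarith)

/-! ### The fractional Sobolev inequality -/

/-- The Gagliardo energy on the whole space, with kernel `|x-y|^(-N-τ)`. -/
noncomputable def energy {N : ℕ} (r τ : ℝ) (f : RN N → ℝ) : ℝ≥0∞ :=
  ∫⁻ x, ∫⁻ y, ENNReal.ofReal (|f x - f y| ^ r / ‖x - y‖ ^ ((N : ℝ) + τ))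

theorem gagliardo_univ {N : ℕ} (σ r : ℝ) (f : RN N → ℝ) :
    gagliardo σ r univ f = energy r (σ * r) f := by
  simp [gagliardo, energy]

theorem setLIntegral_rpow_le {α : Type*} [MeasurableSpace α] {μ : Measure α} {F : α → ℝ≥0∞}
    (hF : AEMeasurable F μ) (S : Set α) {θ : ℝ} (h0 : 0 ≤ θ) (h1 : θ ≤ 1) :
    ∫⁻ x in S, F x ^ θ ∂μ ≤ (∫⁻ x in S, F x ∂μ) ^ θ * μ S ^ (1 - θ) := by
  have := ENNReal.lintegral_mul_norm_pow_le (μ := μ.restrict S) hF.restrict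
    (aemeasurable_const (b := (1 : ℝ≥0∞))) h0 (sub_nonneg.2 h1) (by ring)
  simpa using this

theorem volume_ball_eq {N : ℕ} (hN : 1 ≤ N) (x : RN N) {ρ : ℝ} (hρ : 0 < ρ) :
    volume (Metric.ball x ρ)
      = ENNReal.ofReal ((volume (Metric.ball (0 : RN N) 1)).toReal * ρ ^ (N : ℝ)) := by
  have : Nonempty (Fin N) := ⟨⟨0, hN⟩⟩
  rw [Measure.addHaar_ball _ _ hρ.le, finrank_euclideanSpace, Fintype.card_fin, mul_comm,
    ENNReal.ofReal_mul ENNReal.toReal_nonneg,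
    ENNReal.ofReal_toReal measure_ball_lt_top.ne, Real.rpow_natCast]

theorem volume_ball_one_pos {N : ℕ} : 0 < (volume (Metric.ball (0 : RN N) 1)).toReal :=
  ENNReal.toReal_pos (Metric.measure_ball_pos _ _ one_pos).ne' measure_ball_lt_top.ne

theorem abs_rpow_mul_volume_ball_le {N : ℕ} {r m τ : ℝ} (hr : 1 ≤ r) (hrm : r ≤ m)
    (hτ : 0 < τ) {f : RN N → ℝ} (hf : Measurable f) (x : RN N) {ρ : ℝ} (hρ : 0 < ρ) :
    ENNReal.ofReal (|f x| ^ r) * volume (Metric.ball x ρ) ≤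
      ENNReal.ofReal (2 ^ r) * (ENNReal.ofReal (ρ ^ ((N : ℝ) + τ)) *
        (∫⁻ y, ENNReal.ofReal (|f x - f y| ^ r / ‖x - y‖ ^ ((N : ℝ) + τ)))
        + (∫⁻ y, ENNReal.ofReal (|f y| ^ m)) ^ (r / m) *
          volume (Metric.ball x ρ) ^ (1 - r / m)) := by
  have hm : 0 < m := by linarith
  have hNτ : 0 < (N : ℝ) + τ := by positivity
  calc ENNReal.ofReal (|f x| ^ r) * volume (Metric.ball x ρ)
      = ∫⁻ y in Metric.ball x ρ, ENNReal.ofReal (|f x| ^ r) := by simp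
    _ ≤ ∫⁻ y in Metric.ball x ρ, ENNReal.ofReal (2 ^ r) * (ENNReal.ofReal (ρ ^ ((N : ℝ) + τ)) *
          ENNReal.ofReal (|f x - f y| ^ r / ‖x - y‖ ^ ((N : ℝ) + τ))
          + ENNReal.ofReal (|f y| ^ m) ^ (r / m)) := by
        apply setLIntegral_mono (by fun_prop)
        intro y hy
        rw [ENNReal.ofReal_rpow_of_nonneg (by positivity) (by positivity),
          ← ENNReal.ofReal_mul (by positivity), ← ENNReal.ofReal_add (by positivity)
          (by positivity), ← ENNReal.ofReal_mul (by positivity)]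
        apply ENNReal.ofReal_le_ofReal
        have e : (|f y| ^ m) ^ (r / m) = |f y| ^ r := by
          rw [← Real.rpow_mul (abs_nonneg _)]; congr 1; field_simp
        rw [e]
        have h1 : |f x| ^ r ≤ (|f x - f y| + |f y|) ^ r := by
          apply Real.rpow_le_rpow (abs_nonneg _) _ (by linarith)
          have := abs_add_le (f x - f y) (f y)
          simpa using this
        refine h1.trans ((rpow_add_le_two_rpow_mul (by linarith) (abs_nonneg _)
          (abs_nonneg _)).trans ?_)
        gcongr
        rcases eq_or_ne x y with rfl | hxy
        · simp [Real.zero_rpow (by linarith : r ≠ 0)]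
        · have hd : 0 < ‖x - y‖ := norm_pos_iff.2 (sub_ne_zero.2 hxy)
          rw [← mul_div_assoc, le_div_iff₀ (by positivity), mul_comm]
          gcongr
          rw [← dist_eq_norm, dist_comm]; exact (Metric.mem_ball.1 hy).le
    _ = ENNReal.ofReal (2 ^ r) * (ENNReal.ofReal (ρ ^ ((N : ℝ) + τ)) *
          (∫⁻ y in Metric.ball x ρ,
            ENNReal.ofReal (|f x - f y| ^ r / ‖x - y‖ ^ ((N : ℝ) + τ)))
          + ∫⁻ y in Metric.ball x ρ, ENNReal.ofReal (|f y| ^ m) ^ (r / m)) := by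
        rw [lintegral_const_mul _ (by fun_prop), lintegral_add_right _ (by fun_prop),
          lintegral_const_mul _ (by fun_prop)]
    _ ≤ _ := by
        gcongr
        · exact Measure.restrict_le_self
        · refine (setLIntegral_rpow_le (by fun_prop) _ (by positivity)
            (by rw [div_le_one hm]; exact hrm)).trans ?_
          gcongr
          exact Measure.restrict_le_self

theorem le_of_forall_scale {n τ A K D Z : ℝ} (hτ : 0 < τ) (hτn : τ < n)
    (hD : 0 ≤ D) (hZ : 0 < Z)
    (h : ∀ ρ : ℝ, 0 < ρ → A ≤ K * (ρ ^ τ * D + Z * ρ ^ (τ - n))) :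
    A ≤ 2 * K * (D ^ (1 - τ / n) * Z ^ (τ / n)) := by
  have hn : 0 < n := hτ.trans hτn
  have hτn' : τ / n < 1 := by rw [div_lt_one hn]; exact hτn
  rcases hD.eq_or_lt with rfl | hD
  · rw [Real.zero_rpow (by linarith), zero_mul, mul_zero]
    have ht : Filter.Tendsto (fun ρ : ℝ => K * (Z * ρ ^ (-(n - τ)))) Filter.atTop
        (nhds (K * (Z * 0))) :=
      ((tendsto_rpow_neg_atTop (sub_pos.2 hτn)).const_mul Z).const_mul K
    rw [mul_zero, mul_zero] at ht
    refine ge_of_tendsto ht ?_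
    filter_upwards [Filter.eventually_gt_atTop 0] with ρ hρ
    have := h ρ hρ
    rw [mul_zero, zero_add] at this
    rwa [neg_sub]
  · have hq : 0 < Z / D := div_pos hZ hD
    have := h ((Z / D) ^ (1 / n)) (Real.rpow_pos_of_pos hq _)
    rw [← Real.rpow_mul hq.le, ← Real.rpow_mul hq.le] at this
    have e1 : (Z / D) ^ (1 / n * τ) * D = D ^ (1 - τ / n) * Z ^ (τ / n) := by
      rw [show 1 / n * τ = τ / n by ring, Real.div_rpow hZ.le hD.le, Real.rpow_sub hD,
        Real.rpow_one]
      ring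
    have e2 : Z * (Z / D) ^ (1 / n * (τ - n)) = D ^ (1 - τ / n) * Z ^ (τ / n) := by
      rw [show 1 / n * (τ - n) = τ / n - 1 by field_simp, Real.rpow_sub hq, Real.rpow_one,
        Real.div_rpow hZ.le hD.le, Real.rpow_sub hD, Real.rpow_one]
      field_simp
    rw [e1, e2] at this
    linarith

theorem exists_sobolev_of_lt_top {N : ℕ} (hN : 1 ≤ N) {r τ : ℝ} (hr : 1 ≤ r) (hτ : 0 < τ)
    (hτN : τ < N) :
    ∃ C : ℝ, 0 < C ∧ ∀ f : RN N → ℝ, Measurable f →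
      ∫⁻ y, ENNReal.ofReal (|f y| ^ (N * r / (N - τ))) < ⊤ →
      (∫⁻ y, ENNReal.ofReal (|f y| ^ (N * r / (N - τ)))) ^ (1 - τ / N)
        ≤ ENNReal.ofReal C * energy r τ f := by
  set c := (volume (Metric.ball (0 : RN N) 1)).toReal with hc
  have hc0 : 0 < c := volume_ball_one_pos
  have hn : (0 : ℝ) < N := by positivity
  have hNτ : 0 < (N : ℝ) - τ := sub_pos.2 hτN
  set m := N * r / (N - τ) with hm
  have hr0 : 0 < r := by linarith
  have hm0 : 0 < m := by positivity
  have hrm : r ≤ m := by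
    rw [hm, le_div_iff₀ hNτ]; nlinarith
  have hrm1 : r / m = 1 - τ / N := by rw [hm]; field_simp
  have hrm0 : 0 < r / m := by positivity
  set K := 2 ^ r * (1 / c + c ^ (-(r / m))) with hK
  have hK0 : 0 < K := by positivity
  refine ⟨(2 * K) ^ (m / r), by positivity, fun f hf hX => ?_⟩
  set X := ∫⁻ y, ENNReal.ofReal (|f y| ^ m) with hXdef
  rcases eq_or_ne X 0 with h0 | h0
  · rw [h0, ENNReal.zero_rpow_of_pos (by rw [← hrm1]; exact hrm0)]; exact zero_le
  set D : RN N → ℝ≥0∞ := fun x =>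
    ∫⁻ y, ENNReal.ofReal (|f x - f y| ^ r / ‖x - y‖ ^ ((N : ℝ) + τ)) with hD
  set Z := X.toReal ^ (r / m) with hZ
  have hXr : 0 < X.toReal := ENNReal.toReal_pos h0 hX.ne
  have hZ0 : 0 < Z := Real.rpow_pos_of_pos hXr _
  have hXt : X ^ (τ / N) ≠ ⊤ := ENNReal.rpow_ne_top_of_nonneg (by positivity) hX.ne
  have hX0 : X ^ (τ / N) ≠ 0 := by
    simp [ENNReal.rpow_eq_zero_iff, h0, hX.ne]
  have main : ∀ x, ENNReal.ofReal (|f x| ^ m)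
      ≤ ENNReal.ofReal ((2 * K) ^ (m / r)) * D x * X ^ (τ / N) := by
    intro x
    rcases eq_or_ne (D x) ⊤ with hDt | hDt
    · rw [hDt, ENNReal.mul_top (by simp; positivity), ENNReal.top_mul hX0]; exact le_top
    have hsc : ∀ ρ : ℝ, 0 < ρ → |f x| ^ r ≤ K * (ρ ^ τ * (D x).toReal + Z * ρ ^ (τ - N)) := by
      intro ρ hρ
      have := abs_rpow_mul_volume_ball_le (m := m) hr hrm hτ hf x hρ
      rw [volume_ball_eq hN x hρ, ← hc] at this
      change _ ≤ ENNReal.ofReal (2 ^ r) * (ENNReal.ofReal (ρ ^ ((N : ℝ) + τ)) * D x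
        + X ^ (r / m) * _) at this
      rw [← ENNReal.ofReal_toReal hDt, ← ENNReal.ofReal_toReal hX.ne,
        ENNReal.ofReal_rpow_of_nonneg ENNReal.toReal_nonneg hrm0.le,
        ENNReal.ofReal_rpow_of_nonneg (by positivity) (by rw [hrm1]; simp; positivity),
        ← ENNReal.ofReal_mul (by positivity), ← ENNReal.ofReal_mul (by positivity),
        ← ENNReal.ofReal_mul (by positivity), ← ENNReal.ofReal_add (by positivity)
        (by positivity), ← ENNReal.ofReal_mul (by positivity),
        ENNReal.ofReal_le_ofReal_iff (by positivity)] at this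
      have hcρ : 0 < c * ρ ^ (N : ℝ) := by positivity
      rw [← le_div_iff₀ hcρ] at this
      refine this.trans ?_
      have e : 2 ^ r * (ρ ^ ((N : ℝ) + τ) * (D x).toReal
          + X.toReal ^ (r / m) * (c * ρ ^ (N : ℝ)) ^ (1 - r / m)) / (c * ρ ^ (N : ℝ))
          = 2 ^ r * (1 / c * (ρ ^ τ * (D x).toReal) + c ^ (-(r / m)) * (Z * ρ ^ (τ - N))) := by
        rw [Real.mul_rpow hc0.le (by positivity), ← Real.rpow_mul hρ.le,
          Real.rpow_sub hc0, Real.rpow_one, Real.rpow_neg hc0.le, Real.rpow_add hρ, hrm1,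
          show (N : ℝ) * (1 - (1 - τ / N)) = τ by field_simp; ring, Real.rpow_sub hρ, hZ, hrm1]
        field_simp
      rw [e, hK, mul_assoc]
      have a1 : 0 ≤ ρ ^ τ * (D x).toReal := by positivity
      have a2 : 0 ≤ Z * ρ ^ (τ - N) := by positivity
      have a3 : 0 < c ^ (-(r / m)) := by positivity
      have a4 : 0 < 1 / c := by positivity
      have : 1 / c * (ρ ^ τ * (D x).toReal) + c ^ (-(r / m)) * (Z * ρ ^ (τ - N))
        ≤ (1 / c + c ^ (-(r / m))) * (ρ ^ τ * (D x).toReal + Z * ρ ^ (τ - N)) := by nlinarith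
      gcongr
    have hA := le_of_forall_scale hτ hτN ENNReal.toReal_nonneg hZ0 hsc
    have hA2 := Real.rpow_le_rpow (by positivity) hA (by positivity : 0 ≤ m / r)
    have hf2 : ((D x).toReal ^ (1 - τ / N) * Z ^ (τ / N)) ^ (m / r)
        = (D x).toReal * X.toReal ^ (τ / N) := by
      rw [Real.mul_rpow (by positivity) (by positivity), ← Real.rpow_mul ENNReal.toReal_nonneg,
        ← Real.rpow_mul hZ0.le, ← hrm1, show r / m * (m / r) = 1 by field_simp, Real.rpow_one,
        hZ, ← Real.rpow_mul hXr.le, show r / m * (τ / N * (m / r)) = τ / N by field_simp]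
    rw [← Real.rpow_mul (abs_nonneg _), show r * (m / r) = m by field_simp,
      Real.mul_rpow (x := 2 * K) (by positivity) (by positivity), hf2, ← mul_assoc] at hA2
    refine (ENNReal.ofReal_le_ofReal hA2).trans (le_of_eq ?_)
    rw [ENNReal.ofReal_mul (by positivity), ENNReal.ofReal_mul (by positivity),
      ENNReal.ofReal_toReal hDt, ← ENNReal.ofReal_rpow_of_nonneg ENNReal.toReal_nonneg
      (by positivity), ENNReal.ofReal_toReal hX.ne]
  have hint : X ≤ ENNReal.ofReal ((2 * K) ^ (m / r)) * energy r τ f * X ^ (τ / N) := by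
    calc X ≤ ∫⁻ x, ENNReal.ofReal ((2 * K) ^ (m / r)) * D x * X ^ (τ / N) := lintegral_mono main
      _ = _ := by
        rw [lintegral_mul_const' _ _ hXt, lintegral_const_mul' _ _ ENNReal.ofReal_ne_top]; rfl
  have : X ^ (1 - τ / N) = X / X ^ (τ / N) := by
    rw [ENNReal.rpow_sub _ _ h0 hX.ne, ENNReal.rpow_one]
  rw [this]
  exact ENNReal.div_le_of_le_mul hint

/-- The fractional Sobolev inequality on `ℝ^N`. -/
theorem exists_sobolev {N : ℕ} (hN : 1 ≤ N) {r τ : ℝ} (hr : 1 ≤ r) (hτ : 0 < τ)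
    (hτN : τ < N) :
    ∃ C : ℝ, 0 < C ∧ ∀ f : RN N → ℝ, Measurable f →
      ∫⁻ y, ENNReal.ofReal (|f y| ^ r) < ⊤ →
      (∫⁻ y, ENNReal.ofReal (|f y| ^ (N * r / (N - τ)))) ^ (1 - τ / N)
        ≤ ENNReal.ofReal C * energy r τ f := by
  obtain ⟨C, hC, hS⟩ := exists_sobolev_of_lt_top hN hr hτ hτN
  refine ⟨C, hC, fun f hf hfr => ?_⟩
  have hn : (0 : ℝ) < N := by positivity
  have hNτ : 0 < (N : ℝ) - τ := sub_pos.2 hτN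
  set m := N * r / (N - τ) with hm
  have hr0 : 0 < r := by linarith
  have hm0 : 0 < m := by positivity
  have hrm : r ≤ m := by
    rw [hm, le_div_iff₀ hNτ]; nlinarith
  have hθ : 0 < 1 - τ / N := by rw [sub_pos, div_lt_one hn]; exact hτN
  set g : ℕ → RN N → ℝ := fun n x => min |f x| n with hg
  have hg0 : ∀ n x, 0 ≤ g n x := fun n x => le_min (abs_nonneg _) (Nat.cast_nonneg n)
  have hgm : ∀ n, Measurable (g n) := fun n => by simp only [hg]; fun_prop
  have hbound : ∀ n, ∫⁻ y, ENNReal.ofReal (|g n y| ^ m)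
      ≤ (ENNReal.ofReal C * energy r τ f) ^ (1 - τ / N)⁻¹ := by
    intro n
    rw [ENNReal.le_rpow_inv_iff hθ]
    have hfin : ∫⁻ y, ENNReal.ofReal (|g n y| ^ m) < ⊤ := by
      calc ∫⁻ y, ENNReal.ofReal (|g n y| ^ m)
          ≤ ∫⁻ y, ENNReal.ofReal ((n : ℝ) ^ (m - r)) * ENNReal.ofReal (|f y| ^ r) := by
            apply lintegral_mono
            intro y
            simp only
            rw [← ENNReal.ofReal_mul (by positivity)]
            apply ENNReal.ofReal_le_ofReal
            rw [abs_of_nonneg (hg0 n y)]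
            have h1 : g n y ^ m = g n y ^ (m - r) * g n y ^ r := by
              rw [← Real.rpow_add_of_nonneg (hg0 n y) (sub_nonneg.2 hrm) hr0.le]; congr 1; ring
            rw [h1]
            have a1 := hg0 n y
            have a2 : g n y ≤ n := min_le_right _ _
            have a3 : g n y ≤ |f y| := min_le_left _ _
            have a4 : 0 ≤ m - r := sub_nonneg.2 hrm
            gcongr
        _ < ⊤ := by
            rw [lintegral_const_mul' _ _ ENNReal.ofReal_ne_top]
            exact ENNReal.mul_lt_top ENNReal.ofReal_lt_top hfr
    refine (hS (g n) (hgm n) hfin).trans ?_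
    gcongr
    refine lintegral_mono fun x => lintegral_mono fun y => ENNReal.ofReal_le_ofReal ?_
    refine div_le_div_of_nonneg_right (Real.rpow_le_rpow (abs_nonneg _) ?_ hr0.le)
      (by positivity)
    refine (abs_min_sub_min_le_max |f x| (n : ℝ) |f y| (n : ℝ)).trans ?_
    rw [sub_self, abs_zero]
    exact max_le (abs_abs_sub_abs_le _ _) (abs_nonneg _)
  have hsup : ∀ y, ENNReal.ofReal (|f y| ^ m) = ⨆ n, ENNReal.ofReal (|g n y| ^ m) := by
    intro y
    apply le_antisymm
    · obtain ⟨n, hn⟩ := exists_nat_ge |f y|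
      refine le_trans ?_ (le_iSup _ n)
      simp [hg, min_eq_left hn]
    · refine iSup_le fun n => ENNReal.ofReal_le_ofReal ?_
      rw [abs_of_nonneg (hg0 n y)]
      exact Real.rpow_le_rpow (hg0 n y) (min_le_left _ _) hm0.le
  have htot : ∫⁻ y, ENNReal.ofReal (|f y| ^ m)
      ≤ (ENNReal.ofReal C * energy r τ f) ^ (1 - τ / N)⁻¹ := by
    simp_rw [hsup]
    rw [lintegral_iSup (fun n => by have := hgm n; fun_prop)]
    · exact iSup_le hbound
    · intro i j hij y
      apply ENNReal.ofReal_le_ofReal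
      rw [abs_of_nonneg (hg0 i y), abs_of_nonneg (hg0 j y)]
      exact Real.rpow_le_rpow (hg0 i y) (min_le_min_left _ (by exact_mod_cast hij)) hm0.le
  rwa [ENNReal.le_rpow_inv_iff hθ] at htot

/-! ### Energy comparison, gain of integrability, products with cutoffs -/

theorem lintegral_lintegral_add_mul_le {N : ℕ} {m : RN N → RN N → ℝ≥0∞}
    (hm : Measurable (Function.uncurry m)) (hsymm : ∀ x y, m x y = m y x) {B : ℝ≥0∞}
    (hB : ∀ x, ∫⁻ y, m x y ≤ B) {F : RN N → ℝ≥0∞} (hF : Measurable F) :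
    ∫⁻ x, ∫⁻ y, (F x + F y) * m x y ≤ 2 * B * ∫⁻ x, F x := by
  have hmx : ∀ x, Measurable (m x) := fun x => hm.comp measurable_prodMk_left
  have h1 : ∫⁻ x, ∫⁻ y, F x * m x y ≤ B * ∫⁻ x, F x := by
    rw [← lintegral_const_mul _ hF]
    refine lintegral_mono fun x => ?_
    rw [lintegral_const_mul _ (hmx x), mul_comm]
    gcongr
    exact hB x
  have h2 : ∫⁻ x, ∫⁻ y, F y * m x y ≤ B * ∫⁻ x, F x := by
    rw [lintegral_lintegral_swap (by
      apply Measurable.aemeasurable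
      exact (hF.comp measurable_snd).mul hm)]
    simp_rw [hsymm]
    simpa [hsymm] using h1
  calc ∫⁻ x, ∫⁻ y, (F x + F y) * m x y
      = (∫⁻ x, ∫⁻ y, F x * m x y) + (∫⁻ x, ∫⁻ y, F y * m x y) := by
        rw [← lintegral_add_left]
        · refine lintegral_congr fun x => ?_
          rw [← lintegral_add_left]
          · simp_rw [add_mul]
          · exact (hmx x).const_mul _
        · exact Measurable.lintegral_prod_right' (f := fun z : RN N × RN N => F z.1 * m z.1 z.2)
            ((hF.comp measurable_fst).mul hm)
    _ ≤ (B * ∫⁻ x, F x) + (B * ∫⁻ x, F x) := add_le_add h1 h2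
    _ = _ := by rw [mul_assoc, two_mul]

/-- The weight `min(1, L|x-y|)^r / |x-y|^(N+τ)`. -/
noncomputable def minKernel {N : ℕ} (r τ L : ℝ) (x y : RN N) : ℝ :=
  (min 1 (L * ‖x - y‖)) ^ r / ‖x - y‖ ^ ((N : ℝ) + τ)

theorem measurable_minKernel {N : ℕ} (r τ L : ℝ) :
    Measurable (Function.uncurry fun x y : RN N => ENNReal.ofReal (minKernel r τ L x y)) := by
  unfold minKernel Function.uncurry; fun_prop

theorem minKernel_symm {N : ℕ} (r τ L : ℝ) (x y : RN N) :
    minKernel r τ L x y = minKernel r τ L y x := by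
  unfold minKernel; rw [norm_sub_rev]

theorem minKernel_nonneg {N : ℕ} {r τ L : ℝ} (hL : 0 ≤ L) (x y : RN N) :
    0 ≤ minKernel r τ L x y := by
  have : 0 ≤ min 1 (L * ‖x - y‖) := le_min zero_le_one (by positivity)
  unfold minKernel; positivity

theorem exists_lintegral_add_mul_minKernel_le {N : ℕ} (hN : 1 ≤ N) {r τ : ℝ} (hτ : 0 < τ)
    (hτr : τ < r) :
    ∃ K : ℝ, 0 < K ∧ ∀ L : ℝ, 0 < L → ∀ F : RN N → ℝ≥0∞, Measurable F →
      ∫⁻ x, ∫⁻ y, (F x + F y) * ENNReal.ofReal (minKernel r τ L x y)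
        ≤ ENNReal.ofReal (K * L ^ τ) * ∫⁻ x, F x := by
  obtain ⟨K, hK, h⟩ := exists_lintegral_min_rpow_div_le hN hτ hτr
  refine ⟨2 * K, by positivity, fun L hL F hF => ?_⟩
  have := lintegral_lintegral_add_mul_le (measurable_minKernel r τ L)
    (fun x y => by rw [minKernel_symm]) (h L hL) hF
  rw [mul_assoc, ENNReal.ofReal_mul zero_le_two]
  simpa using this

theorem measurable_abs_sub_rpow_div {N : ℕ} {f : RN N → ℝ} (hf : Measurable f) (r e : ℝ) :
    Measurable (fun z : RN N × RN N =>
      ENNReal.ofReal (|f z.1 - f z.2| ^ r / ‖z.1 - z.2‖ ^ e)) := by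
  fun_prop

theorem abs_sub_rpow_div_le {N : ℕ} {r κ τ R : ℝ} (hr : 1 ≤ r) (hκτ : κ ≤ τ) (hR : 0 < R)
    (f : RN N → ℝ) (x y : RN N) :
    |f x - f y| ^ r / ‖x - y‖ ^ ((N : ℝ) + κ) ≤
      R ^ (τ - κ) * (|f x - f y| ^ r / ‖x - y‖ ^ ((N : ℝ) + τ))
      + 2 ^ r * ((|f x| ^ r + |f y| ^ r) * minKernel (κ + 1) κ R⁻¹ x y) := by
  have hmk := minKernel_nonneg (r := κ + 1) (τ := κ) (inv_pos.2 hR).le x y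
  rcases eq_or_ne x y with rfl | hxy
  · simp only [sub_self, abs_zero, Real.zero_rpow (by linarith : r ≠ 0), zero_div, mul_zero,
      zero_add]
    positivity
  have hd : 0 < ‖x - y‖ := norm_pos_iff.2 (sub_ne_zero.2 hxy)
  generalize hdd : ‖x - y‖ = d at *
  rcases le_total d R with hdR | hdR
  · refine le_add_of_le_of_nonneg ?_ (by positivity)
    have h1 : d ^ (τ - κ) ≤ R ^ (τ - κ) := Real.rpow_le_rpow hd.le hdR (sub_nonneg.2 hκτ)
    have e : |f x - f y| ^ r / d ^ ((N : ℝ) + κ)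
        = d ^ (τ - κ) * (|f x - f y| ^ r / d ^ ((N : ℝ) + τ)) := by
      rw [show (N : ℝ) + τ = (τ - κ) + ((N : ℝ) + κ) by ring, Real.rpow_add hd (τ - κ),
        ← mul_div_assoc, mul_div_mul_left _ _ (Real.rpow_pos_of_pos hd _).ne']
    rw [e]
    gcongr
  · refine le_add_of_nonneg_of_le (by positivity) ?_
    have e : minKernel (κ + 1) κ R⁻¹ x y = 1 / d ^ ((N : ℝ) + κ) := by
      unfold minKernel
      rw [hdd, min_eq_left, Real.one_rpow]
      rw [← div_eq_inv_mul, le_div_iff₀ hR]; linarith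
    rw [e, ← mul_assoc, ← mul_div_assoc, mul_one]
    gcongr
    refine le_trans ?_ (rpow_add_le_two_rpow_mul (by linarith) (abs_nonneg _) (abs_nonneg _))
    exact Real.rpow_le_rpow (abs_nonneg _) (abs_sub _ _) (by linarith)

theorem exists_energy_le {N : ℕ} (hN : 1 ≤ N) {r κ : ℝ} (hr : 1 ≤ r) (hκ : 0 < κ) :
    ∃ K : ℝ, 0 < K ∧ ∀ τ : ℝ, κ ≤ τ → ∀ R : ℝ, 0 < R → ∀ f : RN N → ℝ, Measurable f →
      energy r κ f ≤ ENNReal.ofReal (R ^ (τ - κ)) * energy r τ f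
        + ENNReal.ofReal (K * R ^ (-κ)) * ∫⁻ x, ENNReal.ofReal (|f x| ^ r) := by
  obtain ⟨K, hK, h⟩ := exists_lintegral_add_mul_minKernel_le hN hκ (lt_add_one κ)
  refine ⟨2 ^ r * K, by positivity, fun τ hτ R hR f hf => ?_⟩
  have hL : 0 < R⁻¹ := inv_pos.2 hR
  have hpt : ∀ x y : RN N, ENNReal.ofReal (|f x - f y| ^ r / ‖x - y‖ ^ ((N : ℝ) + κ)) ≤
      ENNReal.ofReal (R ^ (τ - κ)) *
        ENNReal.ofReal (|f x - f y| ^ r / ‖x - y‖ ^ ((N : ℝ) + τ))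
      + ENNReal.ofReal (2 ^ r) * ((ENNReal.ofReal (|f x| ^ r) + ENNReal.ofReal (|f y| ^ r))
        * ENNReal.ofReal (minKernel (κ + 1) κ R⁻¹ x y)) := by
    intro x y
    have hmk := minKernel_nonneg (r := κ + 1) (τ := κ) hL.le x y
    have h1 : 0 ≤ |f x - f y| ^ r / ‖x - y‖ ^ ((N : ℝ) + τ) := by positivity
    have h2 : 0 ≤ R ^ (τ - κ) := by positivity
    have h3 : 0 ≤ |f x| ^ r := by positivity
    have h4 : 0 ≤ |f y| ^ r := by positivity
    have h5 : (0 : ℝ) ≤ 2 ^ r := by positivity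
    refine (ENNReal.ofReal_le_ofReal (abs_sub_rpow_div_le hr hτ hR f x y)).trans (le_of_eq ?_)
    rw [ENNReal.ofReal_add (mul_nonneg h2 h1) (mul_nonneg h5 (mul_nonneg (add_nonneg h3 h4) hmk)),
      ENNReal.ofReal_mul h2, ENNReal.ofReal_mul h5, ENNReal.ofReal_mul (add_nonneg h3 h4),
      ENNReal.ofReal_add h3 h4]
  have hmeas1 := measurable_abs_sub_rpow_div hf r ((N : ℝ) + τ)
  have hmeas1x : ∀ x, Measurable fun y => ENNReal.ofReal (|f x - f y| ^ r / ‖x - y‖ ^ ((N : ℝ) + τ)) :=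
    fun x => by fun_prop
  calc energy r κ f ≤ ∫⁻ x, ∫⁻ y, (ENNReal.ofReal (R ^ (τ - κ)) *
        ENNReal.ofReal (|f x - f y| ^ r / ‖x - y‖ ^ ((N : ℝ) + τ))
      + ENNReal.ofReal (2 ^ r) * ((ENNReal.ofReal (|f x| ^ r) + ENNReal.ofReal (|f y| ^ r))
        * ENNReal.ofReal (minKernel (κ + 1) κ R⁻¹ x y))) :=
        lintegral_mono fun x => lintegral_mono fun y => hpt x y
    _ = ENNReal.ofReal (R ^ (τ - κ)) * energy r τ f + ENNReal.ofReal (2 ^ r) *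
        ∫⁻ x, ∫⁻ y, (ENNReal.ofReal (|f x| ^ r) + ENNReal.ofReal (|f y| ^ r))
        * ENNReal.ofReal (minKernel (κ + 1) κ R⁻¹ x y) := by
        unfold energy
        rw [← lintegral_const_mul' _ _ ENNReal.ofReal_ne_top,
          ← lintegral_const_mul' _ _ ENNReal.ofReal_ne_top, ← lintegral_add_left]
        · refine lintegral_congr fun x => ?_
          rw [lintegral_add_left ((hmeas1x x).const_mul _),
            lintegral_const_mul' _ _ ENNReal.ofReal_ne_top,
            lintegral_const_mul' _ _ ENNReal.ofReal_ne_top]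
        · exact (Measurable.lintegral_prod_right' hmeas1).const_mul _
    _ ≤ _ := by
        refine add_le_add le_rfl ?_
        have h1 := h R⁻¹ hL (fun x => ENNReal.ofReal (|f x| ^ r)) (by fun_prop)
        have e : ENNReal.ofReal (2 ^ r * K * R ^ (-κ))
            = ENNReal.ofReal (2 ^ r) * ENNReal.ofReal (K * R⁻¹ ^ κ) := by
          rw [← ENNReal.ofReal_mul (by positivity), Real.inv_rpow hR.le, ← Real.rpow_neg hR.le,
            mul_assoc]
        rw [e, mul_assoc]
        gcongr

theorem exists_sobolev_scaled {N : ℕ} (hN : 1 ≤ N) {r κ : ℝ} (hr : 1 ≤ r) (hκ : 0 < κ)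
    (hκN : κ < N) :
    ∃ C : ℝ, 0 < C ∧ ∀ τ : ℝ, κ ≤ τ → ∀ R : ℝ, 0 < R → ∀ f : RN N → ℝ, Measurable f →
      ∫⁻ y, ENNReal.ofReal (|f y| ^ r) < ⊤ →
      (∫⁻ y, ENNReal.ofReal (|f y| ^ (N * r / (N - κ)))) ^ (1 - κ / N)
        ≤ ENNReal.ofReal (C * R ^ (τ - κ)) * energy r τ f
          + ENNReal.ofReal (C * R ^ (-κ)) * ∫⁻ x, ENNReal.ofReal (|f x| ^ r) := by
  obtain ⟨C, hC, hS⟩ := exists_sobolev hN hr hκ hκN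
  obtain ⟨K, hK, hE⟩ := exists_energy_le hN hr hκ
  refine ⟨C * (1 + K), by positivity, fun τ hτ R hR f hf hfr => ?_⟩
  refine (hS f hf hfr).trans ((mul_le_mul_right (hE τ hτ R hR f hf) _).trans ?_)
  rw [mul_add, ← mul_assoc, ← mul_assoc, ← ENNReal.ofReal_mul hC.le, ← ENNReal.ofReal_mul hC.le]
  have h1 : 0 ≤ C * R ^ (τ - κ) := by positivity
  have h2 : 0 ≤ C * R ^ (-κ) := by positivity
  gcongr ENNReal.ofReal ?_ * _ + ENNReal.ofReal ?_ * _
  · nlinarith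
  · nlinarith

theorem exists_gain {N : ℕ} (hN : 1 ≤ N) {r κ : ℝ} (hr : 1 ≤ r) (hκ : 0 < κ) (hκN : κ < N) :
    ∃ C : ℝ, 0 < C ∧ ∀ τ : ℝ, κ ≤ τ → ∀ R : ℝ, 0 < R → ∀ f : RN N → ℝ, Measurable f →
      ∫⁻ y, ENNReal.ofReal (|f y| ^ r) < ⊤ → ∀ S : Set (RN N), (∀ x, x ∉ S → f x = 0) →
      ∫⁻ y, ENNReal.ofReal (|f y| ^ r)
        ≤ volume S ^ (κ / N) * (ENNReal.ofReal (C * R ^ (τ - κ)) * energy r τ f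
          + ENNReal.ofReal (C * R ^ (-κ)) * ∫⁻ x, ENNReal.ofReal (|f x| ^ r)) := by
  obtain ⟨C, hC, hS⟩ := exists_sobolev_scaled hN hr hκ hκN
  refine ⟨C, hC, fun τ hτ R hR f hf hfr S hfS => ?_⟩
  have hn : (0 : ℝ) < N := by positivity
  have hNκ : 0 < (N : ℝ) - κ := sub_pos.2 hκN
  have hr0 : 0 < r := by linarith
  have hθ : 0 < 1 - κ / N := by rw [sub_pos, div_lt_one hn]; exact hκN
  have hsub : ∫⁻ y, ENNReal.ofReal (|f y| ^ r) = ∫⁻ y in S, ENNReal.ofReal (|f y| ^ r) := by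
    refine (setLIntegral_eq_of_support_subset ?_).symm
    intro x hx
    by_contra hxS
    apply hx
    simp [hfS x hxS, Real.zero_rpow hr0.ne']
  have e : ∀ y, ENNReal.ofReal (|f y| ^ r)
      = ENNReal.ofReal (|f y| ^ (N * r / (N - κ))) ^ (1 - κ / N) := by
    intro y
    rw [ENNReal.ofReal_rpow_of_nonneg (by positivity) hθ.le, ← Real.rpow_mul (abs_nonneg _)]
    congr 2
    field_simp
  calc ∫⁻ y, ENNReal.ofReal (|f y| ^ r)
      = ∫⁻ y in S, ENNReal.ofReal (|f y| ^ (N * r / (N - κ))) ^ (1 - κ / N) := by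
        rw [hsub]; exact lintegral_congr fun y => e y
    _ ≤ (∫⁻ y in S, ENNReal.ofReal (|f y| ^ (N * r / (N - κ)))) ^ (1 - κ / N)
        * volume S ^ (1 - (1 - κ / N)) :=
        setLIntegral_rpow_le (by fun_prop) S hθ.le (by have : 0 < κ / N := by positivity
                                                       linarith)
    _ ≤ (∫⁻ y, ENNReal.ofReal (|f y| ^ (N * r / (N - κ)))) ^ (1 - κ / N)
        * volume S ^ (1 - (1 - κ / N)) := by
        gcongr
        exact Measure.restrict_le_self
    _ ≤ _ := by
        rw [sub_sub_cancel, mul_comm]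
        gcongr
        exact hS τ hτ R hR f hf hfr

/-- A function with values in `[0,1]` that vanishes off `U` and is Lipschitz with constant
comparable to `L`. -/
structure IsCutoff {N : ℕ} (U : Set (RN N)) (A L : ℝ) (ψ : RN N → ℝ) : Prop where
  measurable : Measurable ψ
  abs_le : ∀ x, |ψ x| ≤ A
  abs_sub_le : ∀ x y, |ψ x - ψ y| ≤ A * min 1 (L * ‖x - y‖)
  eq_zero : ∀ x, x ∉ U → ψ x = 0

theorem IsCutoff.abs_mul_sub_mul_rpow_le {N : ℕ} {U : Set (RN N)} {A L r : ℝ} {ψ : RN N → ℝ}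
    (hψ : IsCutoff U A L ψ) (hr : 0 < r) (hL : 0 ≤ L) (u : RN N → ℝ) (x y : RN N) :
    |u x * ψ x - u y * ψ y| ^ r ≤ (2 * A) ^ r *
      (U.indicator 1 x * U.indicator 1 y * |u x - u y| ^ r
      + (U.indicator (fun x => |u x| ^ r) x + U.indicator (fun x => |u x| ^ r) y)
        * (min 1 (L * ‖x - y‖)) ^ r) := by
  have hA : 0 ≤ A := (abs_nonneg _).trans (hψ.abs_le x)
  have hr' := hr.le
  have hmin : 0 ≤ min 1 (L * ‖x - y‖) := le_min zero_le_one (by positivity)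
  have aux : ∀ v : ℝ, |v * (ψ x - ψ y)| ^ r
      ≤ A ^ r * (|v| ^ r * (min 1 (L * ‖x - y‖)) ^ r) := by
    intro v
    rw [abs_mul, Real.mul_rpow (abs_nonneg _) (abs_nonneg _)]
    have := Real.rpow_le_rpow (abs_nonneg _) (hψ.abs_sub_le x y) hr'
    rw [Real.mul_rpow hA hmin] at this
    have hv := Real.rpow_nonneg (abs_nonneg v) r
    nlinarith
  have h2 : (1 : ℝ) ≤ 2 ^ r := Real.one_le_rpow one_le_two hr'
  have hAr : 0 ≤ A ^ r := by positivity
  rw [Real.mul_rpow zero_le_two hA]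
  by_cases hx : x ∈ U <;> by_cases hy : y ∈ U
  · simp only [hx, hy, indicator_of_mem, Pi.one_apply, one_mul]
    have h1 : |u x * ψ x - u y * ψ y| ≤ |(u x - u y) * ψ x| + |u y * (ψ x - ψ y)| := by
      have e : u x * ψ x - u y * ψ y = (u x - u y) * ψ x + u y * (ψ x - ψ y) := by ring
      rw [e]
      exact abs_add_le _ _
    have h3 := (Real.rpow_le_rpow (abs_nonneg _) h1 hr').trans
      (rpow_add_le_two_rpow_mul hr' (abs_nonneg _) (abs_nonneg _))
    refine h3.trans ?_
    rw [mul_assoc]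
    gcongr
    have h4 := aux (u y)
    have h5 : |(u x - u y) * ψ x| ^ r ≤ A ^ r * |u x - u y| ^ r := by
      rw [abs_mul, Real.mul_rpow (abs_nonneg _) (abs_nonneg _), mul_comm]
      gcongr
      exact hψ.abs_le x
    have h6 : 0 ≤ A ^ r * (|u x| ^ r * (min 1 (L * ‖x - y‖)) ^ r) := by positivity
    rw [add_mul, mul_add, mul_add]
    linarith
  · have h4 := aux (u x)
    simp only [hx, hy, indicator_of_mem, indicator_of_notMem, not_false_eq_true, Pi.one_apply,
      mul_zero, zero_mul, zero_add, add_zero, hψ.eq_zero y hy, sub_zero] at h4 ⊢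
    have h6 : 0 ≤ A ^ r * (|u x| ^ r * (min 1 (L * ‖x - y‖)) ^ r) := by positivity
    nlinarith
  · have h4 := aux (u y)
    simp only [hx, hy, indicator_of_mem, indicator_of_notMem, not_false_eq_true, Pi.one_apply,
      mul_zero, zero_mul, zero_add, hψ.eq_zero x hx, zero_sub, mul_neg, abs_neg] at h4 ⊢
    have h6 : 0 ≤ A ^ r * (|u y| ^ r * (min 1 (L * ‖x - y‖)) ^ r) := by positivity
    nlinarith
  · simp only [hx, hy, indicator_of_notMem, not_false_eq_true, hψ.eq_zero x hx,
      hψ.eq_zero y hy, mul_zero, sub_zero, abs_zero, zero_mul, add_zero]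
    rw [Real.zero_rpow hr.ne']

/-- The Gagliardo energy over `U`, with kernel `|x-y|^(-N-τ)`. -/
noncomputable def energyOn {N : ℕ} (r τ : ℝ) (U : Set (RN N)) (f : RN N → ℝ) : ℝ≥0∞ :=
  ∫⁻ x in U, ∫⁻ y in U, ENNReal.ofReal (|f x - f y| ^ r / ‖x - y‖ ^ ((N : ℝ) + τ))

theorem exists_energy_mul_cutoff_le {N : ℕ} (hN : 1 ≤ N) {r τ : ℝ} (hτ : 0 < τ) (hτr : τ < r) :
    ∃ K : ℝ, 0 < K ∧ ∀ (U : Set (RN N)), MeasurableSet U → ∀ A L : ℝ, 0 < L →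
      ∀ ψ : RN N → ℝ, IsCutoff U A L ψ → ∀ u : RN N → ℝ, Measurable u →
      energy r τ (fun x => u x * ψ x) ≤ ENNReal.ofReal ((2 * A) ^ r) * (energyOn r τ U u
        + ENNReal.ofReal (K * L ^ τ) * ∫⁻ x in U, ENNReal.ofReal (|u x| ^ r)) := by
  obtain ⟨K, hK, h⟩ := exists_lintegral_add_mul_minKernel_le hN hτ hτr
  refine ⟨K, hK, fun U hU A L hL ψ hψ u hu => ?_⟩
  have hr : 0 < r := hτ.trans hτr
  have hA : 0 ≤ A := (abs_nonneg _).trans (hψ.abs_le 0)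
  set F : RN N → ℝ≥0∞ := U.indicator (fun x => ENNReal.ofReal (|u x| ^ r)) with hF
  have hFm : Measurable F := Measurable.indicator (by fun_prop) hU
  have hFr : ∀ x, F x = ENNReal.ofReal (U.indicator (fun x => |u x| ^ r) x) := by
    intro x; by_cases hx : x ∈ U <;> simp [hF, hx]
  set G : RN N × RN N → ℝ≥0∞ := fun z => (U ×ˢ U).indicator (fun z =>
    ENNReal.ofReal (|u z.1 - u z.2| ^ r / ‖z.1 - z.2‖ ^ ((N : ℝ) + τ))) z with hG
  have hGm : Measurable G := (measurable_abs_sub_rpow_div hu r _).indicator (hU.prod hU)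
  have hpt : ∀ x y : RN N,
      ENNReal.ofReal (|u x * ψ x - u y * ψ y| ^ r / ‖x - y‖ ^ ((N : ℝ) + τ)) ≤
      ENNReal.ofReal ((2 * A) ^ r) * (G (x, y)
        + (F x + F y) * ENNReal.ofReal (minKernel r τ L x y)) := by
    intro x y
    have hi : ∀ x, 0 ≤ U.indicator (fun x => |u x| ^ r) x := fun x =>
      indicator_nonneg (fun x _ => by positivity) x
    have hmk := minKernel_nonneg (r := r) (τ := τ) hL.le x y
    have hG' : G (x, y) = ENNReal.ofReal (U.indicator 1 x * U.indicator 1 y * |u x - u y| ^ r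
        / ‖x - y‖ ^ ((N : ℝ) + τ)) := by
      by_cases hx : x ∈ U <;> by_cases hy : y ∈ U <;> simp [hG, hx, hy]
    have h01 : ∀ x, (0 : ℝ) ≤ U.indicator 1 x := fun x =>
      indicator_nonneg (fun _ _ => zero_le_one) x
    have h1 := h01 x
    have h2 := h01 y
    have h3 := hi x
    have h4 := hi y
    rw [hG', hFr, hFr, ← ENNReal.ofReal_add (hi x) (hi y), ← ENNReal.ofReal_mul (by positivity),
      ← ENNReal.ofReal_add (by positivity) (by positivity), ← ENNReal.ofReal_mul (by positivity)]
    apply ENNReal.ofReal_le_ofReal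
    unfold minKernel
    rw [← mul_div_assoc, ← add_div, ← mul_div_assoc]
    gcongr
    exact hψ.abs_mul_sub_mul_rpow_le hr hL.le u x y
  have hGx : ∀ x, Measurable fun y => G (x, y) := fun x => hGm.comp measurable_prodMk_left
  have hGint : ∫⁻ x, ∫⁻ y, G (x, y) = energyOn r τ U u := by
    unfold energyOn
    rw [← lintegral_indicator hU]
    refine lintegral_congr fun x => ?_
    by_cases hx : x ∈ U
    · rw [indicator_of_mem hx, ← lintegral_indicator hU]
      refine lintegral_congr fun y => ?_
      by_cases hy : y ∈ U <;> simp [hG, hx, hy]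
    · simp [hG, hx]
  calc energy r τ (fun x => u x * ψ x)
      ≤ ∫⁻ x, ∫⁻ y, ENNReal.ofReal ((2 * A) ^ r) * (G (x, y)
        + (F x + F y) * ENNReal.ofReal (minKernel r τ L x y)) :=
        lintegral_mono fun x => lintegral_mono fun y => hpt x y
    _ = ENNReal.ofReal ((2 * A) ^ r) * ((∫⁻ x, ∫⁻ y, G (x, y))
        + (∫⁻ x, ∫⁻ y, (F x + F y) * ENNReal.ofReal (minKernel r τ L x y))) := by
        rw [← lintegral_add_left (Measurable.lintegral_prod_right' hGm),
          ← lintegral_const_mul' _ _ ENNReal.ofReal_ne_top]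
        refine lintegral_congr fun x => ?_
        rw [lintegral_const_mul' _ _ ENNReal.ofReal_ne_top, lintegral_add_left (hGx x)]
    _ ≤ _ := by
        rw [hGint]
        gcongr
        refine (h L hL F hFm).trans (le_of_eq ?_)
        rw [hF, lintegral_indicator hU]

/-- The radial cutoff equal to `1` on `B_a(x₀)` and to `0` off `B_b(x₀)`. -/
noncomputable def cutoff {N : ℕ} (x₀ : RN N) (a b : ℝ) (x : RN N) : ℝ :=
  max 0 (min 1 ((b - ‖x - x₀‖) / (b - a)))

theorem cutoff_nonneg {N : ℕ} (x₀ : RN N) (a b : ℝ) (x : RN N) : 0 ≤ cutoff x₀ a b x :=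
  le_max_left _ _

theorem cutoff_le_one {N : ℕ} (x₀ : RN N) (a b : ℝ) (x : RN N) : cutoff x₀ a b x ≤ 1 :=
  max_le zero_le_one (min_le_left _ _)

theorem cutoff_eq_one {N : ℕ} {x₀ : RN N} {a b : ℝ} (hab : a < b) {x : RN N}
    (hx : ‖x - x₀‖ ≤ a) : cutoff x₀ a b x = 1 := by
  unfold cutoff
  rw [min_eq_left, max_eq_right zero_le_one]
  rw [le_div_iff₀ (sub_pos.2 hab)]; linarith

theorem cutoff_eq_zero {N : ℕ} {x₀ : RN N} {a b : ℝ} (hab : a < b) {x : RN N}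
    (hx : b ≤ ‖x - x₀‖) : cutoff x₀ a b x = 0 := by
  unfold cutoff
  rw [max_eq_left]
  exact (min_le_right _ _).trans (div_nonpos_of_nonpos_of_nonneg (by linarith)
    (sub_nonneg.2 hab.le))

theorem continuous_cutoff {N : ℕ} (x₀ : RN N) (a b : ℝ) : Continuous (cutoff x₀ a b) := by
  unfold cutoff; fun_prop

theorem abs_cutoff_sub_le {N : ℕ} {x₀ : RN N} {a b : ℝ} (hab : a < b) (x y : RN N) :
    |cutoff x₀ a b x - cutoff x₀ a b y| ≤ min 1 ((b - a)⁻¹ * ‖x - y‖) := by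
  apply le_min
  · rw [abs_le]
    have := cutoff_nonneg x₀ a b x
    have := cutoff_nonneg x₀ a b y
    have := cutoff_le_one x₀ a b x
    have := cutoff_le_one x₀ a b y
    constructor <;> linarith
  · unfold cutoff
    have hba : 0 < b - a := sub_pos.2 hab
    refine (abs_max_sub_max_le_max _ _ _ _).trans (max_le (by simp; positivity) ?_)
    refine (abs_min_sub_min_le_max _ _ _ _).trans (max_le (by simp; positivity) ?_)
    rw [← sub_div, abs_div, abs_of_pos hba, div_eq_inv_mul]
    gcongr
    rw [sub_sub_sub_cancel_left]
    refine (abs_norm_sub_norm_le _ _).trans (le_of_eq ?_)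
    rw [sub_sub_sub_cancel_right, norm_sub_rev]

theorem abs_rpow_sub_rpow_le {θ a b : ℝ} (hθ : 1 ≤ θ) (ha : 0 ≤ a) (ha1 : a ≤ 1) (hb : 0 ≤ b)
    (hb1 : b ≤ 1) : |a ^ θ - b ^ θ| ≤ θ * |a - b| := by
  have aux : ∀ {a b : ℝ}, 0 ≤ a → a ≤ b → b ≤ 1 → |a ^ θ - b ^ θ| ≤ θ * |a - b| := by
    intro a b ha hab hb1
    have hb : 0 ≤ b := ha.trans hab
    rw [abs_sub_comm, abs_sub_comm a, abs_of_nonneg (sub_nonneg.2 hab), abs_of_nonneg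
      (sub_nonneg.2 (Real.rpow_le_rpow ha hab (by linarith)))]
    refine (rpow_sub_rpow_le_mul hθ ha hab).trans ?_
    have h1 : b ^ (θ - 1) ≤ 1 := Real.rpow_le_one hb hb1 (by linarith)
    have h2 : 0 ≤ b - a := sub_nonneg.2 hab
    have : θ * b ^ (θ - 1) ≤ θ := by nlinarith
    gcongr
  rcases le_total a b with h | h
  · exact aux ha h hb1
  · rw [abs_sub_comm, abs_sub_comm a]; exact aux hb h ha1

theorem isCutoff_cutoff_rpow {N : ℕ} {x₀ : RN N} {a b θ : ℝ} (hab : a < b) (hθ : 1 ≤ θ) :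
    IsCutoff (Metric.ball x₀ b) θ (b - a)⁻¹ (fun x => cutoff x₀ a b x ^ θ) where
  measurable := (continuous_cutoff x₀ a b).measurable.pow_const θ
  abs_le x := by
    rw [abs_of_nonneg (Real.rpow_nonneg (cutoff_nonneg _ _ _ _) _)]
    exact (Real.rpow_le_one (cutoff_nonneg _ _ _ _) (cutoff_le_one _ _ _ _) (by linarith)).trans hθ
  abs_sub_le x y := (abs_rpow_sub_rpow_le hθ (cutoff_nonneg _ _ _ _) (cutoff_le_one _ _ _ _)
    (cutoff_nonneg _ _ _ _) (cutoff_le_one _ _ _ _)).trans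
    (mul_le_mul_of_nonneg_left (abs_cutoff_sub_le hab x y) (by linarith))
  eq_zero x hx := by
    rw [Metric.mem_ball, not_lt, dist_eq_norm] at hx
    simp [cutoff_eq_zero hab hx, Real.zero_rpow (by linarith : θ ≠ 0)]

/-! ### Pairings along a flow of measure-preserving maps -/

/-- A jointly continuous family of measure-preserving maps indexed by `ℝ^N`. -/
structure IsFlow {N : ℕ} {X : Type*} [TopologicalSpace X] [MeasurableSpace X] (μ : Measure X)
    (T : RN N → X → X) : Prop where
  cont : Continuous (Function.uncurry T)
  mp : ∀ z, MeasurePreserving (T z) μ μ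

section Flow

variable {N : ℕ} {X : Type*} [TopologicalSpace X] [R1Space X]
  [MeasurableSpace X] [BorelSpace X] {μ : Measure X} [IsLocallyFiniteMeasure μ]
  [μ.InnerRegularCompactLTTop] {T : RN N → X → X} {r r' : ℝ} {F Φ : X → ℝ}

theorem holderConjugate_ofReal (hr : r.HolderConjugate r') :
    ENNReal.HolderConjugate (ENNReal.ofReal r) (ENNReal.ofReal r') :=
  hr.ennrealOfReal

theorem IsFlow.continuous_pairing (hT : IsFlow μ T) (hr : r.HolderConjugate r')
    (hF : MemLp F (ENNReal.ofReal r) μ) (hΦ : MemLp Φ (ENNReal.ofReal r') μ) :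
    Continuous fun z => ∫ x, Φ x * F (T z x) ∂μ := by
  have := holderConjugate_ofReal hr
  have : Fact (1 ≤ ENNReal.ofReal r) := ⟨by simpa using hr.lt.le⟩
  have : Fact (1 ≤ ENNReal.ofReal r') := ⟨by simpa using hr.symm.lt.le⟩
  let TC : C(RN N, C(X, X)) := (ContinuousMap.mk (Function.uncurry T) hT.cont).curry
  have hmp : ∀ z, MeasurePreserving (TC z) μ μ := hT.mp
  have h1 : Continuous fun z => Lp.compMeasurePreserving (TC z) (hmp z) (hF.toLp F) :=
    continuous_const.compMeasurePreservingLp TC.continuous hmp ENNReal.ofReal_ne_top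
  have h2 := ((ContinuousLinearMap.mul ℝ ℝ).lpPairing μ (ENNReal.ofReal r') (ENNReal.ofReal r)
    (hΦ.toLp Φ)).continuous.comp h1
  refine h2.congr fun z => ?_
  simp only [Function.comp]
  rw [ContinuousLinearMap.lpPairing_eq_integral]
  apply integral_congr_ae
  filter_upwards [hΦ.coeFn_toLp, Lp.coeFn_compMeasurePreserving (hF.toLp F) (hmp z),
    (hmp z).quasiMeasurePreserving.ae_eq_comp hF.coeFn_toLp] with x h1 h2 h3
  simp only [ContinuousLinearMap.mul_apply', h1, h2, h3]
  rfl

theorem IsFlow.integral_pairing [SecondCountableTopology X] [SFinite μ] (hT : IsFlow μ T) (hr : r.HolderConjugate r')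
    (hF : MemLp F (ENNReal.ofReal r) μ) (hΦ : MemLp Φ (ENNReal.ofReal r') μ)
    (hFm : Measurable F) (hΦm : Measurable Φ) {ρ : RN N → ℝ} (hρ : Continuous ρ)
    (hρc : HasCompactSupport ρ) :
    ∫ x, Φ x * (∫ z, ρ z * F (T z x)) ∂μ = ∫ z, ρ z * ∫ x, Φ x * F (T z x) ∂μ := by
  have := holderConjugate_ofReal hr
  have hFz : ∀ z, MemLp (fun x => F (T z x)) (ENNReal.ofReal r) μ := fun z =>
    hF.comp_measurePreserving (hT.mp z)
  have hint : ∀ z, Integrable (fun x => Φ x * F (T z x)) μ := fun z =>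
    hΦ.integrable_mul (hFz z)
  have hTm : Measurable (Function.uncurry T) := hT.cont.measurable
  have hI : Integrable (Function.uncurry fun (z : RN N) x => ρ z * (Φ x * F (T z x)))
      ((volume : Measure (RN N)).prod μ) := by
    rw [integrable_prod_iff]
    · refine ⟨Filter.Eventually.of_forall fun z => ?_, ?_⟩
      · simpa only [Function.uncurry] using (hint z).const_mul (ρ z)
      have hc := hT.continuous_pairing hr hF.norm hΦ.norm
      have : (fun z => ∫ x, ‖Function.uncurry (fun (z : RN N) x => ρ z * (Φ x * F (T z x)))
          (z, x)‖ ∂μ) = fun z => ‖ρ z‖ * ∫ x, ‖Φ x‖ * ‖F (T z x)‖ ∂μ := by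
        funext z
        simp only [Function.uncurry, norm_mul]
        rw [integral_const_mul]
      rw [this]
      exact (hρ.norm.mul hc).integrable_of_hasCompactSupport (hρc.norm.mul_right)
    · refine Measurable.aestronglyMeasurable ?_
      exact (hρ.measurable.comp measurable_fst).mul ((hΦm.comp measurable_snd).mul
        (hFm.comp hTm))
  have := integral_integral_swap hI
  simp only [integral_const_mul] at this
  rw [this]
  congr 1
  funext x
  rw [← integral_const_mul]
  congr 1
  funext z
  ring

end Flow

theorem eq_zero_of_forall_integral_bump_eq_zero {N : ℕ} {c : RN N → ℝ} (hc : Continuous c)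
    {δ : ℝ} (hδ : 0 < δ)
    (h : ∀ φ : ContDiffBump (0 : RN N), φ.rOut ≤ δ → ∫ z, φ.normed volume z * c z = 0) :
    c 0 = 0 := by
  rw [← dist_le_zero]
  refine le_of_forall_pos_le_add fun ε hε => ?_
  rw [zero_add]
  have hc' : Continuous fun z => c (-z) := hc.comp continuous_neg
  obtain ⟨η, hη, hηc⟩ := Metric.continuous_iff.1 hc' 0 ε hε
  let φ : ContDiffBump (0 : RN N) := ⟨min η δ / 2, min η δ, by positivity,
    by have : 0 < min η δ := by positivity
       linarith⟩
  have := φ.dist_normed_convolution_le (μ := volume) (g := fun z => c (-z)) (x₀ := 0) (ε := ε)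
    hc'.aestronglyMeasurable
    (fun x hx => (hηc x (lt_of_lt_of_le (Metric.mem_ball.1 hx) (min_le_left _ _))).le)
  rw [convolution_def] at this
  simp only [ContinuousLinearMap.lsmul_apply, smul_eq_mul, zero_sub, neg_neg, neg_zero] at this
  rw [h φ (min_le_right _ _), dist_comm] at this
  exact this

theorem isFlow_sub {N : ℕ} : IsFlow (volume : Measure (RN N)) (fun z x => x - z) where
  cont := by unfold Function.uncurry; fun_prop
  mp z := measurePreserving_sub_right volume z

theorem isFlow_sub_prod {N : ℕ} : IsFlow ((volume : Measure (RN N)).prod (volume : Measure (RN N)))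
    (fun z x => (x.1 - z, x.2 - z)) where
  cont := by unfold Function.uncurry; fun_prop
  mp z := (measurePreserving_sub_right volume z).prod (measurePreserving_sub_right volume z)

/-! ### Representation of one phase of the form -/

/-- The data of one phase `(r, τ)` near a set `K` on which test functions live: a kernel `k`
comparable from above to `|x-y|^(-N-τ)`, and a function `u` of finite energy on a neighbourhood
`U` of `K` with finite tails. -/
structure IsPhase {N : ℕ} (r τ Λ δ : ℝ) (k : RN N → RN N → ℝ) (U K : Set (RN N))
    (u : RN N → ℝ) : Prop where
  one_le_dim : 1 ≤ N
  one_lt : 1 < r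
  τ_pos : 0 < τ
  τ_lt : τ < r
  Λ_nonneg : 0 ≤ Λ
  kernel_measurable : Measurable (Function.uncurry k)
  kernel_nonneg : ∀ x y, x ≠ y → 0 ≤ k x y
  kernel_symm : ∀ x y, k x y = k y x
  kernel_le : ∀ x y, x ≠ y → k x y ≤ Λ / ‖x - y‖ ^ ((N : ℝ) + τ)
  measurable : Measurable u
  measurableSet_U : MeasurableSet U
  measurableSet_K : MeasurableSet K
  subset : K ⊆ U
  volume_K : volume K < ⊤
  gap_pos : 0 < δ
  gap : ∀ x ∈ K, ∀ y, y ∉ U → δ ≤ ‖x - y‖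
  lintegral_lt_top : ∫⁻ x in U, ENNReal.ofReal (|u x| ^ r) < ⊤
  energyOn_lt_top : energyOn r τ U u < ⊤
  tail : ∃ T : ℝ, 0 ≤ T ∧ ∀ x ∈ K,
    ∫⁻ y in Uᶜ, ENNReal.ofReal (k x y * |u y| ^ (r - 1)) ≤ ENNReal.ofReal T

/-- An admissible test function for `IsPhase`. -/
structure IsTest {N : ℕ} (r τ : ℝ) (K : Set (RN N)) (v : RN N → ℝ) : Prop where
  measurable : Measurable v
  eq_zero : ∀ x, x ∉ K → v x = 0
  lintegral_lt_top : ∫⁻ x, ENNReal.ofReal (|v x| ^ r) < ⊤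
  energy_lt_top : energy r τ v < ⊤

section Phase

variable {N : ℕ} {r τ Λ δ : ℝ} {k : RN N → RN N → ℝ} {U K : Set (RN N)} {u v : RN N → ℝ}

/-- The integrand of one phase of the form. -/
noncomputable def phaseIntegrand (r : ℝ) (k : RN N → RN N → ℝ) (u v : RN N → ℝ)
    (z : RN N × RN N) : ℝ :=
  hPow r (u z.1 - u z.2) * (v z.1 - v z.2) * k z.1 z.2

/-- The density paired with the difference quotient of the test function in the near field. -/
noncomputable def nearDensity (r τ : ℝ) (k : RN N → RN N → ℝ) (U : Set (RN N)) (u : RN N → ℝ) :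
    RN N × RN N → ℝ :=
  (U ×ˢ U).indicator fun z =>
    hPow r (u z.1 - u z.2) * k z.1 z.2 * ‖z.1 - z.2‖ ^ (((N : ℝ) + τ) / r)

/-- The fractional difference quotient. -/
noncomputable def diffQuot (r τ : ℝ) (v : RN N → ℝ) (z : RN N × RN N) : ℝ :=
  (v z.1 - v z.2) / ‖z.1 - z.2‖ ^ (((N : ℝ) + τ) / r)

/-- The density paired with the test function in the far field. -/
noncomputable def farDensity (r : ℝ) (k : RN N → RN N → ℝ) (U K : Set (RN N)) (u : RN N → ℝ) :
    RN N → ℝ :=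
  K.indicator fun x => ∫ y in Uᶜ, hPow r (u x - u y) * k x y

theorem memLp_ofReal_iff {X : Type*} [MeasurableSpace X] {μ : Measure X} {f : X → ℝ} {r : ℝ}
    (hr : 0 < r) (hf : AEStronglyMeasurable f μ) :
    MemLp f (ENNReal.ofReal r) μ ↔ ∫⁻ x, ENNReal.ofReal (|f x| ^ r) ∂μ < ⊤ := by
  have h0 : ENNReal.ofReal r ≠ 0 := by simpa using hr
  rw [MemLp, eLpNorm_lt_top_iff_lintegral_rpow_enorm_lt_top h0 ENNReal.ofReal_ne_top,
    ENNReal.toReal_ofReal hr.le]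
  have : ∀ x, ‖f x‖ₑ ^ r = ENNReal.ofReal (|f x| ^ r) := fun x => by
    rw [← ofReal_norm, Real.norm_eq_abs,
      ENNReal.ofReal_rpow_of_nonneg (abs_nonneg _) hr.le]
  simp_rw [this]
  exact ⟨fun h => h.2, fun h => ⟨hf, h⟩⟩

theorem measurable_diffQuot (hv : Measurable v) : Measurable (diffQuot r τ v) := by
  unfold diffQuot; fun_prop

theorem lintegral_abs_diffQuot (hr : 0 < r) (hv : Measurable v) :
    ∫⁻ z, ENNReal.ofReal (|diffQuot r τ v z| ^ r)
      ∂((volume : Measure (RN N)).prod (volume : Measure (RN N))) = energy r τ v := by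
  have hm : Measurable (diffQuot r τ v) := measurable_diffQuot hv
  rw [lintegral_prod _ (by fun_prop)]
  unfold energy
  refine lintegral_congr fun x => lintegral_congr fun y => ?_
  unfold diffQuot
  simp only
  rw [abs_div, Real.div_rpow (abs_nonneg _) (abs_nonneg _),
    abs_of_nonneg (Real.rpow_nonneg (norm_nonneg _) _), ← Real.rpow_mul (norm_nonneg _),
    div_mul_cancel₀ _ hr.ne']

theorem IsTest.memLp_diffQuot (hr : 0 < r) (hv : IsTest r τ K v) :
    MemLp (diffQuot r τ v) (ENNReal.ofReal r)
      ((volume : Measure (RN N)).prod (volume : Measure (RN N))) := by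
  rw [memLp_ofReal_iff hr (measurable_diffQuot hv.measurable).aestronglyMeasurable,
    lintegral_abs_diffQuot hr hv.measurable]
  exact hv.energy_lt_top

theorem IsTest.memLp (hr : 0 < r) (hv : IsTest r τ K v) : MemLp v (ENNReal.ofReal r) :=
  (memLp_ofReal_iff hr hv.measurable.aestronglyMeasurable).2 hv.lintegral_lt_top

theorem IsPhase.measurable_hPow_mul (h : IsPhase r τ Λ δ k U K u) :
    Measurable fun z : RN N × RN N => hPow r (u z.1 - u z.2) * k z.1 z.2 := by
  have hu := h.measurable
  exact ((measurable_hPow r).comp (by fun_prop)).mul h.kernel_measurable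

theorem IsPhase.measurable_nearDensity (h : IsPhase r τ Λ δ k U K u) : Measurable (nearDensity r τ k U u) := by
  refine Measurable.indicator ?_ (h.measurableSet_U.prod h.measurableSet_U)
  exact h.measurable_hPow_mul.mul (by fun_prop)

theorem IsPhase.memLp_nearDensity (h : IsPhase r τ Λ δ k U K u) {r' : ℝ} (hr : r.HolderConjugate r') :
    MemLp (nearDensity r τ k U u) (ENNReal.ofReal r')
      ((volume : Measure (RN N)).prod (volume : Measure (RN N))) := by
  have hr1 := h.one_lt
  have hr0 : 0 < r := by linarith
  have hr'0 : 0 < r' := hr.symm.pos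
  have hΛ := h.Λ_nonneg
  have hu := h.measurable
  have e1 : (r - 1) * r' = r := hr.sub_one_mul_conj
  rw [memLp_ofReal_iff hr'0 h.measurable_nearDensity.aestronglyMeasurable]
  set G : RN N × RN N → ℝ≥0∞ := (U ×ˢ U).indicator fun z =>
    ENNReal.ofReal (|u z.1 - u z.2| ^ r / ‖z.1 - z.2‖ ^ ((N : ℝ) + τ)) with hG
  have hGm : Measurable G := (measurable_abs_sub_rpow_div hu r _).indicator
    (h.measurableSet_U.prod h.measurableSet_U)
  have hGint : ∫⁻ z, G z ∂((volume : Measure (RN N)).prod (volume : Measure (RN N)))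
      = energyOn r τ U u := by
    rw [hG, lintegral_indicator (h.measurableSet_U.prod h.measurableSet_U),
      ← Measure.prod_restrict, lintegral_prod _ (by fun_prop)]
    rfl
  have hpt : ∀ z, ENNReal.ofReal (|nearDensity r τ k U u z| ^ r')
      ≤ ENNReal.ofReal (Λ ^ r') * G z := by
    rintro ⟨x, y⟩
    by_cases hz : (x, y) ∈ U ×ˢ U
    · rw [nearDensity, indicator_of_mem hz, hG, indicator_of_mem hz,
        ← ENNReal.ofReal_mul (by positivity)]
      apply ENNReal.ofReal_le_ofReal
      simp only
      rcases eq_or_ne x y with rfl | hxy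
      · simp [hPow, Real.zero_rpow hr'0.ne', Real.zero_rpow hr0.ne']
      have hd : 0 < ‖x - y‖ := norm_pos_iff.2 (sub_ne_zero.2 hxy)
      have hk0 := h.kernel_nonneg x y hxy
      have hk := h.kernel_le x y hxy
      rw [abs_mul, abs_mul, abs_hPow hr1, abs_of_nonneg hk0,
        abs_of_nonneg (Real.rpow_nonneg hd.le _)]
      calc (|u x - u y| ^ (r - 1) * k x y * ‖x - y‖ ^ (((N : ℝ) + τ) / r)) ^ r'
          ≤ (|u x - u y| ^ (r - 1) * (Λ / ‖x - y‖ ^ ((N : ℝ) + τ)) *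
            ‖x - y‖ ^ (((N : ℝ) + τ) / r)) ^ r' := by gcongr
        _ = (Λ * (|u x - u y| ^ (r - 1) / ‖x - y‖ ^ (((N : ℝ) + τ) / r'))) ^ r' := by
            congr 1
            have : ((N : ℝ) + τ) = ((N : ℝ) + τ) / r + ((N : ℝ) + τ) / r' := by
              have := hr.inv_add_inv_eq_one
              rw [div_eq_mul_inv, div_eq_mul_inv, ← mul_add, this, mul_one]
            have e : ‖x - y‖ ^ ((N : ℝ) + τ)
              = ‖x - y‖ ^ (((N : ℝ) + τ) / r) * ‖x - y‖ ^ (((N : ℝ) + τ) / r') := by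
              rw [← Real.rpow_add hd, ← this]
            rw [e]
            have p1 := Real.rpow_pos_of_pos hd (((N : ℝ) + τ) / r)
            have p2 := Real.rpow_pos_of_pos hd (((N : ℝ) + τ) / r')
            generalize ‖x - y‖ ^ (((N : ℝ) + τ) / r) = A at *
            generalize ‖x - y‖ ^ (((N : ℝ) + τ) / r') = B at *
            field_simp
        _ = Λ ^ r' * (|u x - u y| ^ r / ‖x - y‖ ^ ((N : ℝ) + τ)) := by
            rw [Real.mul_rpow hΛ (by positivity), Real.div_rpow (by positivity) (by positivity),
              ← Real.rpow_mul (abs_nonneg _), e1, ← Real.rpow_mul hd.le,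
              div_mul_cancel₀ _ hr'0.ne']
        _ ≤ _ := le_rfl
    · rw [nearDensity, indicator_of_notMem hz]
      simp [Real.zero_rpow hr'0.ne']
  refine (lintegral_mono hpt).trans_lt ?_
  rw [lintegral_const_mul _ hGm, hGint]
  exact ENNReal.mul_lt_top ENNReal.ofReal_lt_top h.energyOn_lt_top

theorem IsPhase.exists_far_bound (h : IsPhase r τ Λ δ k U K u) : ∃ C : ℝ, 0 ≤ C ∧ ∀ x ∈ K,
    ∫⁻ y in Uᶜ, ENNReal.ofReal (|hPow r (u x - u y) * k x y|)
      ≤ ENNReal.ofReal (C * (|u x| ^ (r - 1) + 1)) := by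
  obtain ⟨T, hT0, hT⟩ := h.tail
  obtain ⟨K₀, hK₀, hJ⟩ := exists_lintegral_min_rpow_div_le h.one_le_dim h.τ_pos h.τ_lt
  have hδ := h.gap_pos
  have hr1 := h.one_lt
  have hr0 : 0 < r := by linarith
  have hΛ := h.Λ_nonneg
  set A := Λ * (K₀ * δ⁻¹ ^ τ) with hA
  have hA0 : 0 ≤ A := by positivity
  refine ⟨2 ^ (r - 1) * (A + T), by positivity, fun x hx => ?_⟩
  calc ∫⁻ y in Uᶜ, ENNReal.ofReal (|hPow r (u x - u y) * k x y|)
      ≤ ∫⁻ y in Uᶜ, (ENNReal.ofReal (2 ^ (r - 1) * |u x| ^ (r - 1) * Λ) *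
          ENNReal.ofReal ((min 1 (δ⁻¹ * ‖x - y‖)) ^ r / ‖x - y‖ ^ ((N : ℝ) + τ))
          + ENNReal.ofReal (2 ^ (r - 1)) * ENNReal.ofReal (k x y * |u y| ^ (r - 1))) := by
        refine setLIntegral_mono' h.measurableSet_U.compl fun y hy => ?_
        have hg := h.gap x hx y hy
        have hd : 0 < ‖x - y‖ := hδ.trans_le hg
        have hxy : x ≠ y := fun e => by rw [e, sub_self, norm_zero] at hd; exact lt_irrefl _ hd
        have hk0 := h.kernel_nonneg x y hxy
        have hk := h.kernel_le x y hxy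
        have hmin : min 1 (δ⁻¹ * ‖x - y‖) = 1 := by
          apply min_eq_left
          rw [← div_eq_inv_mul, le_div_iff₀ hδ]; linarith
        rw [hmin, Real.one_rpow, ← ENNReal.ofReal_mul (by positivity),
          ← ENNReal.ofReal_mul (by positivity), ← ENNReal.ofReal_add (by positivity)
          (by positivity)]
        apply ENNReal.ofReal_le_ofReal
        rw [abs_mul, abs_hPow hr1, abs_of_nonneg hk0]
        have h1 : |u x - u y| ^ (r - 1) ≤ 2 ^ (r - 1) * (|u x| ^ (r - 1) + |u y| ^ (r - 1)) :=
          (Real.rpow_le_rpow (abs_nonneg _) (abs_sub _ _) (by linarith)).trans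
          (rpow_add_le_two_rpow_mul (by linarith) (abs_nonneg _) (abs_nonneg _))
        calc |u x - u y| ^ (r - 1) * k x y
            ≤ 2 ^ (r - 1) * (|u x| ^ (r - 1) + |u y| ^ (r - 1)) * k x y := by gcongr
          _ = 2 ^ (r - 1) * |u x| ^ (r - 1) * k x y + 2 ^ (r - 1) * (k x y * |u y| ^ (r - 1)) := by
              ring
          _ ≤ 2 ^ (r - 1) * |u x| ^ (r - 1) * (Λ / ‖x - y‖ ^ ((N : ℝ) + τ))
              + 2 ^ (r - 1) * (k x y * |u y| ^ (r - 1)) := by gcongr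
          _ = _ := by ring
    _ = ENNReal.ofReal (2 ^ (r - 1) * |u x| ^ (r - 1) * Λ) * (∫⁻ y in Uᶜ,
          ENNReal.ofReal ((min 1 (δ⁻¹ * ‖x - y‖)) ^ r / ‖x - y‖ ^ ((N : ℝ) + τ)))
          + ENNReal.ofReal (2 ^ (r - 1)) *
            ∫⁻ y in Uᶜ, ENNReal.ofReal (k x y * |u y| ^ (r - 1)) := by
        rw [lintegral_add_left (by fun_prop), lintegral_const_mul' _ _ ENNReal.ofReal_ne_top,
          lintegral_const_mul' _ _ ENNReal.ofReal_ne_top]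
    _ ≤ ENNReal.ofReal (2 ^ (r - 1) * |u x| ^ (r - 1) * Λ) * ENNReal.ofReal (K₀ * δ⁻¹ ^ τ)
          + ENNReal.ofReal (2 ^ (r - 1)) * ENNReal.ofReal T := by
        refine add_le_add (mul_le_mul_right ?_ _) (mul_le_mul_right (hT x hx) _)
        exact (lintegral_mono' Measure.restrict_le_self le_rfl).trans (hJ δ⁻¹ (inv_pos.2 hδ) x)
    _ ≤ _ := by
        rw [← ENNReal.ofReal_mul (by positivity), ← ENNReal.ofReal_mul (by positivity),
          ← ENNReal.ofReal_add (by positivity) (by positivity)]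
        apply ENNReal.ofReal_le_ofReal
        have hX : 0 ≤ |u x| ^ (r - 1) := by positivity
        have h2 : (0 : ℝ) ≤ 2 ^ (r - 1) := by positivity
        have e : 2 ^ (r - 1) * |u x| ^ (r - 1) * Λ * (K₀ * δ⁻¹ ^ τ) + 2 ^ (r - 1) * T
          = 2 ^ (r - 1) * (A * |u x| ^ (r - 1) + T) := by rw [hA]; ring
        rw [e, mul_assoc (2 ^ (r - 1)) (A + T)]
        refine mul_le_mul_of_nonneg_left ?_ h2
        nlinarith [mul_nonneg hT0 hX]

theorem IsPhase.memLp_growth (h : IsPhase r τ Λ δ k U K u) {r' : ℝ} (hr : r.HolderConjugate r') (C : ℝ) :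
    MemLp (K.indicator fun x => C * (|u x| ^ (r - 1) + 1)) (ENNReal.ofReal r') := by
  have hr'0 : 0 < r' := hr.symm.pos
  have hu := h.measurable
  have hr1 := h.one_lt
  rw [memLp_indicator_iff_restrict h.measurableSet_K]
  have h1 : MemLp (fun x => |u x| ^ (r - 1)) (ENNReal.ofReal r') (volume.restrict K) := by
    rw [memLp_ofReal_iff hr'0 (hu.abs.pow_const _).aestronglyMeasurable]
    have e : ∀ x, |(|u x| ^ (r - 1))| ^ r' = |u x| ^ r := fun x => by
      rw [abs_of_nonneg (by positivity), ← Real.rpow_mul (abs_nonneg _), hr.sub_one_mul_conj]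
    simp_rw [e]
    exact (lintegral_mono_set h.subset).trans_lt h.lintegral_lt_top
  have : IsFiniteMeasure (volume.restrict K) := ⟨by simpa using h.volume_K⟩
  have h2 : MemLp (fun _ => (1 : ℝ)) (ENNReal.ofReal r') (volume.restrict K) := memLp_const 1
  exact (h1.add h2).const_mul C

theorem IsPhase.measurable_farDensity (h : IsPhase r τ Λ δ k U K u) : Measurable (farDensity r k U K u) := by
  refine Measurable.indicator ?_ h.measurableSet_K
  exact (h.measurable_hPow_mul.stronglyMeasurable.integral_prod_right
    (ν := volume.restrict Uᶜ)).measurable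

theorem IsPhase.memLp_farDensity (h : IsPhase r τ Λ δ k U K u) {r' : ℝ} (hr : r.HolderConjugate r') :
    MemLp (farDensity r k U K u) (ENNReal.ofReal r') := by
  obtain ⟨C, hC, hb⟩ := h.exists_far_bound
  refine (h.memLp_growth hr C).mono h.measurable_farDensity.aestronglyMeasurable
    (Filter.Eventually.of_forall fun x => ?_)
  by_cases hx : x ∈ K
  · rw [farDensity, indicator_of_mem hx, indicator_of_mem hx, Real.norm_eq_abs, Real.norm_eq_abs]
    have h0 : 0 ≤ C * (|u x| ^ (r - 1) + 1) := by positivity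
    rw [abs_of_nonneg h0]
    refine (abs_integral_le_integral_abs).trans ?_
    rw [integral_eq_lintegral_of_nonneg_ae (Filter.Eventually.of_forall fun y => abs_nonneg _)
      (by have := (h.measurable_hPow_mul.comp (measurable_prodMk_left (x := x))).abs
          exact this.aestronglyMeasurable)]
    exact ENNReal.toReal_le_of_le_ofReal h0 (hb x hx)
  · simp [farDensity, hx]

/-- The far-field part of the integrand. -/
noncomputable def farIntegrand (r : ℝ) (k : RN N → RN N → ℝ) (U : Set (RN N)) (u v : RN N → ℝ)
    (z : RN N × RN N) : ℝ :=
  v z.1 * Uᶜ.indicator (fun y => hPow r (u z.1 - u y) * k z.1 y) z.2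

theorem IsPhase.measurable_farIntegrand (h : IsPhase r τ Λ δ k U K u) (hv : Measurable v) :
    Measurable (farIntegrand r k U u v) := by
  have e : farIntegrand r k U u v = fun z => v z.1 * (univ ×ˢ Uᶜ).indicator
      (fun z : RN N × RN N => hPow r (u z.1 - u z.2) * k z.1 z.2) z := by
    funext z
    by_cases hz : z.2 ∈ U <;> simp [farIntegrand, hz, indicator]
  rw [e]
  exact (hv.comp measurable_fst).mul (h.measurable_hPow_mul.indicator
    (MeasurableSet.univ.prod h.measurableSet_U.compl))

theorem IsPhase.integrable_farIntegrand (h : IsPhase r τ Λ δ k U K u) (hv : IsTest r τ K v) :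
    Integrable (farIntegrand r k U u v)
      ((volume : Measure (RN N)).prod (volume : Measure (RN N))) := by
  obtain ⟨C, hC, hb⟩ := h.exists_far_bound
  have hr0 : 0 < r := by linarith [h.one_lt]
  have hr := Real.HolderConjugate.conjExponent h.one_lt
  have hc := holderConjugate_ofReal hr
  have hm := h.measurable_farIntegrand hv.measurable
  have hkx : ∀ x, Measurable fun y => hPow r (u x - u y) * k x y := fun x =>
    h.measurable_hPow_mul.comp (measurable_prodMk_left (x := x))
  have hint : ∀ x ∈ K, IntegrableOn (fun y => hPow r (u x - u y) * k x y) Uᶜ := fun x hx => by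
    refine ⟨(hkx x).aestronglyMeasurable, ?_⟩
    rw [hasFiniteIntegral_iff_norm]
    exact (hb x hx).trans_lt ENNReal.ofReal_lt_top
  rw [integrable_prod_iff hm.aestronglyMeasurable]
  constructor
  · refine Filter.Eventually.of_forall fun x => ?_
    by_cases hx : x ∈ K
    · exact ((hint x hx).integrable_indicator h.measurableSet_U.compl).const_mul (v x)
    · simp [farIntegrand, hv.eq_zero x hx]
  · have hprod := (h.memLp_growth hr C).integrable_mul (hv.memLp hr0).norm
    refine hprod.mono' hm.aestronglyMeasurable.norm.integral_prod_right'
      (Filter.Eventually.of_forall fun x => ?_)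
    rw [Real.norm_eq_abs, abs_of_nonneg (integral_nonneg fun _ => norm_nonneg _)]
    by_cases hx : x ∈ K
    · have e : ∀ y, ‖farIntegrand r k U u v (x, y)‖
          = |v x| * Uᶜ.indicator (fun y => |hPow r (u x - u y) * k x y|) y := fun y => by
        rw [farIntegrand, norm_mul, Real.norm_eq_abs, Real.norm_eq_abs]
        by_cases hy : y ∈ U <;> simp [hy]
      simp_rw [e]
      rw [integral_const_mul, integral_indicator h.measurableSet_U.compl,
        Pi.mul_apply, indicator_of_mem hx, mul_comm, Real.norm_eq_abs]
      refine mul_le_mul_of_nonneg_right ?_ (abs_nonneg _)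
      rw [integral_eq_lintegral_of_nonneg_ae (Filter.Eventually.of_forall fun y => abs_nonneg _)
        (hkx x).abs.aestronglyMeasurable]
      exact ENNReal.toReal_le_of_le_ofReal (by positivity) (hb x hx)
    · simp [farIntegrand, hv.eq_zero x hx]

theorem IsPhase.integral_farIntegrand (h : IsPhase r τ Λ δ k U K u) (hv : IsTest r τ K v) :
    ∫ z, farIntegrand r k U u v z ∂((volume : Measure (RN N)).prod (volume : Measure (RN N)))
      = ∫ x, farDensity r k U K u x * v x := by
  rw [integral_prod _ (h.integrable_farIntegrand hv)]
  congr 1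
  funext x
  simp only [farIntegrand]
  rw [integral_const_mul, integral_indicator h.measurableSet_U.compl]
  by_cases hx : x ∈ K
  · rw [farDensity, indicator_of_mem hx, mul_comm]
  · simp [hv.eq_zero x hx]

theorem IsPhase.phaseIntegrand_eq (h : IsPhase r τ Λ δ k U K u) (hv : IsTest r τ K v)
    (z : RN N × RN N) :
    phaseIntegrand r k u v z = nearDensity r τ k U u z * diffQuot r τ v z
      + (farIntegrand r k U u v z + farIntegrand r k U u v z.swap) := by
  obtain ⟨x, y⟩ := z
  have hv0 : ∀ x, x ∉ U → v x = 0 := fun x hx => hv.eq_zero x fun hK => hx (h.subset hK)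
  simp only [phaseIntegrand, nearDensity, diffQuot, farIntegrand, Prod.swap]
  by_cases hx : x ∈ U <;> by_cases hy : y ∈ U
  · rcases eq_or_ne x y with rfl | hxy
    · simp [hx]
    have hd : 0 < ‖x - y‖ := norm_pos_iff.2 (sub_ne_zero.2 hxy)
    have hp := Real.rpow_pos_of_pos hd (((N : ℝ) + τ) / r)
    simp only [indicator, mem_prod, hx, hy, mem_compl_iff, and_self, not_true_eq_false, if_true,
      if_false]
    field_simp
    ring
  · simp only [indicator, mem_prod, hx, hy, mem_compl_iff, and_false, not_true_eq_false,
      not_false_eq_true, if_true, if_false, hv0 y hy]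
    ring
  · simp only [indicator, mem_prod, hx, hy, mem_compl_iff, false_and, not_true_eq_false,
      not_false_eq_true, if_true, if_false, hv0 x hx]
    rw [h.kernel_symm y x, ← neg_sub (u x), hPow_neg]
    ring
  · simp [indicator, hx, hy, hv0 x hx, hv0 y hy]

theorem IsPhase.integrable_near (h : IsPhase r τ Λ δ k U K u) (hv : IsTest r τ K v) :
    Integrable (fun z => nearDensity r τ k U u z * diffQuot r τ v z)
      ((volume : Measure (RN N)).prod (volume : Measure (RN N))) := by
  have hr0 : 0 < r := by linarith [h.one_lt]
  have hr := Real.HolderConjugate.conjExponent h.one_lt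
  have hc := holderConjugate_ofReal hr
  exact (h.memLp_nearDensity hr).integrable_mul (hv.memLp_diffQuot hr0)

theorem IsPhase.integrable_phaseIntegrand (h : IsPhase r τ Λ δ k U K u) (hv : IsTest r τ K v) :
    Integrable (phaseIntegrand r k u v)
      ((volume : Measure (RN N)).prod (volume : Measure (RN N))) := by
  have hf := h.integrable_farIntegrand hv
  refine ((h.integrable_near hv).add (hf.add hf.swap)).congr
    (Filter.Eventually.of_forall fun z => ?_)
  rw [h.phaseIntegrand_eq hv z]
  rfl

theorem IsPhase.integral_phaseIntegrand (h : IsPhase r τ Λ δ k U K u) (hv : IsTest r τ K v) :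
    ∫ z, phaseIntegrand r k u v z
        ∂((volume : Measure (RN N)).prod (volume : Measure (RN N)))
      = ∫ z, nearDensity r τ k U u z * diffQuot r τ v z
        ∂((volume : Measure (RN N)).prod (volume : Measure (RN N)))
        + 2 * ∫ x, farDensity r k U K u x * v x := by
  have hf := h.integrable_farIntegrand hv
  simp_rw [h.phaseIntegrand_eq hv]
  have hs : Integrable (fun z : RN N × RN N => farIntegrand r k U u v z.swap)
      ((volume : Measure (RN N)).prod (volume : Measure (RN N))) := hf.swap
  have hfs : Integrable (fun z : RN N × RN N => farIntegrand r k U u v z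
      + farIntegrand r k U u v z.swap)
      ((volume : Measure (RN N)).prod (volume : Measure (RN N))) := hf.add hs
  rw [integral_add (h.integrable_near hv) hfs, integral_add hf hs,
    integral_prod_swap (f := farIntegrand r k U u v), h.integral_farIntegrand hv]
  ring

theorem IsPhase.integral_integral_phaseIntegrand (h : IsPhase r τ Λ δ k U K u)
    (hv : IsTest r τ K v) :
    ∫ x, ∫ y, phaseIntegrand r k u v (x, y)
      = ∫ z, phaseIntegrand r k u v z
        ∂((volume : Measure (RN N)).prod (volume : Measure (RN N))) :=
  (integral_prod _ (h.integrable_phaseIntegrand hv)).symm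

end Phase

open scoped Convolution

/-! ### Enlarging the class of test functions -/

section Testing

variable {N : ℕ} {r τ Λ δ : ℝ} {k : RN N → RN N → ℝ} {U K K₀ : Set (RN N)} {u v : RN N → ℝ}

theorem isTest_of_contDiff (hN : 1 ≤ N) (hτ : 0 < τ) (hτr : τ < r) (hK : IsCompact K)
    {w : RN N → ℝ} (hw : ContDiff ℝ ((⊤ : ℕ∞) : WithTop ℕ∞) w) (hw0 : ∀ x, x ∉ K → w x = 0) :
    IsTest r τ K w := by
  have hr : 0 < r := hτ.trans hτr
  have hwc : HasCompactSupport w := HasCompactSupport.intro hK hw0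
  obtain ⟨C, hC⟩ := hw.lipschitzWith_of_hasCompactSupport hwc (by simp)
  obtain ⟨B, hB⟩ := hwc.exists_bound_of_continuous hw.continuous
  have hB0 : 0 ≤ B := (norm_nonneg _).trans (hB 0)
  set A : ℝ := 2 * B + 1 with hA
  have hA0 : 0 < A := by positivity
  have hcut : IsCutoff K A ((C + 1) / A) w :=
    { measurable := hw.continuous.measurable
      abs_le := fun x => by have := hB x; rw [Real.norm_eq_abs] at this; linarith
      abs_sub_le := fun x y => by
        rw [mul_min_of_nonneg _ _ hA0.le]
        apply le_min
        · have h1 := hB x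
          have h2 := hB y
          rw [Real.norm_eq_abs] at h1 h2
          have := abs_sub (w x) (w y)
          linarith
        · have h1 := hC.dist_le_mul x y
          rw [dist_eq_norm, dist_eq_norm, Real.norm_eq_abs] at h1
          have e : A * ((C + 1) / A * ‖x - y‖) = (C + 1) * ‖x - y‖ := by field_simp
          rw [e]
          have := norm_nonneg (x - y)
          linarith
      eq_zero := hw0 }
  obtain ⟨K₁, hK₁, hE⟩ := exists_energy_mul_cutoff_le hN hτ hτr
  refine ⟨hw.continuous.measurable, hw0, ?_, ?_⟩
  · rw [← memLp_ofReal_iff hr hw.continuous.aestronglyMeasurable]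
    exact hw.continuous.memLp_of_hasCompactSupport hwc
  · have := hE K hK.measurableSet A ((C + 1) / A) (by positivity) w hcut (fun _ => 1)
      measurable_const
    simp only [one_mul] at this
    refine this.trans_lt ?_
    have h0 : energyOn r τ K (fun _ : RN N => (1 : ℝ)) = 0 := by
      simp [energyOn, Real.zero_rpow hr.ne']
    rw [h0, zero_add]
    refine ENNReal.mul_lt_top ENNReal.ofReal_lt_top (ENNReal.mul_lt_top ENNReal.ofReal_lt_top ?_)
    simpa using hK.measure_lt_top

theorem IsTest.locallyIntegrable (hr : 1 ≤ r) (hv : IsTest r τ K v) : LocallyIntegrable v :=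
  (hv.memLp (by linarith)).locallyIntegrable (by simpa using hr)

theorem convolution_bump_eq_zero {η : ℝ} (hK : ∀ x ∈ K₀, ∀ z : RN N, ‖z‖ ≤ η → x + z ∈ K)
    (hv0 : ∀ x, x ∉ K₀ → v x = 0) (φ : ContDiffBump (0 : RN N)) (hφ : φ.rOut ≤ η) {x : RN N}
    (hx : x ∉ K) : ∫ z, φ.normed volume z * v (x - z) = 0 := by
  rw [← integral_zero (RN N) ℝ (μ := volume)]
  congr 1
  funext z
  by_cases hz : φ.normed volume z = 0
  · rw [hz, zero_mul]
  · have hz' : z ∈ Function.support (φ.normed volume) := hz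
    rw [φ.support_normed_eq, Metric.mem_ball, dist_zero_right] at hz'
    rw [hv0 (x - z), mul_zero]
    intro hxz
    apply hx
    have := hK _ hxz z (hz'.le.trans hφ)
    simpa using this

theorem IsTest.contDiff_convolution (hr : 1 ≤ r) (hv : IsTest r τ K v)
    (φ : ContDiffBump (0 : RN N)) :
    ContDiff ℝ ((⊤ : ℕ∞) : WithTop ℕ∞) (fun x => ∫ z, φ.normed volume z * v (x - z)) :=
  φ.hasCompactSupport_normed.contDiff_convolution_left (ContinuousLinearMap.lsmul ℝ ℝ)
    φ.contDiff_normed (hv.locallyIntegrable hr)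

theorem IsTest.diffQuot_convolution (hr : 1 ≤ r) (hv : IsTest r τ K v)
    (φ : ContDiffBump (0 : RN N)) (x : RN N × RN N) :
    diffQuot r τ (fun x => ∫ z, φ.normed volume z * v (x - z)) x
      = ∫ z, φ.normed volume z * diffQuot r τ v (x.1 - z, x.2 - z) := by
  have hint : ∀ y, Integrable fun z => φ.normed volume z * v (y - z) := fun y =>
    φ.hasCompactSupport_normed.convolutionExists_left (ContinuousLinearMap.lsmul ℝ ℝ)
      φ.continuous_normed (hv.locallyIntegrable hr) y
  unfold diffQuot
  simp only [sub_sub_sub_cancel_right]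
  rw [← integral_sub (hint _) (hint _), div_eq_mul_inv, ← integral_mul_const]
  congr 1
  funext z
  ring

/-- The phase of the form evaluated at the translate of the test function by `w`. -/
noncomputable def phasePairing (r τ : ℝ) (k : RN N → RN N → ℝ) (U K : Set (RN N))
    (u v : RN N → ℝ) (w : RN N) : ℝ :=
  ∫ z, nearDensity r τ k U u z * diffQuot r τ v (z.1 - w, z.2 - w)
        ∂((volume : Measure (RN N)).prod (volume : Measure (RN N)))
        + 2 * ∫ x, farDensity r k U K u x * v (x - w)

theorem IsPhase.pairing_continuous (h : IsPhase r τ Λ δ k U K u) (hv : IsTest r τ K v) :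
    Continuous (phasePairing r τ k U K u v) := by
  have hr0 : 0 < r := by linarith [h.one_lt]
  have hr := Real.HolderConjugate.conjExponent h.one_lt
  exact (isFlow_sub_prod.continuous_pairing hr (hv.memLp_diffQuot hr0)
    (h.memLp_nearDensity hr)).add (continuous_const.mul
    (isFlow_sub.continuous_pairing hr (hv.memLp hr0) (h.memLp_farDensity hr)))

theorem IsPhase.integral_convolution (h : IsPhase r τ Λ δ k U K u) (hv : IsTest r τ K v)
    (φ : ContDiffBump (0 : RN N))
    (hφ : IsTest r τ K (fun x => ∫ z, φ.normed volume z * v (x - z))) :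
    ∫ z, phaseIntegrand r k u (fun x => ∫ z, φ.normed volume z * v (x - z)) z
        ∂((volume : Measure (RN N)).prod (volume : Measure (RN N)))
      = ∫ w, φ.normed volume w *
        phasePairing r τ k U K u v w := by
  have hr0 : 0 < r := by linarith [h.one_lt]
  have hr := Real.HolderConjugate.conjExponent h.one_lt
  rw [h.integral_phaseIntegrand hφ]
  have c1 := isFlow_sub_prod.continuous_pairing hr (hv.memLp_diffQuot hr0)
    (h.memLp_nearDensity hr)
  have c2 := isFlow_sub.continuous_pairing hr (hv.memLp hr0) (h.memLp_farDensity hr)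
  have i1 := (φ.continuous_normed (μ := volume).mul c1).integrable_of_hasCompactSupport
    (μ := volume) φ.hasCompactSupport_normed.mul_right
  have i2 := (φ.continuous_normed (μ := volume).mul c2).integrable_of_hasCompactSupport
    (μ := volume) φ.hasCompactSupport_normed.mul_right
  have e1 := isFlow_sub_prod.integral_pairing hr (hv.memLp_diffQuot hr0)
    (h.memLp_nearDensity hr) (measurable_diffQuot hv.measurable) h.measurable_nearDensity
    (φ.continuous_normed (μ := volume)) φ.hasCompactSupport_normed
  have e2 := isFlow_sub.integral_pairing hr (hv.memLp hr0)
    (h.memLp_farDensity hr) hv.measurable h.measurable_farDensity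
    (φ.continuous_normed (μ := volume)) φ.hasCompactSupport_normed
  simp_rw [hv.diffQuot_convolution h.one_lt.le φ]
  simp only [Pi.mul_def] at i1 i2
  rw [e1, e2, ← integral_const_mul, ← integral_add i1 (i2.const_mul 2)]
  congr 1
  funext w
  unfold phasePairing
  ring

/-- The weak formulation of a two-phase equation extends from smooth test functions to
compactly supported ones of finite energy. -/
theorem weak_of_isTest {r₁ τ₁ Λ₁ δ₁ r₂ τ₂ Λ₂ δ₂ l l' η : ℝ} {k₁ k₂ : RN N → RN N → ℝ}
    {g : RN N → ℝ}
    (h₁ : IsPhase r₁ τ₁ Λ₁ δ₁ k₁ U K u) (h₂ : IsPhase r₂ τ₂ Λ₂ δ₂ k₂ U K u)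
    (hK : IsCompact K) (hη : 0 < η) (hK₀ : ∀ x ∈ K₀, ∀ z : RN N, ‖z‖ ≤ η → x + z ∈ K)
    (hl : l.HolderConjugate l') (hg : Measurable g) (hgl : MemLp g (ENNReal.ofReal l'))
    (hweak : ∀ w : RN N → ℝ, ContDiff ℝ ((⊤ : ℕ∞) : WithTop ℕ∞) w → (∀ x, x ∉ K → w x = 0) →
      (∫ x, ∫ y, phaseIntegrand r₁ k₁ u w (x, y)) + (∫ x, ∫ y, phaseIntegrand r₂ k₂ u w (x, y))
        = ∫ x, g x * w x)
    (hv₁ : IsTest r₁ τ₁ K₀ v) (hv₂ : IsTest r₂ τ₂ K₀ v) (hvl : MemLp v (ENNReal.ofReal l)) :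
    ∫ z, phaseIntegrand r₁ k₁ u v z
        ∂((volume : Measure (RN N)).prod (volume : Measure (RN N)))
      + ∫ z, phaseIntegrand r₂ k₂ u v z
        ∂((volume : Measure (RN N)).prod (volume : Measure (RN N)))
      = ∫ x, g x * v x := by
  have hsub : K₀ ⊆ K := fun x hx => by simpa using hK₀ x hx 0 (by simpa using hη.le)
  have mono : ∀ {r τ : ℝ}, IsTest r τ K₀ v → IsTest r τ K v := fun ht =>
    ⟨ht.measurable, fun x hx => ht.eq_zero x fun h => hx (hsub h), ht.lintegral_lt_top,
      ht.energy_lt_top⟩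
  have hw₁ := mono hv₁
  have hw₂ := mono hv₂
  have c3 := (isFlow_sub (N := N)).continuous_pairing hl hvl hgl
  have hc : Continuous fun w => phasePairing r₁ τ₁ k₁ U K u v w + phasePairing r₂ τ₂ k₂ U K u v w
      - ∫ x, g x * v (x - w) :=
    ((h₁.pairing_continuous hw₁).add (h₂.pairing_continuous hw₂)).sub c3
  have key := eq_zero_of_forall_integral_bump_eq_zero hc hη ?_
  · simp only [phasePairing, sub_zero, Prod.mk.eta] at key
    rw [h₁.integral_phaseIntegrand hw₁, h₂.integral_phaseIntegrand hw₂]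
    linarith
  · intro φ hφ
    have hsm := hv₁.contDiff_convolution h₁.one_lt.le φ
    have h0 : ∀ x, x ∉ K → ∫ z, φ.normed volume z * v (x - z) = 0 := fun x hx =>
      convolution_bump_eq_zero hK₀ hv₁.eq_zero φ hφ hx
    have ht₁ := isTest_of_contDiff h₁.one_le_dim h₁.τ_pos h₁.τ_lt hK hsm h0
    have ht₂ := isTest_of_contDiff h₂.one_le_dim h₂.τ_pos h₂.τ_lt hK hsm h0
    have hw := hweak _ hsm h0
    rw [h₁.integral_integral_phaseIntegrand ht₁, h₂.integral_integral_phaseIntegrand ht₂,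
      h₁.integral_convolution hw₁ φ ht₁, h₂.integral_convolution hw₂ φ ht₂,
      (isFlow_sub (N := N)).integral_pairing hl hvl hgl hv₁.measurable hg
        (φ.continuous_normed (μ := volume)) φ.hasCompactSupport_normed] at hw
    have i1 := (φ.continuous_normed (μ := volume).mul
      (h₁.pairing_continuous hw₁)).integrable_of_hasCompactSupport
      (μ := volume) φ.hasCompactSupport_normed.mul_right
    have i2 := (φ.continuous_normed (μ := volume).mul
      (h₂.pairing_continuous hw₂)).integrable_of_hasCompactSupport
      (μ := volume) φ.hasCompactSupport_normed.mul_right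
    have i3 := (φ.continuous_normed (μ := volume).mul c3).integrable_of_hasCompactSupport
      (μ := volume) φ.hasCompactSupport_normed.mul_right
    simp only [Pi.mul_def] at i1 i2 i3
    simp only [mul_sub, mul_add]
    rw [integral_sub, integral_add, hw, sub_self]
    · exact i1
    · exact i2
    · exact i1.add i2
    · exact i3

end Testing

/-! ### The Caccioppoli inequality for one phase -/

/-- The truncation `(u - m)_+`. -/
noncomputable def trunc {N : ℕ} (u : RN N → ℝ) (m : ℝ) (x : RN N) : ℝ := max (u x - m) 0

theorem trunc_nonneg {N : ℕ} (u : RN N → ℝ) (m : ℝ) (x : RN N) : 0 ≤ trunc u m x :=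
  le_max_right _ _

theorem measurable_trunc {N : ℕ} {u : RN N → ℝ} (hu : Measurable u) (m : ℝ) :
    Measurable (trunc u m) := by
  unfold trunc; fun_prop

theorem abs_trunc_sub_le {N : ℕ} (u : RN N → ℝ) (m : ℝ) (x y : RN N) :
    |trunc u m x - trunc u m y| ≤ |u x - u y| := by
  unfold trunc
  refine (abs_max_sub_max_le_abs _ _ _).trans ?_
  rw [sub_sub_sub_cancel_right]

theorem trunc_le {N : ℕ} (u : RN N → ℝ) (m : ℝ) (x : RN N) : trunc u m x ≤ |u x| + |m| := by
  unfold trunc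
  apply max_le _ (by positivity)
  linarith [le_abs_self (u x), neg_abs_le m]

theorem energyOn_trunc_le {N : ℕ} {r τ : ℝ} (hr : 0 ≤ r) (U : Set (RN N)) (u : RN N → ℝ)
    (m : ℝ) : energyOn r τ U (trunc u m) ≤ energyOn r τ U u := by
  refine lintegral_mono fun x => lintegral_mono fun y => ENNReal.ofReal_le_ofReal ?_
  exact div_le_div_of_nonneg_right (Real.rpow_le_rpow (abs_nonneg _) (abs_trunc_sub_le u m x y) hr)
    (by positivity)

theorem lintegral_trunc_rpow_lt_top {N : ℕ} {r : ℝ} (hr : 0 ≤ r) {U : Set (RN N)}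
    (hU : volume U < ⊤) {u : RN N → ℝ}
    (h : ∫⁻ x in U, ENNReal.ofReal (|u x| ^ r) < ⊤) (m : ℝ) :
    ∫⁻ x in U, ENNReal.ofReal (trunc u m x ^ r) < ⊤ := by
  calc ∫⁻ x in U, ENNReal.ofReal (trunc u m x ^ r)
      ≤ ∫⁻ x in U, (ENNReal.ofReal (2 ^ r) * ENNReal.ofReal (|u x| ^ r)
          + ENNReal.ofReal (2 ^ r * |m| ^ r)) := by
        refine lintegral_mono fun x => ?_
        simp only
        rw [← ENNReal.ofReal_mul (by positivity), ← ENNReal.ofReal_add (by positivity)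
          (by positivity), ← mul_add]
        exact ENNReal.ofReal_le_ofReal ((Real.rpow_le_rpow (trunc_nonneg _ _ _)
          (trunc_le u m x) hr).trans (rpow_add_le_two_rpow_mul hr (abs_nonneg _) (abs_nonneg _)))
    _ < ⊤ := by
        rw [lintegral_add_right _ measurable_const, lintegral_const_mul' _ _ ENNReal.ofReal_ne_top,
          lintegral_const, Measure.restrict_apply_univ]
        exact ENNReal.add_lt_top.2 ⟨ENNReal.mul_lt_top ENNReal.ofReal_lt_top h,
          ENNReal.mul_lt_top ENNReal.ofReal_lt_top hU⟩

theorem toReal_lintegral_le_integral_add {X : Type*} [MeasurableSpace X] {μ : Measure X}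
    {I P Q : X → ℝ} {B : ℝ} (hI : Integrable I μ) (hP : Measurable P) (hQ : Measurable Q)
    (hP0 : ∀ x, 0 ≤ P x) (hQ0 : ∀ x, 0 ≤ Q x) (hPt : ∫⁻ x, ENNReal.ofReal (P x) ∂μ < ⊤)
    (hB : 0 ≤ B) (hQB : ∫⁻ x, ENNReal.ofReal (Q x) ∂μ ≤ ENNReal.ofReal B)
    (h : ∀ x, P x ≤ I x + Q x) :
    (∫⁻ x, ENNReal.ofReal (P x) ∂μ).toReal ≤ ∫ x, I x ∂μ + B := by
  have hfin : ∀ {f : X → ℝ}, Measurable f → (∀ x, 0 ≤ f x) →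
      ∫⁻ x, ENNReal.ofReal (f x) ∂μ < ⊤ → Integrable f μ := by
    intro f hf hf0 hft
    refine ⟨hf.aestronglyMeasurable, ?_⟩
    rw [hasFiniteIntegral_iff_norm]
    simpa [abs_of_nonneg (hf0 _)] using hft
  have hPi := hfin hP hP0 hPt
  have hQi := hfin hQ hQ0 (hQB.trans_lt ENNReal.ofReal_lt_top)
  rw [← integral_eq_lintegral_of_nonneg_ae (Filter.Eventually.of_forall hP0)
    hP.aestronglyMeasurable]
  have h1 : ∫ x, P x ∂μ ≤ ∫ x, (I x + Q x) ∂μ := integral_mono hPi (hI.add hQi) h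
  rw [integral_add hI hQi] at h1
  have h2 : ∫ x, Q x ∂μ ≤ B := by
    rw [integral_eq_lintegral_of_nonneg_ae (Filter.Eventually.of_forall hQ0)
      hQ.aestronglyMeasurable]
    exact ENNReal.toReal_le_of_le_ofReal hB hQB
  linarith

section

variable {N : ℕ} {r τ Λ δ : ℝ} {k : RN N → RN N → ℝ} {U K : Set (RN N)} {u : RN N → ℝ}

/-- The error terms in the Caccioppoli inequality. -/
noncomputable def caccioppoliError (r τ A L C : ℝ) (k : RN N → RN N → ℝ) (B : Set (RN N))
    (w ψ : RN N → ℝ) (z : RN N × RN N) : ℝ :=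
  C * A ^ r * ((B.indicator (fun x => w x ^ r) z.1 + B.indicator (fun x => w x ^ r) z.2)
      * minKernel r τ L z.1 z.2)
    + (w z.1 * ψ z.1 ^ r * Bᶜ.indicator (fun y => k z.1 y * w y ^ (r - 1)) z.2
      + w z.2 * ψ z.2 ^ r * Bᶜ.indicator (fun y => k z.2 y * w y ^ (r - 1)) z.1)

theorem IsPhase.le_phaseIntegrand_add (h : IsPhase r τ Λ δ k U K u) {B : Set (RN N)}
    {A L lam : ℝ} (hL : 0 ≤ L) {ψ : RN N → ℝ} (hψ : IsCutoff B A L ψ) (hψ0 : ∀ x, 0 ≤ ψ x)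
    (hlam : 0 ≤ lam)
    (hk : ∀ x ∈ B, ∀ y ∈ B, x ≠ y → lam / ‖x - y‖ ^ ((N : ℝ) + τ) ≤ k x y) (m : ℝ)
    (z : RN N × RN N) :
    2⁻¹ * (2 ^ r)⁻¹ * lam * (|trunc u m z.1 * ψ z.1 - trunc u m z.2 * ψ z.2| ^ r
        / ‖z.1 - z.2‖ ^ ((N : ℝ) + τ))
      ≤ phaseIntegrand r k u (fun x => trunc u m x * ψ x ^ r) z
        + caccioppoliError r τ A L (((2 * r) ^ r + 1) * Λ + lam) k B (trunc u m) ψ z := by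
  obtain ⟨x, y⟩ := z
  have hr1 := h.one_lt
  have hr0 : 0 < r := by linarith
  have hA : 0 ≤ A := (abs_nonneg _).trans (hψ.abs_le 0)
  have hΛ := h.Λ_nonneg
  have hc : (0 : ℝ) < 2⁻¹ * (2 ^ r)⁻¹ := by positivity
  have hc1 : (2 : ℝ)⁻¹ * (2 ^ r)⁻¹ ≤ 1 := by
    have : (1 : ℝ) ≤ 2 ^ r := Real.one_le_rpow one_le_two hr0.le
    have h2 : ((2 : ℝ) ^ r)⁻¹ ≤ 1 := inv_le_one_of_one_le₀ this
    have h3 : (0 : ℝ) < (2 ^ r)⁻¹ := by positivity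
    nlinarith
  have hC : 0 ≤ (2 * r) ^ r + 1 := by positivity
  rcases eq_or_ne x y with rfl | hxy
  · by_cases hx : x ∈ B
    · simp only [phaseIntegrand, caccioppoliError, sub_self, abs_zero, Real.zero_rpow hr0.ne',
        zero_div, mul_zero, zero_mul, indicator, mem_compl_iff, hx, not_true_eq_false, if_false,
        if_true, add_zero, zero_add]
      have := minKernel_nonneg (r := r) (τ := τ) hL x x
      have := Real.rpow_nonneg (trunc_nonneg u m x) r
      positivity
    · simp [phaseIntegrand, caccioppoliError, Real.zero_rpow hr0.ne', hx, hψ.eq_zero x hx]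
  have hd : 0 < ‖x - y‖ := norm_pos_iff.2 (sub_ne_zero.2 hxy)
  have hD : 0 < ‖x - y‖ ^ ((N : ℝ) + τ) := Real.rpow_pos_of_pos hd _
  have hk0 := h.kernel_nonneg x y hxy
  have hkle := h.kernel_le x y hxy
  have hwx := trunc_nonneg u m x
  have hwy := trunc_nonneg u m y
  have hwxr := Real.rpow_nonneg hwx r
  have hwyr := Real.rpow_nonneg hwy r
  -- the product structure of the cutoff difference
  have hψd : |ψ x - ψ y| ^ r / ‖x - y‖ ^ ((N : ℝ) + τ) ≤ A ^ r * minKernel r τ L x y := by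
    unfold minKernel
    have hmin : 0 ≤ min 1 (L * ‖x - y‖) := le_min zero_le_one (by positivity)
    rw [← mul_div_assoc, ← Real.mul_rpow hA hmin]
    gcongr
    exact hψ.abs_sub_le x y
  have hmk := minKernel_nonneg (r := r) (τ := τ) hL x y
  have hAr : 0 ≤ A ^ r := by positivity
  have hAm : 0 ≤ A ^ r * minKernel r τ L x y := mul_nonneg hAr hmk
  have hrw : u x - u y = (u x - m) - (u y - m) := by ring
  simp only [phaseIntegrand, caccioppoliError]
  by_cases hx : x ∈ B <;> by_cases hy : y ∈ B
  · simp only [indicator, mem_compl_iff, hx, hy, not_true_eq_false, if_false, if_true, mul_zero,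
      add_zero]
    have hmain := hPow_mul_sub_lower (u x - m) (u y - m) hr1 (hψ0 x) (hψ0 y)
    rw [← hrw] at hmain
    change 2⁻¹ * (2 ^ r)⁻¹ * |trunc u m x * ψ x - trunc u m y * ψ y| ^ r
      - ((2 * r) ^ r + 1) * ((max (trunc u m x) (trunc u m y)) ^ r * |ψ x - ψ y| ^ r)
      ≤ hPow r (u x - u y) * (trunc u m x * ψ x ^ r - trunc u m y * ψ y ^ r) at hmain
    have hmax : (max (trunc u m x) (trunc u m y)) ^ r ≤ trunc u m x ^ r + trunc u m y ^ r := by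
      rcases le_total (trunc u m x) (trunc u m y) with hle | hle
      · rw [max_eq_right hle]; linarith
      · rw [max_eq_left hle]; linarith
    have hl := hk x hx y hy hxy
    set P := |trunc u m x * ψ x - trunc u m y * ψ y| ^ r with hP
    have hP0 : 0 ≤ P := by positivity
    set S := trunc u m x ^ r + trunc u m y ^ r with hS
    have hS0 : 0 ≤ S := add_nonneg hwxr hwyr
    set Ψ := |ψ x - ψ y| ^ r with hΨ
    have hΨ0 : 0 ≤ Ψ := by positivity
    have s1 := mul_le_mul_of_nonneg_right hmain hk0
    have s2 : 2⁻¹ * (2 ^ r)⁻¹ * lam * (P / ‖x - y‖ ^ ((N : ℝ) + τ))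
        ≤ 2⁻¹ * (2 ^ r)⁻¹ * P * k x y := by
      have e : 2⁻¹ * (2 ^ r)⁻¹ * lam * (P / ‖x - y‖ ^ ((N : ℝ) + τ))
        = 2⁻¹ * (2 ^ r)⁻¹ * P * (lam / ‖x - y‖ ^ ((N : ℝ) + τ)) := by ring
      rw [e]
      gcongr
    have s3 : ((2 * r) ^ r + 1) * ((max (trunc u m x) (trunc u m y)) ^ r * Ψ) * k x y
        ≤ ((2 * r) ^ r + 1) * Λ * (S * (A ^ r * minKernel r τ L x y)) := by
      calc ((2 * r) ^ r + 1) * ((max (trunc u m x) (trunc u m y)) ^ r * Ψ) * k x y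
          ≤ ((2 * r) ^ r + 1) * (S * Ψ) * (Λ / ‖x - y‖ ^ ((N : ℝ) + τ)) := by gcongr
        _ = ((2 * r) ^ r + 1) * Λ * (S * (Ψ / ‖x - y‖ ^ ((N : ℝ) + τ))) := by ring
        _ ≤ _ := by gcongr
    have s4 : 0 ≤ lam * (S * (A ^ r * minKernel r τ L x y)) := by positivity
    have e2 : (((2 * r) ^ r + 1) * Λ + lam) * A ^ r * (S * minKernel r τ L x y)
      = ((2 * r) ^ r + 1) * Λ * (S * (A ^ r * minKernel r τ L x y))
        + lam * (S * (A ^ r * minKernel r τ L x y)) := by ring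
    rw [e2]
    rw [sub_mul] at s1
    linarith
  · simp only [indicator, mem_compl_iff, hx, hy, not_true_eq_false, not_false_eq_true, if_false,
      if_true, mul_zero, add_zero, hψ.eq_zero y hy, Real.zero_rpow hr0.ne', sub_zero]
    have hfar := hPow_mul_max_lower (u x - m) (u y - m) (η := ψ x ^ r) hr1
      (Real.rpow_nonneg (hψ0 x) r)
    rw [← hrw] at hfar
    have s1 := mul_le_mul_of_nonneg_right hfar hk0
    change -(trunc u m y ^ (r - 1) * (trunc u m x * ψ x ^ r)) * k x y
      ≤ hPow r (u x - u y) * (trunc u m x * ψ x ^ r) * k x y at s1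
    rw [hψ.eq_zero y hy, sub_zero] at hψd
    have s2 : 2⁻¹ * (2 ^ r)⁻¹ * lam * (|trunc u m x * ψ x| ^ r / ‖x - y‖ ^ ((N : ℝ) + τ))
        ≤ (((2 * r) ^ r + 1) * Λ + lam) * A ^ r * (trunc u m x ^ r * minKernel r τ L x y) := by
      calc 2⁻¹ * (2 ^ r)⁻¹ * lam * (|trunc u m x * ψ x| ^ r / ‖x - y‖ ^ ((N : ℝ) + τ))
          ≤ 1 * lam * (|trunc u m x * ψ x| ^ r / ‖x - y‖ ^ ((N : ℝ) + τ)) := by gcongr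
        _ = lam * (trunc u m x ^ r * (|ψ x| ^ r / ‖x - y‖ ^ ((N : ℝ) + τ))) := by
            rw [abs_mul, abs_of_nonneg hwx, Real.mul_rpow hwx (abs_nonneg _)]; ring
        _ ≤ lam * (trunc u m x ^ r * (A ^ r * minKernel r τ L x y)) := by gcongr
        _ ≤ _ := by
            have : 0 ≤ ((2 * r) ^ r + 1) * Λ * (trunc u m x ^ r * (A ^ r * minKernel r τ L x y)) := by
              positivity
            linarith
    linarith
  · simp only [indicator, mem_compl_iff, hx, hy, not_true_eq_false, not_false_eq_true, if_false,
      if_true, mul_zero, zero_add, hψ.eq_zero x hx, Real.zero_rpow hr0.ne', zero_sub, abs_neg]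
    have hfar := hPow_mul_max_lower (u y - m) (u x - m) (η := ψ y ^ r) hr1
      (Real.rpow_nonneg (hψ0 y) r)
    have hrw' : (u y - m) - (u x - m) = -(u x - u y) := by ring
    rw [hrw', hPow_neg] at hfar
    have s1 := mul_le_mul_of_nonneg_right hfar hk0
    change -(trunc u m x ^ (r - 1) * (trunc u m y * ψ y ^ r)) * k x y
      ≤ -hPow r (u x - u y) * (trunc u m y * ψ y ^ r) * k x y at s1
    rw [hψ.eq_zero x hx, zero_sub, abs_neg] at hψd
    have s2 : 2⁻¹ * (2 ^ r)⁻¹ * lam * (|trunc u m y * ψ y| ^ r / ‖x - y‖ ^ ((N : ℝ) + τ))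
        ≤ (((2 * r) ^ r + 1) * Λ + lam) * A ^ r * (trunc u m y ^ r * minKernel r τ L x y) := by
      calc 2⁻¹ * (2 ^ r)⁻¹ * lam * (|trunc u m y * ψ y| ^ r / ‖x - y‖ ^ ((N : ℝ) + τ))
          ≤ 1 * lam * (|trunc u m y * ψ y| ^ r / ‖x - y‖ ^ ((N : ℝ) + τ)) := by gcongr
        _ = lam * (trunc u m y ^ r * (|ψ y| ^ r / ‖x - y‖ ^ ((N : ℝ) + τ))) := by
            rw [abs_mul, abs_of_nonneg hwy, Real.mul_rpow hwy (abs_nonneg _)]; ring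
        _ ≤ lam * (trunc u m y ^ r * (A ^ r * minKernel r τ L x y)) := by gcongr
        _ ≤ _ := by
            have : 0 ≤ ((2 * r) ^ r + 1) * Λ * (trunc u m y ^ r * (A ^ r * minKernel r τ L x y)) := by
              positivity
            linarith
    rw [h.kernel_symm y x]
    linarith
  · simp [indicator, hx, hy, hψ.eq_zero x hx, hψ.eq_zero y hy, Real.zero_rpow hr0.ne']

theorem exists_caccioppoli (hN : 1 ≤ N) (hτ : 0 < τ) (hτr : τ < r) :
    ∃ C : ℝ, 0 < C ∧ ∀ {Λ δ : ℝ} {k : RN N → RN N → ℝ} {U K : Set (RN N)} {u : RN N → ℝ},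
      IsPhase r τ Λ δ k U K u → ∀ {B K₀ : Set (RN N)}, MeasurableSet B → MeasurableSet K₀ →
      K₀ ⊆ B → ∀ {A L lam T : ℝ}, 0 < L → ∀ {ψ : RN N → ℝ}, IsCutoff B A L ψ → (∀ x, 0 ≤ ψ x) →
      (∀ x, ψ x ≤ 1) → (∀ x, x ∉ K₀ → ψ x = 0) → 0 ≤ lam → 0 ≤ T →
      (∀ x ∈ B, ∀ y ∈ B, x ≠ y → lam / ‖x - y‖ ^ ((N : ℝ) + τ) ≤ k x y) → ∀ m : ℝ,
      IsTest r τ K (fun x => trunc u m x * ψ x ^ r) →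
      energy r τ (fun x => trunc u m x * ψ x) < ⊤ →
      ∫⁻ x in B, ENNReal.ofReal (trunc u m x ^ r) < ⊤ →
      ∫⁻ x in B, ENNReal.ofReal (trunc u m x) < ⊤ →
      (∀ x ∈ K₀, ∫⁻ y in Bᶜ, ENNReal.ofReal (k x y * trunc u m y ^ (r - 1)) ≤ ENNReal.ofReal T) →
      2⁻¹ * (2 ^ r)⁻¹ * lam * (energy r τ (fun x => trunc u m x * ψ x)).toReal
        ≤ ∫ z, phaseIntegrand r k u (fun x => trunc u m x * ψ x ^ r) z
            ∂((volume : Measure (RN N)).prod (volume : Measure (RN N)))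
          + C * (Λ + lam) * A ^ r * L ^ τ * (∫⁻ x in B, ENNReal.ofReal (trunc u m x ^ r)).toReal
          + 2 * T * (∫⁻ x in B, ENNReal.ofReal (trunc u m x)).toReal := by
  obtain ⟨K₁, hK₁, hJ⟩ := exists_lintegral_add_mul_minKernel_le hN hτ hτr
  have hr0 : 0 < r := hτ.trans hτr
  refine ⟨((2 * r) ^ r + 1) * K₁, by positivity, ?_⟩
  intro Λ δ k U K u h B K₀ hB hK₀ hK₀B A L lam T hL ψ hψ hψ0 hψ1 hψK hlam hT hk m ht hE hY hW htail
  have hA : 0 ≤ A := (abs_nonneg _).trans (hψ.abs_le 0)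
  have hΛ := h.Λ_nonneg
  have hu := h.measurable
  have hwm := measurable_trunc hu m
  set w := trunc u m with hw
  have hw0 : ∀ x, 0 ≤ w x := trunc_nonneg u m
  set C₁ := ((2 * r) ^ r + 1) * Λ + lam with hC₁
  have hC₁0 : 0 ≤ C₁ := by positivity
  set Y := (∫⁻ x in B, ENNReal.ofReal (w x ^ r)).toReal with hYdef
  set W := (∫⁻ x in B, ENNReal.ofReal (w x)).toReal with hWdef
  have hψm := hψ.measurable
  have hPm : Measurable fun z : RN N × RN N => 2⁻¹ * (2 ^ r)⁻¹ * lam *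
      (|w z.1 * ψ z.1 - w z.2 * ψ z.2| ^ r / ‖z.1 - z.2‖ ^ ((N : ℝ) + τ)) := by fun_prop
  have hmkm : Measurable fun z : RN N × RN N => minKernel r τ L z.1 z.2 := by
    unfold minKernel; fun_prop
  -- far interaction
  set J : RN N × RN N → ℝ := fun z => w z.1 * ψ z.1 ^ r *
      Bᶜ.indicator (fun y => k z.1 y * w y ^ (r - 1)) z.2 with hJdef
  have hJm : Measurable J := by
    have e : J = fun z => w z.1 * ψ z.1 ^ r * (univ ×ˢ Bᶜ).indicator
        (fun z : RN N × RN N => k z.1 z.2 * w z.2 ^ (r - 1)) z := by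
      funext z
      by_cases hz : z.2 ∈ B <;> simp [hJdef, hz, indicator]
    rw [e]
    refine Measurable.mul (by fun_prop) (Measurable.indicator ?_ (MeasurableSet.univ.prod hB.compl))
    exact h.kernel_measurable.mul (by fun_prop)
  have hind0 : ∀ x, 0 ≤ B.indicator (fun x => w x ^ r) x := fun x =>
    indicator_nonneg (fun x _ => Real.rpow_nonneg (hw0 x) r) x
  have hJ0 : ∀ z, 0 ≤ J z := by
    rintro ⟨x, y⟩
    by_cases hx : x ∈ B
    · by_cases hy : y ∈ B
      · simp [hJdef, hy]
      · have hxy : x ≠ y := fun e => hy (e ▸ hx)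
        have := h.kernel_nonneg x y hxy
        have := Real.rpow_nonneg (hw0 y) (r - 1)
        have := Real.rpow_nonneg (hψ0 x) r
        have := hw0 x
        simp only [hJdef, indicator, mem_compl_iff, hy, not_false_eq_true, if_true]
        positivity
    · simp [hJdef, hψ.eq_zero x hx, Real.zero_rpow hr0.ne']
  have hJint : ∫⁻ z, ENNReal.ofReal (J z) ∂((volume : Measure (RN N)).prod volume)
      ≤ ENNReal.ofReal (T * W) := by
    rw [lintegral_prod _ (by fun_prop)]
    calc ∫⁻ x, ∫⁻ y, ENNReal.ofReal (J (x, y))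
        ≤ ∫⁻ x, B.indicator (fun x => ENNReal.ofReal (w x)) x * ENNReal.ofReal T := by
          refine lintegral_mono fun x => ?_
          by_cases hx : x ∈ K₀
          · have hxB := hK₀B hx
            have hψr := Real.rpow_nonneg (hψ0 x) r
            have hw0x := hw0 x
            have e : ∀ y, ENNReal.ofReal (J (x, y)) = ENNReal.ofReal (w x * ψ x ^ r) *
                Bᶜ.indicator (fun y => ENNReal.ofReal (k x y * w y ^ (r - 1))) y := by
              intro y
              simp only [hJdef]
              rw [ENNReal.ofReal_mul (mul_nonneg hw0x hψr)]
              by_cases hy : y ∈ B <;> simp [hy]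
            simp_rw [e]
            rw [lintegral_const_mul' _ _ ENNReal.ofReal_ne_top, lintegral_indicator hB.compl,
              indicator_of_mem hxB]
            refine mul_le_mul' (ENNReal.ofReal_le_ofReal ?_) (htail x hx)
            exact mul_le_of_le_one_right hw0x (Real.rpow_le_one (hψ0 x) (hψ1 x) hr0.le)
          · have e : ∀ y, J (x, y) = 0 := fun y => by
              simp [hJdef, hψK x hx, Real.zero_rpow hr0.ne']
            simp [e]
      _ = ENNReal.ofReal (T * W) := by
          rw [lintegral_mul_const' _ _ ENNReal.ofReal_ne_top, lintegral_indicator hB,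
            ENNReal.ofReal_mul hT, hWdef, ENNReal.ofReal_toReal hW.ne, mul_comm]
  have hJswap : ∫⁻ z, ENNReal.ofReal (J z.swap) ∂((volume : Measure (RN N)).prod volume)
      ≤ ENNReal.ofReal (T * W) := by
    rw [lintegral_prod_swap (f := fun z => ENNReal.ofReal (J z))]
    exact hJint
  set G : RN N × RN N → ℝ := fun z => C₁ * A ^ r *
    ((B.indicator (fun x => w x ^ r) z.1 + B.indicator (fun x => w x ^ r) z.2)
      * minKernel r τ L z.1 z.2) with hG
  have hindm : Measurable (B.indicator fun x => w x ^ r) := (hwm.pow_const r).indicator hB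
  have hGm : Measurable G := by
    have h1 : Measurable fun z : RN N × RN N => B.indicator (fun x => w x ^ r) z.1 :=
      hindm.comp measurable_fst
    have h2 : Measurable fun z : RN N × RN N => B.indicator (fun x => w x ^ r) z.2 :=
      hindm.comp measurable_snd
    exact ((h1.add h2).mul hmkm).const_mul _
  have hG0 : ∀ z, 0 ≤ G z := fun z => by
    have := hind0 z.1
    have := hind0 z.2
    have := minKernel_nonneg (r := r) (τ := τ) hL.le z.1 z.2
    simp only [hG]
    positivity
  have hGint : ∫⁻ z, ENNReal.ofReal (G z) ∂((volume : Measure (RN N)).prod volume)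
      ≤ ENNReal.ofReal (C₁ * A ^ r * (K₁ * L ^ τ * Y)) := by
    rw [lintegral_prod _ (by fun_prop)]
    have e : ∀ x y, ENNReal.ofReal (G (x, y)) = ENNReal.ofReal (C₁ * A ^ r) *
        ((ENNReal.ofReal (B.indicator (fun x => w x ^ r) x)
          + ENNReal.ofReal (B.indicator (fun x => w x ^ r) y))
          * ENNReal.ofReal (minKernel r τ L x y)) := by
      intro x y
      rw [← ENNReal.ofReal_add (hind0 x) (hind0 y),
        ← ENNReal.ofReal_mul (add_nonneg (hind0 x) (hind0 y)),
        ← ENNReal.ofReal_mul (by positivity)]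
    simp_rw [e]
    have e2 : ∀ x, ∫⁻ y, ENNReal.ofReal (C₁ * A ^ r) *
        ((ENNReal.ofReal (B.indicator (fun x => w x ^ r) x)
          + ENNReal.ofReal (B.indicator (fun x => w x ^ r) y))
          * ENNReal.ofReal (minKernel r τ L x y)) = ENNReal.ofReal (C₁ * A ^ r) * ∫⁻ y,
        ((ENNReal.ofReal (B.indicator (fun x => w x ^ r) x)
          + ENNReal.ofReal (B.indicator (fun x => w x ^ r) y))
          * ENNReal.ofReal (minKernel r τ L x y)) := fun x =>
      lintegral_const_mul' _ _ ENNReal.ofReal_ne_top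
    simp_rw [e2]
    rw [lintegral_const_mul' _ _ ENNReal.ofReal_ne_top,
      ENNReal.ofReal_mul (p := C₁ * A ^ r) (by positivity)]
    refine mul_le_mul' le_rfl ?_
    have h1 := hJ L hL (fun x => ENNReal.ofReal (B.indicator (fun x => w x ^ r) x))
      hindm.ennreal_ofReal
    refine h1.trans (le_of_eq ?_)
    rw [ENNReal.ofReal_mul (p := K₁ * L ^ τ) (by positivity), hYdef,
      ENNReal.ofReal_toReal hY.ne]
    congr 1
    rw [← lintegral_indicator hB]
    refine lintegral_congr fun x => ?_
    by_cases hx : x ∈ B <;> simp [hx]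
  have hY0 : 0 ≤ Y := ENNReal.toReal_nonneg
  have hW0 : 0 ≤ W := ENNReal.toReal_nonneg
  have hcp : 0 ≤ 2⁻¹ * (2 ^ r)⁻¹ * lam := by positivity
  have hPint : ∫⁻ z, ENNReal.ofReal (2⁻¹ * (2 ^ r)⁻¹ * lam *
      (|w z.1 * ψ z.1 - w z.2 * ψ z.2| ^ r / ‖z.1 - z.2‖ ^ ((N : ℝ) + τ)))
        ∂((volume : Measure (RN N)).prod volume)
      = ENNReal.ofReal (2⁻¹ * (2 ^ r)⁻¹ * lam) * energy r τ (fun x => w x * ψ x) := by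
    simp_rw [ENNReal.ofReal_mul hcp]
    rw [lintegral_const_mul' _ _ ENNReal.ofReal_ne_top, lintegral_prod _ (by fun_prop)]
    rfl
  have hQ : caccioppoliError r τ A L C₁ k B w ψ = fun z => G z + (J z + J z.swap) := by
    funext z
    simp only [caccioppoliError, hG, hJdef, Prod.fst_swap, Prod.snd_swap]
  have hJsm : Measurable fun z : RN N × RN N => J z.swap := hJm.comp measurable_swap
  have key := toReal_lintegral_le_integral_add
    (B := C₁ * A ^ r * (K₁ * L ^ τ * Y) + (T * W + T * W))
    (h.integrable_phaseIntegrand ht) hPm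
    (Q := caccioppoliError r τ A L C₁ k B w ψ)
    (by rw [hQ]; exact hGm.add (hJm.add hJsm))
    (fun z => by positivity)
    (fun z => by rw [hQ]; exact add_nonneg (hG0 z) (add_nonneg (hJ0 _) (hJ0 _)))
    (by rw [hPint]; exact ENNReal.mul_lt_top ENNReal.ofReal_lt_top hE)
    (by positivity)
    (by
      rw [hQ]
      have e : ∀ z, ENNReal.ofReal (G z + (J z + J z.swap)) = ENNReal.ofReal (G z) +
          (ENNReal.ofReal (J z) + ENNReal.ofReal (J z.swap)) := fun z => by
        rw [ENNReal.ofReal_add (hG0 z) (add_nonneg (hJ0 _) (hJ0 _)),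
          ENNReal.ofReal_add (hJ0 _) (hJ0 _)]
      simp_rw [e]
      rw [lintegral_add_left hGm.ennreal_ofReal, lintegral_add_left hJm.ennreal_ofReal,
        ENNReal.ofReal_add (by positivity) (by positivity),
        ENNReal.ofReal_add (by positivity) (by positivity)]
      exact add_le_add hGint (add_le_add hJint hJswap))
    (fun z => h.le_phaseIntegrand_add hL.le hψ hψ0 hlam hk m z)
  rw [hPint, ENNReal.toReal_mul, ENNReal.toReal_ofReal hcp] at key
  have hfin : C₁ * A ^ r * (K₁ * L ^ τ * Y)
      ≤ ((2 * r) ^ r + 1) * K₁ * (Λ + lam) * A ^ r * L ^ τ * Y := by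
    have h1 : C₁ ≤ ((2 * r) ^ r + 1) * (Λ + lam) := by
      have : 0 ≤ (2 * r) ^ r * lam := by positivity
      rw [hC₁]; linarith
    have h2 : 0 ≤ A ^ r * (K₁ * L ^ τ * Y) := by positivity
    calc C₁ * A ^ r * (K₁ * L ^ τ * Y) = C₁ * (A ^ r * (K₁ * L ^ τ * Y)) := by ring
      _ ≤ ((2 * r) ^ r + 1) * (Λ + lam) * (A ^ r * (K₁ * L ^ τ * Y)) := by gcongr
      _ = _ := by ring
  linarith

end

/-! ### Level sets and the level estimate for one phase -/

section

variable {N : ℕ} {r τ Λ δ : ℝ} {k : RN N → RN N → ℝ} {U K : Set (RN N)} {u : RN N → ℝ}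

/-- The excess `∫_{B_ρ(x₀)} (u-m)_+^r`. -/
noncomputable def excess (r : ℝ) (u : RN N → ℝ) (m : ℝ) (x₀ : RN N) (ρ : ℝ) : ℝ :=
  (∫⁻ x in Metric.ball x₀ ρ, ENNReal.ofReal (trunc u m x ^ r)).toReal

theorem excess_nonneg (r : ℝ) (u : RN N → ℝ) (m : ℝ) (x₀ : RN N) (ρ : ℝ) :
    0 ≤ excess r u m x₀ ρ := ENNReal.toReal_nonneg

theorem trunc_anti (u : RN N → ℝ) {h m : ℝ} (hm : h ≤ m) (x : RN N) :
    trunc u m x ≤ trunc u h x :=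
  max_le_max_right _ (by linarith)

theorem toReal_lintegral_mono {X : Type*} [MeasurableSpace X] {μ : Measure X} {f g : X → ℝ≥0∞}
    {c : ℝ} (hc : 0 ≤ c) (hg : ∫⁻ x, g x ∂μ < ⊤) (h : ∀ x, f x ≤ ENNReal.ofReal c * g x) :
    (∫⁻ x, f x ∂μ).toReal ≤ c * (∫⁻ x, g x ∂μ).toReal := by
  have h1 : ∫⁻ x, f x ∂μ ≤ ENNReal.ofReal c * ∫⁻ x, g x ∂μ :=
    (lintegral_mono h).trans (le_of_eq (lintegral_const_mul' _ _ ENNReal.ofReal_ne_top))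
  have h2 := ENNReal.toReal_mono (ENNReal.mul_lt_top ENNReal.ofReal_lt_top hg).ne h1
  rwa [ENNReal.toReal_mul, ENNReal.toReal_ofReal hc] at h2

theorem excess_anti (hr : 0 ≤ r) {h m ρ ρ' : ℝ} {x₀ : RN N} (hm : h ≤ m) (hρ : ρ' ≤ ρ)
    (hfin : ∫⁻ x in Metric.ball x₀ ρ, ENNReal.ofReal (trunc u h x ^ r) < ⊤) :
    excess r u m x₀ ρ' ≤ excess r u h x₀ ρ := by
  refine ENNReal.toReal_mono hfin.ne ?_
  refine (lintegral_mono_set (Metric.ball_subset_ball hρ)).trans (lintegral_mono fun x => ?_)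
  exact ENNReal.ofReal_le_ofReal (Real.rpow_le_rpow (trunc_nonneg _ _ _) (trunc_anti u hm x) hr)

theorem trunc_le_mul_rpow (hr : 1 ≤ r) {h m : ℝ} (hm : h < m) (x : RN N) :
    trunc u m x ≤ (m - h) ^ (-(r - 1)) * trunc u h x ^ r := by
  have hmh : 0 < m - h := sub_pos.2 hm
  rcases le_or_gt (u x) m with hu | hu
  · have : trunc u m x = 0 := max_eq_right (by linarith)
    rw [this]
    have := Real.rpow_nonneg (trunc_nonneg u h x) r
    positivity
  · have e1 : trunc u m x = u x - m := max_eq_left (by linarith)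
    have e2 : trunc u h x = u x - h := max_eq_left (by linarith)
    rw [e1, e2]
    have ht : 0 < u x - h := by linarith
    have e3 : (u x - h) ^ r = (u x - h) ^ (r - 1) * (u x - h) := by
      rw [← Real.rpow_add_one ht.ne']; congr 1; ring
    have h1 : (m - h) ^ (r - 1) ≤ (u x - h) ^ (r - 1) :=
      Real.rpow_le_rpow hmh.le (by linarith) (by linarith)
    rw [e3, Real.rpow_neg hmh.le, ← mul_assoc, ← div_eq_inv_mul]
    have h2 : 1 ≤ (u x - h) ^ (r - 1) / (m - h) ^ (r - 1) := by
      rw [le_div_iff₀ (Real.rpow_pos_of_pos hmh _)]; linarith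
    nlinarith

theorem lintegral_trunc_le (hr : 1 ≤ r) {h m ρ : ℝ} {x₀ : RN N} (hm : h < m)
    (hfin : ∫⁻ x in Metric.ball x₀ ρ, ENNReal.ofReal (trunc u h x ^ r) < ⊤) :
    (∫⁻ x in Metric.ball x₀ ρ, ENNReal.ofReal (trunc u m x)).toReal
      ≤ (m - h) ^ (-(r - 1)) * excess r u h x₀ ρ := by
  have hmh : 0 < m - h := sub_pos.2 hm
  refine toReal_lintegral_mono (by positivity) hfin fun x => ?_
  rw [← ENNReal.ofReal_mul (by positivity)]
  exact ENNReal.ofReal_le_ofReal (trunc_le_mul_rpow hr hm x)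

theorem lintegral_trunc_lt_top (hr : 1 ≤ r) {m ρ : ℝ} {x₀ : RN N}
    (hfin : ∀ h, ∫⁻ x in Metric.ball x₀ ρ, ENNReal.ofReal (trunc u h x ^ r) < ⊤) :
    ∫⁻ x in Metric.ball x₀ ρ, ENNReal.ofReal (trunc u m x) < ⊤ := by
  have hm : m - 1 < m := by linarith
  refine (lintegral_mono fun x => ENNReal.ofReal_le_ofReal
    (trunc_le_mul_rpow (r := r) hr hm x)).trans_lt ?_
  simp only [sub_sub_cancel, Real.one_rpow, one_mul]
  exact hfin (m - 1)

/-- The part of a ball where `u` exceeds the level `m`. -/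
def levelSet (u : RN N → ℝ) (m : ℝ) (x₀ : RN N) (ρ : ℝ) : Set (RN N) :=
  Metric.ball x₀ ρ ∩ {x | m < u x}

theorem measurableSet_levelSet (hu : Measurable u) (m : ℝ) (x₀ : RN N) (ρ : ℝ) :
    MeasurableSet (levelSet u m x₀ ρ) :=
  measurableSet_ball.inter (measurableSet_lt measurable_const hu)

theorem volume_levelSet_lt_top (u : RN N → ℝ) (m : ℝ) (x₀ : RN N) (ρ : ℝ) :
    volume (levelSet u m x₀ ρ) < ⊤ :=
  (measure_mono inter_subset_left).trans_lt measure_ball_lt_top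

theorem volume_levelSet_le (hr : 0 ≤ r) (hu : Measurable u) {h m ρ : ℝ} {x₀ : RN N} (hm : h < m)
    (hfin : ∫⁻ x in Metric.ball x₀ ρ, ENNReal.ofReal (trunc u h x ^ r) < ⊤) :
    (volume (levelSet u m x₀ ρ)).toReal ≤ (m - h) ^ (-r) * excess r u h x₀ ρ := by
  have hmh : 0 < m - h := sub_pos.2 hm
  have e : volume (levelSet u m x₀ ρ)
      = ∫⁻ x in Metric.ball x₀ ρ, {x | m < u x}.indicator (fun _ => (1 : ℝ≥0∞)) x := by
    rw [lintegral_indicator (measurableSet_lt measurable_const hu), setLIntegral_one,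
      Measure.restrict_apply (measurableSet_lt measurable_const hu), levelSet, inter_comm]
  rw [e]
  refine toReal_lintegral_mono (by positivity) hfin fun x => ?_
  by_cases hx : m < u x
  · rw [indicator_of_mem (show x ∈ {x | m < u x} from hx), ← ENNReal.ofReal_mul (by positivity),
      ← ENNReal.ofReal_one]
    apply ENNReal.ofReal_le_ofReal
    have e2 : trunc u h x = u x - h := max_eq_left (by linarith)
    rw [e2, Real.rpow_neg hmh.le, ← div_eq_inv_mul, le_div_iff₀ (Real.rpow_pos_of_pos hmh _),
      one_mul]
    exact Real.rpow_le_rpow hmh.le (by linarith) hr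
  · rw [indicator_of_notMem (show x ∉ {x | m < u x} from hx)]
    exact zero_le

theorem IsCutoff.mono {B B' : Set (RN N)} {A L : ℝ} {ψ : RN N → ℝ} (h : IsCutoff B A L ψ)
    (hB : B ⊆ B') : IsCutoff B' A L ψ :=
  ⟨h.measurable, h.abs_le, h.abs_sub_le, fun x hx => h.eq_zero x fun hx' => hx (hB hx')⟩

theorem cutoff_rpow_rpow (x₀ : RN N) (a b θ r : ℝ) (x : RN N) :
    (cutoff x₀ a b x ^ θ) ^ r = cutoff x₀ a b x ^ (θ * r) := by
  rw [← Real.rpow_mul (cutoff_nonneg _ _ _ _)]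

theorem IsPhase.lintegral_trunc_lt_top' (h : IsPhase r τ Λ δ k U K u) (hU : volume U < ⊤)
    {B : Set (RN N)} (hB : B ⊆ U) (m : ℝ) :
    ∫⁻ x in B, ENNReal.ofReal (trunc u m x ^ r) < ⊤ :=
  (lintegral_mono_set hB).trans_lt
    (lintegral_trunc_rpow_lt_top (by linarith [h.one_lt]) hU h.lintegral_lt_top m)

theorem IsPhase.energy_trunc_mul_lt_top (h : IsPhase r τ Λ δ k U K u) (hU : volume U < ⊤)
    {A L : ℝ} (hL : 0 < L) {ψ : RN N → ℝ} (hψ : IsCutoff U A L ψ) (m : ℝ) :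
    energy r τ (fun x => trunc u m x * ψ x) < ⊤ := by
  obtain ⟨K₁, hK₁, hE⟩ := exists_energy_mul_cutoff_le h.one_le_dim h.τ_pos h.τ_lt
  have hr0 : 0 ≤ r := by linarith [h.one_lt]
  refine (hE U h.measurableSet_U A L hL ψ hψ _ (measurable_trunc h.measurable m)).trans_lt ?_
  refine ENNReal.mul_lt_top ENNReal.ofReal_lt_top (ENNReal.add_lt_top.2 ⟨?_,
    ENNReal.mul_lt_top ENNReal.ofReal_lt_top ?_⟩)
  · exact (energyOn_trunc_le hr0 U u m).trans_lt h.energyOn_lt_top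
  · simp_rw [abs_of_nonneg (trunc_nonneg u m _)]
    exact h.lintegral_trunc_lt_top' hU subset_rfl m

theorem lintegral_trunc_mul_le {B : Set (RN N)} (hB : MeasurableSet B) (hr : 0 < r)
    {ψ : RN N → ℝ} (hψ0 : ∀ x, 0 ≤ ψ x) (hψ1 : ∀ x, ψ x ≤ 1) (hψB : ∀ x, x ∉ B → ψ x = 0)
    (m : ℝ) :
    ∫⁻ x, ENNReal.ofReal (|trunc u m x * ψ x| ^ r)
      ≤ ∫⁻ x in B, ENNReal.ofReal (trunc u m x ^ r) := by
  rw [← lintegral_indicator hB]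
  refine lintegral_mono fun x => ?_
  simp only
  by_cases hx : x ∈ B
  · rw [indicator_of_mem hx, abs_of_nonneg (mul_nonneg (trunc_nonneg _ _ _) (hψ0 x))]
    exact ENNReal.ofReal_le_ofReal (Real.rpow_le_rpow (mul_nonneg (trunc_nonneg _ _ _) (hψ0 x))
      (mul_le_of_le_one_right (trunc_nonneg _ _ _) (hψ1 x)) hr.le)
  · simp [hψB x hx, Real.zero_rpow hr.ne']

theorem IsPhase.isTest_trunc_mul (h : IsPhase r τ Λ δ k U K u) (hU : volume U < ⊤)
    {A L : ℝ} (hL : 0 < L) {ψ : RN N → ℝ} (hψ : IsCutoff U A L ψ) (hψ0 : ∀ x, 0 ≤ ψ x)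
    (hψ1 : ∀ x, ψ x ≤ 1) {K₀ : Set (RN N)} (hK₀ : ∀ x, x ∉ K₀ → ψ x = 0) (m : ℝ) :
    IsTest r τ K₀ (fun x => trunc u m x * ψ x) where
  measurable := (measurable_trunc h.measurable m).mul hψ.measurable
  eq_zero x hx := by simp [hK₀ x hx]
  lintegral_lt_top := (lintegral_trunc_mul_le h.measurableSet_U (by linarith [h.one_lt])
    hψ0 hψ1 hψ.eq_zero m).trans_lt (h.lintegral_trunc_lt_top' hU subset_rfl m)
  energy_lt_top := h.energy_trunc_mul_lt_top hU hL hψ m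

theorem exists_level_estimate (hN : 1 ≤ N) (hτ : 0 < τ) (hτr : τ < r) (hr : 1 < r)
    (Λ lam θ : ℝ) (hΛ : 0 ≤ Λ) (hlam : 0 ≤ lam) (hθ : 1 ≤ θ) :
    ∃ C : ℝ, 0 < C ∧ ∀ {δ : ℝ} {k b : RN N → RN N → ℝ} {u : RN N → ℝ} {x₀ : RN N} {R : ℝ},
      0 < R → IsPhase r τ Λ δ k (Metric.ball x₀ (4 * R)) (Metric.closedBall x₀ (2 * R)) u →
      (∀ x ∈ Metric.ball x₀ (2 * R), ∀ y ∈ Metric.ball x₀ (2 * R), x ≠ y →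
        lam / ‖x - y‖ ^ ((N : ℝ) + τ) ≤ k x y) →
      (∀ x y, 0 ≤ b x y) → (∀ x y, x ≠ y → k x y ≤ b x y / ‖x - y‖ ^ ((N : ℝ) + τ)) →
      ∀ {k' kt : ℝ}, 0 < kt →
      (∀ x, ∫⁻ y in (Metric.ball x₀ R)ᶜ,
        ENNReal.ofReal (b x y * (trunc u k' y ^ (r - 1) / ‖x₀ - y‖ ^ ((N : ℝ) + τ)))
          ≤ ENNReal.ofReal (Λ * (R ^ (-τ) * kt ^ (r - 1)))) →
      ∀ {d ρ h : ℝ}, 0 < d → d ≤ 1 → R ≤ ρ → ρ + d * R ≤ 2 * R → k' ≤ h →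
      2⁻¹ * (2 ^ r)⁻¹ * lam * (energy r τ (fun x => trunc u (h + d * kt) x *
          cutoff x₀ ρ (ρ + d * R / 2) x ^ θ)).toReal
        ≤ ∫ z, phaseIntegrand r k u (fun x => trunc u (h + d * kt) x *
              cutoff x₀ ρ (ρ + d * R / 2) x ^ (θ * r)) z
            ∂((volume : Measure (RN N)).prod (volume : Measure (RN N)))
          + C * d ^ (-((N : ℝ) + τ + r)) * (R ^ (-τ) * excess r u h x₀ (ρ + d * R)) := by
  obtain ⟨C₀, hC₀, hcac⟩ := exists_caccioppoli hN hτ hτr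
  have hθ0 : 0 < θ := by linarith
  refine ⟨C₀ * (Λ + lam) * θ ^ r * 2 ^ τ + 2 * (4 ^ ((N : ℝ) + τ) * Λ) + 1, by positivity, ?_⟩
  intro δ k b u x₀ R hR hph hk hb0 hb k' kt hkt htail d ρ h hd hd1 hRρ hρ hk'h
  have hr0 : 0 < r := by linarith
  have hdR : 0 < d * R := mul_pos hd hR
  have hdk : 0 < d * kt := mul_pos hd hkt
  set m := h + d * kt with hm
  have hhm : h < m := by rw [hm]; linarith
  set ρ₂ := ρ + d * R / 2 with hρ₂
  set ρ₁ := ρ + d * R with hρ₁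
  have hρρ₂ : ρ < ρ₂ := by rw [hρ₂]; linarith
  have hρ₂₁ : ρ₂ < ρ₁ := by rw [hρ₂, hρ₁]; linarith
  set ψ : RN N → ℝ := fun x => cutoff x₀ ρ ρ₂ x ^ θ with hψdef
  have hψ0 : ∀ x, 0 ≤ ψ x := fun x => Real.rpow_nonneg (cutoff_nonneg _ _ _ _) _
  have hψ1 : ∀ x, ψ x ≤ 1 := fun x =>
    Real.rpow_le_one (cutoff_nonneg _ _ _ _) (cutoff_le_one _ _ _ _) hθ0.le
  have hL : 0 < (ρ₂ - ρ)⁻¹ := inv_pos.2 (sub_pos.2 hρρ₂)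
  have hcut : IsCutoff (Metric.ball x₀ ρ₂) θ (ρ₂ - ρ)⁻¹ ψ := isCutoff_cutoff_rpow hρρ₂ hθ
  have hcutB := hcut.mono (Metric.ball_subset_ball hρ₂₁.le)
  have hBU : Metric.ball x₀ ρ₁ ⊆ Metric.ball x₀ (4 * R) := Metric.ball_subset_ball (by linarith)
  have hcutU := hcutB.mono hBU
  have hU : volume (Metric.ball x₀ (4 * R)) < ⊤ := measure_ball_lt_top
  have hcutr : IsCutoff (Metric.ball x₀ (4 * R)) (θ * r) (ρ₂ - ρ)⁻¹
      (fun x => cutoff x₀ ρ ρ₂ x ^ (θ * r)) :=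
    (isCutoff_cutoff_rpow hρρ₂ (by nlinarith)).mono
      (Metric.ball_subset_ball (by linarith))
  have hfun : (fun x => trunc u m x * ψ x ^ r)
      = fun x => trunc u m x * cutoff x₀ ρ ρ₂ x ^ (θ * r) := by
    funext x
    rw [hψdef, cutoff_rpow_rpow]
  have hψK : ∀ x, x ∉ Metric.closedBall x₀ ρ₂ → ψ x = 0 := fun x hx =>
    hcut.eq_zero x fun hx' => hx (Metric.ball_subset_closedBall hx')
  have hψrK : ∀ x, x ∉ Metric.closedBall x₀ (2 * R) → cutoff x₀ ρ ρ₂ x ^ (θ * r) = 0 :=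
    fun x hx => by
      rw [← cutoff_rpow_rpow]
      change ψ x ^ r = 0
      rw [hψK x fun hx' => hx (Metric.closedBall_subset_closedBall (by linarith) hx'),
        Real.zero_rpow hr0.ne']
  have ht : IsTest r τ (Metric.closedBall x₀ (2 * R))
      (fun x => trunc u m x * cutoff x₀ ρ ρ₂ x ^ (θ * r)) :=
    hph.isTest_trunc_mul hU hL hcutr
      (fun x => Real.rpow_nonneg (cutoff_nonneg _ _ _ _) _)
      (fun x => Real.rpow_le_one (cutoff_nonneg _ _ _ _) (cutoff_le_one _ _ _ _) (by positivity))
      hψrK m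
  have hfin : ∀ m, ∫⁻ x in Metric.ball x₀ ρ₁, ENNReal.ofReal (trunc u m x ^ r) < ⊤ := fun m =>
    hph.lintegral_trunc_lt_top' hU hBU m
  set T := (4 / d) ^ ((N : ℝ) + τ) * (Λ * (R ^ (-τ) * kt ^ (r - 1))) with hT
  have hT0 : 0 ≤ T := by positivity
  have htailT : ∀ x ∈ Metric.closedBall x₀ ρ₂, ∫⁻ y in (Metric.ball x₀ ρ₁)ᶜ,
      ENNReal.ofReal (k x y * trunc u m y ^ (r - 1)) ≤ ENNReal.ofReal T := by
    intro x hx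
    rw [hT, ENNReal.ofReal_mul (by positivity)]
    calc ∫⁻ y in (Metric.ball x₀ ρ₁)ᶜ, ENNReal.ofReal (k x y * trunc u m y ^ (r - 1))
        ≤ ∫⁻ y in (Metric.ball x₀ ρ₁)ᶜ, ENNReal.ofReal ((4 / d) ^ ((N : ℝ) + τ)) *
          ENNReal.ofReal (b x y * (trunc u k' y ^ (r - 1) / ‖x₀ - y‖ ^ ((N : ℝ) + τ))) := by
          refine setLIntegral_mono' measurableSet_ball.compl fun y hy => ?_
          rw [← ENNReal.ofReal_mul (by positivity)]
          apply ENNReal.ofReal_le_ofReal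
          have hy' : ρ₁ ≤ ‖x₀ - y‖ := by
            rw [mem_compl_iff, Metric.mem_ball, not_lt, dist_comm, dist_eq_norm] at hy
            exact hy
          have hx' : ‖x₀ - x‖ ≤ ρ₂ := by
            rw [Metric.mem_closedBall, dist_comm, dist_eq_norm] at hx
            exact hx
          have htri : ‖x₀ - y‖ ≤ ‖x₀ - x‖ + ‖x - y‖ := norm_sub_le_norm_sub_add_norm_sub _ _ _
          have hz : 0 < ‖x₀ - y‖ := by linarith
          have hdist : d / 4 * ‖x₀ - y‖ ≤ ‖x - y‖ := by
            have h1 : ρ₁ ≤ 2 * R := hρ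
            have h2 : ρ₂ = ρ₁ - d * R / 2 := by rw [hρ₂, hρ₁]; ring
            have h3 : ‖x₀ - y‖ - ρ₁ + d * R / 2 ≤ ‖x - y‖ := by linarith
            nlinarith
          have hxy0 : 0 < ‖x - y‖ := lt_of_lt_of_le (by positivity) hdist
          have hxy : x ≠ y := fun e => by
            rw [e, sub_self, norm_zero] at hxy0; exact lt_irrefl _ hxy0
          have hw : trunc u m y ^ (r - 1) ≤ trunc u k' y ^ (r - 1) :=
            Real.rpow_le_rpow (trunc_nonneg _ _ _) (trunc_anti u (by linarith) y) (by linarith)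
          have hw0 := Real.rpow_nonneg (trunc_nonneg u m y) (r - 1)
          have hD : 0 < ‖x₀ - y‖ ^ ((N : ℝ) + τ) := Real.rpow_pos_of_pos hz _
          have hp : (d / 4 * ‖x₀ - y‖) ^ ((N : ℝ) + τ) ≤ ‖x - y‖ ^ ((N : ℝ) + τ) :=
            Real.rpow_le_rpow (by positivity) hdist (by positivity)
          have hp0 : 0 < (d / 4 * ‖x₀ - y‖) ^ ((N : ℝ) + τ) := by positivity
          have hbb := hb0 x y
          calc k x y * trunc u m y ^ (r - 1)
              ≤ b x y / ‖x - y‖ ^ ((N : ℝ) + τ) * trunc u k' y ^ (r - 1) :=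
                mul_le_mul (hb x y hxy) hw hw0 (by positivity)
            _ ≤ b x y / (d / 4 * ‖x₀ - y‖) ^ ((N : ℝ) + τ) * trunc u k' y ^ (r - 1) :=
                mul_le_mul_of_nonneg_right (div_le_div_of_nonneg_left hbb hp0 hp) (hw0.trans hw)
            _ = _ := by
                rw [Real.mul_rpow (by positivity) hz.le, Real.div_rpow hd.le (by norm_num),
                  Real.div_rpow (by norm_num) hd.le]
                have h1 : 0 < d ^ ((N : ℝ) + τ) := Real.rpow_pos_of_pos hd _
                have h2 : (0 : ℝ) < 4 ^ ((N : ℝ) + τ) := by positivity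
                generalize ‖x₀ - y‖ ^ ((N : ℝ) + τ) = D at *
                generalize d ^ ((N : ℝ) + τ) = d' at *
                generalize (4 : ℝ) ^ ((N : ℝ) + τ) = f at *
                field_simp
      _ ≤ ENNReal.ofReal ((4 / d) ^ ((N : ℝ) + τ)) *
          ENNReal.ofReal (Λ * (R ^ (-τ) * kt ^ (r - 1))) := by
          rw [lintegral_const_mul' _ _ ENNReal.ofReal_ne_top]
          refine mul_le_mul' le_rfl ?_
          exact (lintegral_mono_set (compl_subset_compl.2
            (Metric.ball_subset_ball (by linarith)))).trans (htail x)
  have key := hcac hph (B := Metric.ball x₀ ρ₁) (K₀ := Metric.closedBall x₀ ρ₂)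
    measurableSet_ball measurableSet_closedBall (Metric.closedBall_subset_ball hρ₂₁)
    (T := T) hL hcutB hψ0 hψ1 hψK hlam hT0
    (fun x hx y hy => hk x (Metric.ball_subset_ball hρ hx) y (Metric.ball_subset_ball hρ hy)) m
    (by rw [hfun]; exact ht)
    (hph.energy_trunc_mul_lt_top hU hL hcutU m) (hfin m)
    (lintegral_trunc_lt_top hr.le hfin) htailT
  rw [hfun] at key
  refine key.trans ?_
  have hYm : excess r u m x₀ ρ₁ ≤ excess r u h x₀ ρ₁ := excess_anti hr0.le hhm.le le_rfl (hfin h)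
  have hWm := lintegral_trunc_le (u := u) (x₀ := x₀) (ρ := ρ₁) hr.le hhm (hfin h)
  rw [show m - h = d * kt by rw [hm]; ring] at hWm
  have hY0 := excess_nonneg r u h x₀ ρ₁
  set Y := excess r u h x₀ ρ₁ with hY
  change ∫ z, phaseIntegrand r k u (fun x => trunc u m x * cutoff x₀ ρ ρ₂ x ^ (θ * r)) z
      ∂((volume : Measure (RN N)).prod (volume : Measure (RN N)))
    + C₀ * (Λ + lam) * θ ^ r * (ρ₂ - ρ)⁻¹ ^ τ * excess r u m x₀ ρ₁ + _ ≤ _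
  have hRτ : 0 < R ^ (-τ) := Real.rpow_pos_of_pos hR _
  set P := (N : ℝ) + τ + r with hP
  have hdP : 0 < d ^ (-P) := Real.rpow_pos_of_pos hd _
  have hdle : ∀ {e : ℝ}, e ≤ P → d ^ (-e) ≤ d ^ (-P) := fun he =>
    Real.rpow_le_rpow_of_exponent_ge hd hd1 (by linarith)
  have hNr : (0 : ℝ) ≤ N := Nat.cast_nonneg N
  have t1 : (ρ₂ - ρ)⁻¹ ^ τ * excess r u m x₀ ρ₁ ≤ 2 ^ τ * d ^ (-P) * (R ^ (-τ) * Y) := by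
    have e : (ρ₂ - ρ)⁻¹ ^ τ = 2 ^ τ * d ^ (-τ) * R ^ (-τ) := by
      rw [hρ₂, add_sub_cancel_left, inv_div, Real.div_rpow (by norm_num) hdR.le,
        Real.mul_rpow hd.le hR.le, Real.rpow_neg hd.le, Real.rpow_neg hR.le]
      field_simp
    rw [e]
    have h1 := hdle (e := τ) (by rw [hP]; linarith)
    have h0 : 0 ≤ excess r u m x₀ ρ₁ := excess_nonneg _ _ _ _ _
    calc 2 ^ τ * d ^ (-τ) * R ^ (-τ) * excess r u m x₀ ρ₁
        ≤ 2 ^ τ * d ^ (-P) * R ^ (-τ) * Y := by gcongr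
      _ = _ := by ring
  have t2 : T * (∫⁻ x in Metric.ball x₀ ρ₁, ENNReal.ofReal (trunc u m x)).toReal
      ≤ 4 ^ ((N : ℝ) + τ) * Λ * d ^ (-P) * (R ^ (-τ) * Y) := by
    have hkr : 0 < kt ^ (r - 1) := Real.rpow_pos_of_pos hkt _
    calc T * (∫⁻ x in Metric.ball x₀ ρ₁, ENNReal.ofReal (trunc u m x)).toReal
        ≤ T * ((d * kt) ^ (-(r - 1)) * Y) := mul_le_mul_of_nonneg_left hWm hT0
      _ = 4 ^ ((N : ℝ) + τ) * Λ * d ^ (-((N : ℝ) + τ + (r - 1))) * (R ^ (-τ) * Y) := by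
          rw [hT, Real.mul_rpow hd.le hkt.le, Real.div_rpow (by norm_num) hd.le,
            neg_add, Real.rpow_add hd (-((N : ℝ) + τ)) (-(r - 1)), Real.rpow_neg hkt.le (r - 1),
            Real.rpow_neg hd.le ((N : ℝ) + τ)]
          have h1 : 0 < d ^ ((N : ℝ) + τ) := Real.rpow_pos_of_pos hd _
          generalize d ^ ((N : ℝ) + τ) = d' at *
          generalize kt ^ (r - 1) = k' at *
          field_simp
      _ ≤ _ := by
          have := hdle (e := (N : ℝ) + τ + (r - 1)) (by rw [hP]; linarith)
          gcongr
  have t3 : 0 ≤ d ^ (-P) * (R ^ (-τ) * Y) := by positivity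
  have t1' := mul_le_mul_of_nonneg_left t1 (by positivity : 0 ≤ C₀ * (Λ + lam) * θ ^ r)
  have e2 : C₀ * (Λ + lam) * θ ^ r * (ρ₂ - ρ)⁻¹ ^ τ * excess r u m x₀ ρ₁
    = C₀ * (Λ + lam) * θ ^ r * ((ρ₂ - ρ)⁻¹ ^ τ * excess r u m x₀ ρ₁) := by ring
  rw [e2]
  linarith

end

/-! ### The lower order term -/

theorem mul_rpow_sub_one_le {a b q : ℝ} (ha : 0 ≤ a) (hb : 0 ≤ b) (hq : 1 < q) :
    b ^ (q - 1) * a ≤ a ^ q + b ^ q := by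
  have key : ∀ {c : ℝ}, 0 ≤ c → c ^ (q - 1) * c = c ^ q := fun {c} hc => by
    rw [← Real.rpow_add_one' hc (by linarith)]; congr 1; ring
  have h1 := Real.rpow_nonneg ha q
  have h2 := Real.rpow_nonneg hb q
  rcases le_total a b with h | h
  · have := mul_le_mul_of_nonneg_left h (Real.rpow_nonneg hb (q - 1))
    rw [key hb] at this
    linarith
  · have := mul_le_mul_of_nonneg_right (Real.rpow_le_rpow hb h (by linarith : 0 ≤ q - 1)) ha
    rw [key ha] at this
    linarith

theorem rpow_sub_one_mul_le {q w φ kt U : ℝ} (hq : 1 < q) (hw : 0 ≤ w) (hφ0 : 0 ≤ φ)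
    (hφ1 : φ ≤ 1) (hkt : 0 < kt) (hU0 : 0 ≤ U) (hU : U ≤ w + 2 * kt) :
    U ^ (q - 1) * (w * φ ^ q) ≤ 4 ^ q * ((w * φ) ^ q + kt ^ q) := by
  have hq1 : 0 ≤ q - 1 := by linarith
  have e1 : w ^ (q - 1) * (w * φ ^ q) = (w * φ) ^ q := by
    rw [Real.mul_rpow hw hφ0, ← mul_assoc, ← Real.rpow_add_one' hw (by linarith)]
    congr 2; ring
  have hφq : φ ^ q ≤ φ := by
    calc φ ^ q ≤ φ ^ (1 : ℝ) := Real.rpow_le_rpow_of_exponent_ge' hφ0 hφ1 zero_le_one hq.le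
      _ = φ := Real.rpow_one _
  have e2 : kt ^ (q - 1) * (w * φ ^ q) ≤ (w * φ) ^ q + kt ^ q :=
    (mul_le_mul_of_nonneg_left (mul_le_mul_of_nonneg_left hφq hw) (by positivity)).trans
      (mul_rpow_sub_one_le (mul_nonneg hw hφ0) hkt.le hq)
  have h0 : 0 ≤ w * φ ^ q := mul_nonneg hw (Real.rpow_nonneg hφ0 _)
  have hA : 0 ≤ (w * φ) ^ q := Real.rpow_nonneg (mul_nonneg hw hφ0) _
  have hB : 0 ≤ kt ^ q := by positivity
  have h2 : (1 : ℝ) ≤ 2 ^ (q - 1) := Real.one_le_rpow one_le_two hq1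
  have e4 : (4 : ℝ) ^ q = 4 * (2 ^ (q - 1) * 2 ^ (q - 1)) := by
    rw [← Real.mul_rpow (by norm_num) (by norm_num)]
    norm_num
    rw [← Real.rpow_one_add' (by norm_num) (by linarith)]
    congr 1; ring
  calc U ^ (q - 1) * (w * φ ^ q) ≤ (w + 2 * kt) ^ (q - 1) * (w * φ ^ q) :=
        mul_le_mul_of_nonneg_right (Real.rpow_le_rpow hU0 hU hq1) h0
    _ ≤ 2 ^ (q - 1) * (w ^ (q - 1) + (2 * kt) ^ (q - 1)) * (w * φ ^ q) :=
        mul_le_mul_of_nonneg_right (rpow_add_le_two_rpow_mul hq1 hw (by positivity)) h0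
    _ = 2 ^ (q - 1) * (w ^ (q - 1) * (w * φ ^ q))
        + 2 ^ (q - 1) * 2 ^ (q - 1) * (kt ^ (q - 1) * (w * φ ^ q)) := by
        rw [Real.mul_rpow (by norm_num) hkt.le]; ring
    _ ≤ 2 ^ (q - 1) * (w * φ) ^ q + 2 ^ (q - 1) * 2 ^ (q - 1) * ((w * φ) ^ q + kt ^ q) := by
        rw [e1]
        have := mul_le_mul_of_nonneg_left e2 (by positivity : (0 : ℝ) ≤ 2 ^ (q - 1) * 2 ^ (q - 1))
        linarith
    _ ≤ _ := by
        rw [e4]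
        generalize (2 : ℝ) ^ (q - 1) = T at *
        nlinarith [mul_nonneg (mul_nonneg (by linarith : (0 : ℝ) ≤ T) (by linarith : 0 ≤ T - 1)) hA,
          mul_nonneg (mul_nonneg (by linarith : (0 : ℝ) ≤ T) (by linarith : 0 ≤ T)) hB,
          mul_nonneg (mul_nonneg (by linarith : (0 : ℝ) ≤ T) (by linarith : 0 ≤ T)) hA]

theorem lintegral_mul_le_of_lt {X : Type*} [MeasurableSpace X] {ν : Measure X}
    {V F : X → ℝ≥0∞} {μ κ : ℝ} (hμ : 0 < μ) (hμκ : μ < κ) (hκ : κ < 1) (hV : AEMeasurable V ν)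
    (hF : AEMeasurable F ν) :
    ∫⁻ x, V x * F x ∂ν ≤ (∫⁻ x, V x ^ (1 / μ) ∂ν) ^ μ *
      ((∫⁻ x, F x ^ (1 / (1 - κ)) ∂ν) ^ (1 - κ) * ν univ ^ (κ - μ)) := by
  have hc : (1 / μ).HolderConjugate (1 / (1 - μ)) := by
    rw [Real.holderConjugate_iff]
    refine ⟨by rw [lt_div_iff₀ hμ]; linarith, ?_⟩
    rw [one_div, one_div, inv_inv, inv_inv]; ring
  have h1 := ENNReal.lintegral_mul_le_Lp_mul_Lq ν hc hV hF
  simp only [Pi.mul_apply, one_div_one_div] at h1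
  refine h1.trans (mul_le_mul' le_rfl ?_)
  have h1μ : 0 < 1 - μ := by linarith
  have h1κ : 0 < 1 - κ := by linarith
  have hθ1 : (1 - κ) / (1 - μ) ≤ 1 := by rw [div_le_one h1μ]; linarith
  have h2 := setLIntegral_rpow_le (μ := ν) (F := fun x => F x ^ (1 / (1 - κ)))
    (θ := (1 - κ) / (1 - μ)) (hF.pow_const _) univ (by positivity) hθ1
  simp only [Measure.restrict_univ] at h2
  have e : ∀ x, (F x ^ (1 / (1 - κ))) ^ ((1 - κ) / (1 - μ)) = F x ^ (1 / (1 - μ)) := fun x => by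
    rw [← ENNReal.rpow_mul]; congr 1; field_simp
  simp_rw [e] at h2
  refine (ENNReal.rpow_le_rpow h2 h1μ.le).trans (le_of_eq ?_)
  rw [ENNReal.mul_rpow_of_nonneg _ _ h1μ.le, ← ENNReal.rpow_mul, ← ENNReal.rpow_mul]
  congr 2
  · field_simp
  · field_simp; ring

theorem setLIntegral_le_rpow_mul {X : Type*} [MeasurableSpace X] {ν : Measure X} {V : X → ℝ≥0∞}
    {μ : ℝ} {S B : Set X} (hμ : 0 < μ) (hμ1 : μ < 1) (hV : AEMeasurable V ν) (hSB : S ⊆ B) :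
    ∫⁻ x in S, V x ∂ν ≤ (∫⁻ x in B, V x ^ (1 / μ) ∂ν) ^ μ * ν S ^ (1 - μ) := by
  have h := setLIntegral_rpow_le (μ := ν) (F := fun x => V x ^ (1 / μ)) (θ := μ)
    (hV.pow_const _) S hμ.le hμ1.le
  have e : ∀ x, (V x ^ (1 / μ)) ^ μ = V x := fun x => by
    rw [← ENNReal.rpow_mul, one_div_mul_cancel hμ.ne', ENNReal.rpow_one]
  simp_rw [e] at h
  exact h.trans (mul_le_mul' (ENNReal.rpow_le_rpow (lintegral_mono_set hSB) hμ.le) le_rfl)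

section

variable {N : ℕ}

theorem lintegral_rhs_le {q κ μ : ℝ} (hq : 1 < q) (hN : 1 ≤ N) (hμ : 0 < μ)
    (hμκ : μ < κ / N) (hκN : κ < N) {g V u φ : RN N → ℝ} {x₀ : RN N} {ρ R₂ k' kt m b c c₁ 𝒱 : ℝ}
    (hu : Measurable u) (hφm : Measurable φ) (hVm : Measurable V)
    (hφ0 : ∀ x, 0 ≤ φ x) (hφ1 : ∀ x, φ x ≤ 1) (hφ : ∀ x, x ∉ Metric.ball x₀ ρ → φ x = 0)
    (hρ : ρ ≤ R₂) (hkt : 0 < kt) (hk'0 : 0 ≤ k') (hk'm : k' ≤ m) (hm : m ≤ 2 * kt)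
    (hb : 0 ≤ b) (hV : ∀ x, 0 ≤ V x) (hc0 : 0 ≤ c)
    (hVn : (∫⁻ x in Metric.ball x₀ R₂, ENNReal.ofReal (V x) ^ (1 / μ)) ^ μ ≤ ENNReal.ofReal 𝒱)
    (hc₁ : c₁ ≤ c * kt ^ (q - 1))
    (hg : ∀ x ∈ Metric.ball x₀ R₂, k' < u x → |g x| ≤ c₁ + (b + V x) * u x ^ (q - 1)) :
    ∫⁻ x, ENNReal.ofReal (|g x * (trunc u m x * φ x ^ q)|)
      ≤ ENNReal.ofReal (c + 4 ^ q * b) * ((∫⁻ x, ENNReal.ofReal (|trunc u m x * φ x| ^ q))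
          + ENNReal.ofReal (kt ^ q) * volume (levelSet u m x₀ ρ))
        + ENNReal.ofReal (4 ^ q * 𝒱) *
          ((∫⁻ x, ENNReal.ofReal (|trunc u m x * φ x| ^ (N * q / (N - κ)))) ^ (1 - κ / N) *
              volume (Metric.ball x₀ R₂) ^ (κ / N - μ)
            + ENNReal.ofReal (kt ^ q) * volume (levelSet u m x₀ ρ) ^ (1 - μ)) := by
  have hNr : (0 : ℝ) < N := by exact_mod_cast hN
  have hκ1 : κ / N < 1 := by rw [div_lt_one hNr]; exact hκN
  have hq0 : 0 < q := by linarith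
  set S := levelSet u m x₀ ρ with hS
  have hSm : MeasurableSet S := measurableSet_levelSet hu m x₀ ρ
  set B := Metric.ball x₀ R₂ with hB
  have hSB : S ⊆ B := fun x hx => Metric.ball_subset_ball hρ hx.1
  have hwm := measurable_trunc hu m
  set F : RN N → ℝ≥0∞ := fun x => ENNReal.ofReal (|trunc u m x * φ x| ^ q) with hF
  have hFm : Measurable F := by fun_prop
  set W : RN N → ℝ≥0∞ := fun x => ENNReal.ofReal (V x) with hW
  have hWm : Measurable W := by fun_prop
  set I : RN N → ℝ≥0∞ := S.indicator fun _ => ENNReal.ofReal (kt ^ q) with hI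
  have hIm : Measurable I := measurable_const.indicator hSm
  have hWF : Measurable fun x => W x * F x := hWm.mul hFm
  have hpt : ∀ x, ENNReal.ofReal (|g x * (trunc u m x * φ x ^ q)|)
      ≤ ENNReal.ofReal (c + 4 ^ q * b) * (F x + I x)
        + ENNReal.ofReal (4 ^ q) * (B.indicator (fun x => W x * F x) x
          + ENNReal.ofReal (kt ^ q) * S.indicator W x) := by
    intro x
    by_cases hx : x ∈ S
    · have hxB := hSB hx
      have hux : m < u x := hx.2
      have hw : trunc u m x = u x - m := max_eq_left (by linarith)
      have hw0 := trunc_nonneg u m x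
      have hφ0x := hφ0 x
      have hVx := hV x
      have hux0 : 0 ≤ u x := by linarith
      rw [hI, indicator_of_mem hx, indicator_of_mem hxB, indicator_of_mem hx, hF, hW]
      simp only
      have hFr : 0 ≤ |trunc u m x * φ x| ^ q := by positivity
      have hkq : 0 ≤ kt ^ q := by positivity
      rw [← ENNReal.ofReal_add hFr hkq, ← ENNReal.ofReal_mul (by positivity),
        ← ENNReal.ofReal_mul hVx, ← ENNReal.ofReal_mul hkq,
        ← ENNReal.ofReal_add (by positivity) (by positivity),
        ← ENNReal.ofReal_mul (by positivity),
        ← ENNReal.ofReal_add (by positivity) (by positivity)]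
      apply ENNReal.ofReal_le_ofReal
      have hv0 : 0 ≤ trunc u m x * φ x ^ q := mul_nonneg hw0 (Real.rpow_nonneg hφ0x _)
      rw [abs_mul, abs_of_nonneg hv0, abs_of_nonneg (mul_nonneg hw0 hφ0x)]
      have h1 := rpow_sub_one_mul_le hq hw0 hφ0x (hφ1 x) hkt hux0 (by rw [hw]; linarith)
      have hφq : φ x ^ q ≤ φ x := by
        calc φ x ^ q ≤ φ x ^ (1 : ℝ) :=
              Real.rpow_le_rpow_of_exponent_ge' hφ0x (hφ1 x) zero_le_one hq.le
          _ = φ x := Real.rpow_one _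
      have h2 : kt ^ (q - 1) * (trunc u m x * φ x ^ q) ≤ (trunc u m x * φ x) ^ q + kt ^ q :=
        (mul_le_mul_of_nonneg_left (mul_le_mul_of_nonneg_left hφq hw0) (by positivity)).trans
          (mul_rpow_sub_one_le (mul_nonneg hw0 hφ0x) hkt.le hq)
      calc |g x| * (trunc u m x * φ x ^ q)
          ≤ (c * kt ^ (q - 1) + (b + V x) * u x ^ (q - 1)) * (trunc u m x * φ x ^ q) :=
            mul_le_mul_of_nonneg_right ((hg x hxB (by linarith)).trans (by linarith)) hv0
        _ = c * (kt ^ (q - 1) * (trunc u m x * φ x ^ q))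
            + (b + V x) * (u x ^ (q - 1) * (trunc u m x * φ x ^ q)) := by ring
        _ ≤ c * ((trunc u m x * φ x) ^ q + kt ^ q)
            + (b + V x) * (4 ^ q * ((trunc u m x * φ x) ^ q + kt ^ q)) :=
            add_le_add (mul_le_mul_of_nonneg_left h2 hc0)
              (mul_le_mul_of_nonneg_left h1 (by positivity))
        _ = _ := by ring
    · have h0 : trunc u m x * φ x ^ q = 0 := by
        by_cases hxb : x ∈ Metric.ball x₀ ρ
        · have : ¬ m < u x := fun h => hx ⟨hxb, h⟩
          have : trunc u m x = 0 := max_eq_right (by linarith)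
          rw [this, zero_mul]
        · rw [hφ x hxb, Real.zero_rpow hq0.ne', mul_zero]
      rw [h0, mul_zero, abs_zero, ENNReal.ofReal_zero]
      exact zero_le
  refine (lintegral_mono hpt).trans ?_
  rw [lintegral_add_left (by fun_prop), lintegral_const_mul' _ _ ENNReal.ofReal_ne_top,
    lintegral_add_left hFm, lintegral_const_mul' _ _ ENNReal.ofReal_ne_top,
    lintegral_add_left (hWF.indicator measurableSet_ball),
    lintegral_const_mul' _ _ ENNReal.ofReal_ne_top, lintegral_indicator measurableSet_ball,
    lintegral_indicator hSm, setLIntegral_const, lintegral_indicator hSm]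
  refine add_le_add le_rfl ?_
  rw [ENNReal.ofReal_mul (by positivity), mul_assoc, mul_add (ENNReal.ofReal 𝒱)]
  refine mul_le_mul' le_rfl (add_le_add ?_ ?_)
  · refine (lintegral_mul_le_of_lt hμ hμκ hκ1 hWm.aemeasurable hFm.aemeasurable).trans ?_
    rw [Measure.restrict_apply_univ]
    refine mul_le_mul' hVn (mul_le_mul' (ENNReal.rpow_le_rpow ?_ (by linarith)) le_rfl)
    refine (setLIntegral_le_lintegral _ _).trans (lintegral_mono fun x => le_of_eq ?_)
    simp only [hF]
    rw [ENNReal.ofReal_rpow_of_nonneg (by positivity) (by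
      have : 0 < 1 - κ / N := by linarith
      positivity), ← Real.rpow_mul (abs_nonneg _)]
    congr 2
    have : (N : ℝ) - κ ≠ 0 := by linarith
    field_simp
  · rw [mul_left_comm]
    exact mul_le_mul' le_rfl ((setLIntegral_le_rpow_mul hμ (hμκ.trans hκ1) hWm.aemeasurable
      hSB).trans (mul_le_mul' hVn le_rfl))

theorem exists_excess_le_gain (hN : 1 ≤ N) {r κ : ℝ} (hr : 1 ≤ r) (hκ : 0 < κ) (hκN : κ < N) :
    ∃ C : ℝ, 0 < C ∧ ∀ {τ R m ρ ρ₁ : ℝ} {u ψ : RN N → ℝ} {x₀ : RN N}, κ ≤ τ → 0 < R →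
      Measurable u → Measurable ψ → (∀ x, 0 ≤ ψ x) → (∀ x, ψ x ≤ 1) →
      (∀ x ∈ Metric.ball x₀ ρ, ψ x = 1) → (∀ x, x ∉ Metric.ball x₀ ρ₁ → ψ x = 0) →
      ∫⁻ x in Metric.ball x₀ ρ₁, ENNReal.ofReal (trunc u m x ^ r) < ⊤ →
      energy r τ (fun x => trunc u m x * ψ x) < ⊤ →
      R ^ (-τ) * excess r u m x₀ ρ
        ≤ C * ((volume (levelSet u m x₀ ρ₁)).toReal ^ (κ / N) * R ^ (-κ)) *
          ((energy r τ fun x => trunc u m x * ψ x).toReal + R ^ (-τ) * excess r u m x₀ ρ₁) := by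
  obtain ⟨C, hC, hg⟩ := exists_gain hN hr hκ hκN
  refine ⟨C, hC, ?_⟩
  intro τ R m ρ ρ₁ u ψ x₀ hτ hR hu hψ hψ0 hψ1 hψeq hψz hfin hE
  have hr0 : 0 < r := by linarith
  have hwm := measurable_trunc hu m
  have hle : ∫⁻ x, ENNReal.ofReal (|trunc u m x * ψ x| ^ r)
      ≤ ∫⁻ x in Metric.ball x₀ ρ₁, ENNReal.ofReal (trunc u m x ^ r) :=
    lintegral_trunc_mul_le measurableSet_ball hr0 hψ0 hψ1 hψz m
  have key := hg τ hτ R hR (fun x => trunc u m x * ψ x) (hwm.mul hψ) (hle.trans_lt hfin)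
    (levelSet u m x₀ ρ₁) (fun x hx => by
      by_cases hxb : x ∈ Metric.ball x₀ ρ₁
      · have : ¬ m < u x := fun h => hx ⟨hxb, h⟩
        have : trunc u m x = 0 := max_eq_right (by linarith)
        rw [this, zero_mul]
      · rw [hψz x hxb, mul_zero])
  have h1 : ∫⁻ x in Metric.ball x₀ ρ, ENNReal.ofReal (trunc u m x ^ r)
      ≤ ∫⁻ x, ENNReal.ofReal (|trunc u m x * ψ x| ^ r) := by
    refine le_trans ?_ (setLIntegral_le_lintegral (Metric.ball x₀ ρ) _)
    refine setLIntegral_mono' measurableSet_ball fun x hx => ?_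
    rw [hψeq x hx, mul_one, abs_of_nonneg (trunc_nonneg _ _ _)]
  have hS := volume_levelSet_lt_top u m x₀ ρ₁
  have h2 : ∫⁻ x in Metric.ball x₀ ρ, ENNReal.ofReal (trunc u m x ^ r)
      ≤ volume (levelSet u m x₀ ρ₁) ^ (κ / N) *
        (ENNReal.ofReal (C * R ^ (τ - κ)) * energy r τ (fun x => trunc u m x * ψ x)
          + ENNReal.ofReal (C * R ^ (-κ)) *
            ∫⁻ x in Metric.ball x₀ ρ₁, ENNReal.ofReal (trunc u m x ^ r)) :=
    h1.trans (key.trans (mul_le_mul' le_rfl (add_le_add le_rfl (mul_le_mul' le_rfl hle))))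
  have hκN0 : 0 ≤ κ / N := by positivity
  have t1 := ENNReal.mul_lt_top (ENNReal.ofReal_lt_top (r := C * R ^ (τ - κ))) hE
  have t2 := ENNReal.mul_lt_top (ENNReal.ofReal_lt_top (r := C * R ^ (-κ))) hfin
  have h3 := ENNReal.toReal_mono (ENNReal.mul_lt_top (ENNReal.rpow_lt_top_of_nonneg hκN0 hS.ne)
    (ENNReal.add_lt_top.2 ⟨t1, t2⟩)).ne h2
  rw [ENNReal.toReal_mul, ENNReal.toReal_add t1.ne t2.ne, ENNReal.toReal_mul, ENNReal.toReal_mul,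
    ENNReal.toReal_ofReal (by positivity), ENNReal.toReal_ofReal (by positivity),
    ← ENNReal.toReal_rpow] at h3
  change excess r u m x₀ ρ ≤ _ * (_ + _ * excess r u m x₀ ρ₁) at h3
  have h4 := mul_le_mul_of_nonneg_left h3 (Real.rpow_nonneg hR.le (-τ))
  refine h4.trans (le_of_eq ?_)
  rw [show τ - κ = τ + -κ by ring, Real.rpow_add hR τ (-κ)]
  have e : R ^ (-τ) * R ^ τ = 1 := by rw [← Real.rpow_add hR]; simp
  generalize R ^ (-τ) = A at *
  generalize R ^ τ = B at *
  linear_combination C * (volume (levelSet u m x₀ ρ₁)).toReal ^ (κ / N) * R ^ (-κ) *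
    (energy r τ fun x => trunc u m x * ψ x).toReal * e

theorem exists_abs_integral_rhs_le {q κ μ : ℝ} (hq : 1 < q) (hN : 1 ≤ N) (hμ : 0 < μ)
    (hμκ : μ < κ / N) (hκ : 0 < κ) (hκN : κ < N) :
    ∃ C : ℝ, 0 < C ∧ ∀ {τ R m h ρ k' kt b c₁ C₁ δ : ℝ} {g V u φ : RN N → ℝ} {x₀ : RN N},
      κ ≤ τ → 0 < R → Measurable u → Measurable φ → Measurable V →
      (∀ x, 0 ≤ φ x) → (∀ x, φ x ≤ 1) → (∀ x, x ∉ Metric.ball x₀ ρ → φ x = 0) →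
      ρ ≤ 2 * R → 0 < kt → 0 ≤ k' → k' ≤ m → m ≤ 2 * kt → h ≤ m → 0 ≤ b → (∀ x, 0 ≤ V x) →
      0 ≤ δ →
      (∫⁻ x in Metric.ball x₀ (2 * R), ENNReal.ofReal (V x) ^ (1 / μ)) ^ μ
        ≤ ENNReal.ofReal (δ * R ^ (N * μ - τ)) →
      c₁ ≤ R ^ (-τ) * kt ^ (q - 1) → b ≤ C₁ * R ^ (-τ) →
      (∀ x ∈ Metric.ball x₀ (2 * R), k' < u x → |g x| ≤ c₁ + (b + V x) * u x ^ (q - 1)) →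
      ∫⁻ x in Metric.ball x₀ ρ, ENNReal.ofReal (trunc u h x ^ q) < ⊤ →
      energy q τ (fun x => trunc u m x * φ x) < ⊤ →
      |∫ x, g x * (trunc u m x * φ x ^ q)|
        ≤ (1 + 4 ^ q * C₁) * (R ^ (-τ) * excess q u h x₀ ρ
            + R ^ (-τ) * (kt ^ q * (volume (levelSet u m x₀ ρ)).toReal))
          + δ * (C * ((energy q τ fun x => trunc u m x * φ x).toReal
              + R ^ (-τ) * excess q u h x₀ ρ)
            + 4 ^ q * (R ^ (-τ) * kt ^ q * (R ^ (N * μ) *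
                (volume (levelSet u m x₀ ρ)).toReal ^ (1 - μ)))) := by
  obtain ⟨C, hC, hS⟩ := exists_sobolev_scaled hN hq.le hκ hκN
  have hNr : (0 : ℝ) < N := by exact_mod_cast hN
  set ω := (volume (Metric.ball (0 : RN N) 1)).toReal with hω
  have hω0 : 0 ≤ ω := ENNReal.toReal_nonneg
  refine ⟨4 ^ q * (C * (ω * 2 ^ (N : ℝ)) ^ (κ / N - μ)) + 1, by positivity, ?_⟩
  intro τ R m h ρ k' kt b c₁ C₁ δ g V u φ x₀ hτ hR hu hφm hVm hφ0 hφ1 hφ hρ hkt hk'0 hk'm hm hhm hb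
    hV hδ hVn hc₁ hbC hg hfin hE
  have hq0 : 0 < q := by linarith
  have hκ1 : κ / N < 1 := by rw [div_lt_one hNr]; exact hκN
  have hRτ : 0 < R ^ (-τ) := Real.rpow_pos_of_pos hR _
  have key := lintegral_rhs_le (φ := φ) (ρ := ρ) (m := m) hq hN hμ hμκ hκN hu hφm hVm hφ0 hφ1 hφ hρ
    hkt hk'0 hk'm hm hb hV hRτ.le hVn hc₁ hg
  have hle : ∫⁻ x, ENNReal.ofReal (|trunc u m x * φ x| ^ q)
      ≤ ∫⁻ x in Metric.ball x₀ ρ, ENNReal.ofReal (trunc u h x ^ q) :=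
    (lintegral_trunc_mul_le measurableSet_ball hq0 hφ0 hφ1 hφ m).trans
      (lintegral_mono fun x => ENNReal.ofReal_le_ofReal
        (Real.rpow_le_rpow (trunc_nonneg _ _ _) (trunc_anti u hhm x) hq0.le))
  have hsob := (hS τ hτ R hR (fun x => trunc u m x * φ x) ((measurable_trunc hu m).mul hφm)
    (hle.trans_lt hfin)).trans (add_le_add le_rfl (mul_le_mul' le_rfl hle))
  have hvS := volume_levelSet_lt_top u m x₀ ρ
  have hvB : volume (Metric.ball x₀ (2 * R)) = ENNReal.ofReal (ω * (2 * R) ^ (N : ℝ)) :=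
    volume_ball_eq hN x₀ (by positivity)
  have t1 := ENNReal.mul_lt_top (ENNReal.ofReal_lt_top (r := C * R ^ (τ - κ))) hE
  have t2 := ENNReal.mul_lt_top (ENNReal.ofReal_lt_top (r := C * R ^ (-κ))) hfin
  have t3 := ENNReal.mul_lt_top (ENNReal.ofReal_lt_top (r := kt ^ q)) hvS
  have hβ : 0 < κ / N - μ := by linarith
  have h1μ : 0 ≤ 1 - μ := by linarith
  have t4 : volume (Metric.ball x₀ (2 * R)) ^ (κ / N - μ) < ⊤ :=
    ENNReal.rpow_lt_top_of_nonneg hβ.le measure_ball_lt_top.ne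
  have t5 := ENNReal.mul_lt_top (ENNReal.ofReal_lt_top (r := kt ^ q))
    (ENNReal.rpow_lt_top_of_nonneg h1μ hvS.ne)
  have t6 := ENNReal.add_lt_top.2 ⟨t1, t2⟩
  have t7 := ENNReal.mul_lt_top t6 t4
  have hbound := key.trans (add_le_add (mul_le_mul' le_rfl (add_le_add hle le_rfl))
    (mul_le_mul' le_rfl (add_le_add (mul_le_mul' hsob le_rfl) le_rfl)))
  have t8 := ENNReal.mul_lt_top (ENNReal.ofReal_lt_top (r := R ^ (-τ) + 4 ^ q * b))
    (ENNReal.add_lt_top.2 ⟨hfin, t3⟩)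
  have t9 := ENNReal.mul_lt_top (ENNReal.ofReal_lt_top (r := 4 ^ q * (δ * R ^ (N * μ - τ))))
    (ENNReal.add_lt_top.2 ⟨t7, t5⟩)
  have h3 := ENNReal.toReal_mono (ENNReal.add_lt_top.2 ⟨t8, t9⟩).ne hbound
  have h4 := norm_integral_le_lintegral_norm (μ := volume)
    (fun x => g x * (trunc u m x * φ x ^ q))
  simp only [Real.norm_eq_abs] at h4
  rw [ENNReal.toReal_add t8.ne t9.ne, ENNReal.toReal_mul, ENNReal.toReal_mul,
    ENNReal.toReal_add hfin.ne t3.ne, ENNReal.toReal_add t7.ne t5.ne, ENNReal.toReal_mul,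
    ENNReal.toReal_mul, ENNReal.toReal_mul, ENNReal.toReal_add t1.ne t2.ne, ENNReal.toReal_mul,
    ENNReal.toReal_mul, ← ENNReal.toReal_rpow, ← ENNReal.toReal_rpow, hvB,
    ENNReal.toReal_ofReal (by positivity), ENNReal.toReal_ofReal (by positivity),
    ENNReal.toReal_ofReal (by positivity), ENNReal.toReal_ofReal (by positivity),
    ENNReal.toReal_ofReal (by positivity), ENNReal.toReal_ofReal (by positivity)] at h3
  refine (h4.trans h3).trans ?_
  change (R ^ (-τ) + 4 ^ q * b) * (excess q u h x₀ ρ + _)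
    + _ * ((_ + _ * excess q u h x₀ ρ) * _ + _) ≤ _
  have hY := excess_nonneg q u h x₀ ρ
  have hs : 0 ≤ (volume (levelSet u m x₀ ρ)).toReal := ENNReal.toReal_nonneg
  have hE0 : 0 ≤ (energy q τ fun x => trunc u m x * φ x).toReal := ENNReal.toReal_nonneg
  generalize (energy q τ fun x => trunc u m x * φ x).toReal = E at *
  generalize excess q u h x₀ ρ = Y at *
  generalize (volume (levelSet u m x₀ ρ)).toReal = s at *
  have e1 : (ω * (2 * R) ^ (N : ℝ)) ^ (κ / N - μ)
      = (ω * 2 ^ (N : ℝ)) ^ (κ / N - μ) * R ^ (κ - N * μ) := by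
    rw [Real.mul_rpow (by norm_num) hR.le, ← mul_assoc, Real.mul_rpow (by positivity) (by positivity),
      ← Real.rpow_mul hR.le]
    congr 2; field_simp
  have e2 : R ^ (N * μ - τ) * R ^ (κ - N * μ) * R ^ (τ - κ) = 1 := by
    rw [← Real.rpow_add hR, ← Real.rpow_add hR]; ring_nf; exact Real.rpow_zero R
  have e3 : R ^ (N * μ - τ) * R ^ (κ - N * μ) * R ^ (-κ) = R ^ (-τ) := by
    rw [← Real.rpow_add hR, ← Real.rpow_add hR]; ring_nf
  have e4 : R ^ (N * μ - τ) = R ^ (-τ) * R ^ (N * μ) := by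
    rw [← Real.rpow_add hR]; ring_nf
  have a1 : (R ^ (-τ) + 4 ^ q * b) * (Y + kt ^ q * s)
      ≤ (1 + 4 ^ q * C₁) * (R ^ (-τ) * Y + R ^ (-τ) * (kt ^ q * s)) := by
    have h4q : (0 : ℝ) < 4 ^ q := by positivity
    have h0 : 0 ≤ Y + kt ^ q * s := by positivity
    have := mul_le_mul_of_nonneg_right (add_le_add_right (mul_le_mul_of_nonneg_left hbC h4q.le)
      (R ^ (-τ))) h0
    refine this.trans (le_of_eq ?_)
    ring
  refine add_le_add a1 ?_
  have a2 : 4 ^ q * (δ * R ^ (N * μ - τ)) *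
      ((C * R ^ (τ - κ) * E + C * R ^ (-κ) * Y) * (ω * (2 * R) ^ (N : ℝ)) ^ (κ / N - μ)
        + kt ^ q * s ^ (1 - μ))
      = δ * ((4 ^ q * (C * (ω * 2 ^ (N : ℝ)) ^ (κ / N - μ))) * (E + R ^ (-τ) * Y)
        + 4 ^ q * (R ^ (-τ) * kt ^ q * (R ^ (N * μ) * s ^ (1 - μ)))) := by
    rw [e1]
    generalize (ω * 2 ^ (N : ℝ)) ^ (κ / N - μ) = P at *
    calc _ = δ * (4 ^ q * (C * P) * ((R ^ (N * μ - τ) * R ^ (κ - N * μ) * R ^ (τ - κ)) * E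
          + (R ^ (N * μ - τ) * R ^ (κ - N * μ) * R ^ (-κ)) * Y)
          + 4 ^ q * (R ^ (N * μ - τ) * kt ^ q * s ^ (1 - μ))) := by ring
      _ = _ := by rw [e2, e3, e4]; ring
  rw [a2]
  have : 0 ≤ E + R ^ (-τ) * Y := by positivity
  refine mul_le_mul_of_nonneg_left (add_le_add (mul_le_mul_of_nonneg_right (by linarith) this)
    le_rfl) hδ

end

/-! ### One step of the De Giorgi iteration -/

/-- A local solution of a double phase equation with right-hand side `g` on `B_{2R}(x₀)`. -/
structure IsLocalSolution {N : ℕ} (p τ₁ Λ₁ lam₁ q τ₂ Λ₂ lam₂ l l' : ℝ)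
    (k₁ b₁ k₂ b₂ : RN N → RN N → ℝ) (g u : RN N → ℝ) (x₀ : RN N) (R : ℝ) : Prop where
  R_pos : 0 < R
  phase₁ : IsPhase p τ₁ Λ₁ (2 * R) k₁ (Metric.ball x₀ (4 * R)) (Metric.closedBall x₀ (2 * R)) u
  phase₂ : IsPhase q τ₂ Λ₂ (2 * R) k₂ (Metric.ball x₀ (4 * R)) (Metric.closedBall x₀ (2 * R)) u
  lower₁ : ∀ x ∈ Metric.ball x₀ (2 * R), ∀ y ∈ Metric.ball x₀ (2 * R), x ≠ y →
    lam₁ / ‖x - y‖ ^ ((N : ℝ) + τ₁) ≤ k₁ x y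
  lower₂ : ∀ x ∈ Metric.ball x₀ (2 * R), ∀ y ∈ Metric.ball x₀ (2 * R), x ≠ y →
    lam₂ / ‖x - y‖ ^ ((N : ℝ) + τ₂) ≤ k₂ x y
  weight₁_nonneg : ∀ x y, 0 ≤ b₁ x y
  weight₂_nonneg : ∀ x y, 0 ≤ b₂ x y
  le_weight₁ : ∀ x y, x ≠ y → k₁ x y ≤ b₁ x y / ‖x - y‖ ^ ((N : ℝ) + τ₁)
  le_weight₂ : ∀ x y, x ≠ y → k₂ x y ≤ b₂ x y / ‖x - y‖ ^ ((N : ℝ) + τ₂)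
  conj : l.HolderConjugate l'
  rhs_measurable : Measurable g
  rhs_memLp : MemLp g (ENNReal.ofReal l')
  memLp : MemLp ((Metric.closedBall x₀ (2 * R)).indicator u) (ENNReal.ofReal l)
  weak : ∀ w : RN N → ℝ, ContDiff ℝ ((⊤ : ℕ∞) : WithTop ℕ∞) w →
    (∀ x, x ∉ Metric.closedBall x₀ (2 * R) → w x = 0) →
    (∫ x, ∫ y, phaseIntegrand p k₁ u w (x, y)) + (∫ x, ∫ y, phaseIntegrand q k₂ u w (x, y))
      = ∫ x, g x * w x

/-- The scale `kt` dominates the tails of `(u-k')_+` and the lower order part of `g`. -/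
structure IsScale {N : ℕ} (p τ₁ Λ₁ q τ₂ Λ₂ μ δ C₁ : ℝ) (b₁ b₂ : RN N → RN N → ℝ)
    (g u : RN N → ℝ) (x₀ : RN N) (R k' kt : ℝ) : Prop where
  pos : 0 < kt
  level_nonneg : 0 ≤ k'
  level_le : k' ≤ kt
  tail₁ : ∀ x, ∫⁻ y in (Metric.ball x₀ R)ᶜ,
    ENNReal.ofReal (b₁ x y * (trunc u k' y ^ (p - 1) / ‖x₀ - y‖ ^ ((N : ℝ) + τ₁)))
      ≤ ENNReal.ofReal (Λ₁ * (R ^ (-τ₁) * kt ^ (p - 1)))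
  tail₂ : ∀ x, ∫⁻ y in (Metric.ball x₀ R)ᶜ,
    ENNReal.ofReal (b₂ x y * (trunc u k' y ^ (q - 1) / ‖x₀ - y‖ ^ ((N : ℝ) + τ₂)))
      ≤ ENNReal.ofReal (Λ₂ * (R ^ (-τ₂) * kt ^ (q - 1)))
  growth : ∃ (c₁ b : ℝ) (V : RN N → ℝ), Measurable V ∧ (∀ x, 0 ≤ V x) ∧ 0 ≤ b ∧
    b ≤ C₁ * R ^ (-τ₂) ∧ c₁ ≤ R ^ (-τ₂) * kt ^ (q - 1) ∧
    (∫⁻ x in Metric.ball x₀ (2 * R), ENNReal.ofReal (V x) ^ (1 / μ)) ^ μ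
      ≤ ENNReal.ofReal (δ * R ^ (N * μ - τ₂)) ∧
    ∀ x ∈ Metric.ball x₀ (2 * R), k' < u x → |g x| ≤ c₁ + (b + V x) * u x ^ (q - 1)

/-- The normalised excess that the iteration drives to zero. -/
noncomputable def normExcess {N : ℕ} (p τ₁ q τ₂ : ℝ) (u : RN N → ℝ) (x₀ : RN N) (R kt h ρ : ℝ) : ℝ :=
  R ^ (τ₁ - N) * kt ^ (-p) * (R ^ (-τ₁) * excess p u h x₀ ρ + R ^ (-τ₂) * excess q u h x₀ ρ)

section

variable {N : ℕ}

theorem IsLocalSolution.phase_add_phase_eq {p τ₁ Λ₁ lam₁ q τ₂ Λ₂ lam₂ l l' : ℝ}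
    {k₁ b₁ k₂ b₂ : RN N → RN N → ℝ} {g u : RN N → ℝ} {x₀ : RN N} {R : ℝ}
    (h : IsLocalSolution p τ₁ Λ₁ lam₁ q τ₂ Λ₂ lam₂ l l' k₁ b₁ k₂ b₂ g u x₀ R)
    {m ρ ρ₂ θ : ℝ} (hm : 0 ≤ m) (hρ : ρ < ρ₂) (hρ₂ : ρ₂ < 2 * R) (hθ : 1 ≤ θ) :
    ∫ z, phaseIntegrand p k₁ u (fun x => trunc u m x * cutoff x₀ ρ ρ₂ x ^ θ) z
        ∂((volume : Measure (RN N)).prod (volume : Measure (RN N)))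
      + ∫ z, phaseIntegrand q k₂ u (fun x => trunc u m x * cutoff x₀ ρ ρ₂ x ^ θ) z
        ∂((volume : Measure (RN N)).prod (volume : Measure (RN N)))
      = ∫ x, g x * (trunc u m x * cutoff x₀ ρ ρ₂ x ^ θ) := by
  have hR := h.R_pos
  have hU : volume (Metric.ball x₀ (4 * R)) < ⊤ := measure_ball_lt_top
  have hL : 0 < (ρ₂ - ρ)⁻¹ := inv_pos.2 (sub_pos.2 hρ)
  have hcut := (isCutoff_cutoff_rpow (x₀ := x₀) hρ hθ).mono
    (Metric.ball_subset_ball (by linarith : ρ₂ ≤ 4 * R))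
  have h0 : ∀ x, 0 ≤ cutoff x₀ ρ ρ₂ x ^ θ := fun x => Real.rpow_nonneg (cutoff_nonneg _ _ _ _) _
  have h1 : ∀ x, cutoff x₀ ρ ρ₂ x ^ θ ≤ 1 := fun x =>
    Real.rpow_le_one (cutoff_nonneg _ _ _ _) (cutoff_le_one _ _ _ _) (by linarith)
  have hz : ∀ x, x ∉ Metric.closedBall x₀ ρ₂ → cutoff x₀ ρ ρ₂ x ^ θ = 0 := fun x hx => by
    rw [Metric.mem_closedBall, not_le, dist_eq_norm] at hx
    rw [cutoff_eq_zero hρ hx.le, Real.zero_rpow (by linarith)]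
  have hv₁ := h.phase₁.isTest_trunc_mul hU hL hcut h0 h1 hz m
  have hv₂ := h.phase₂.isTest_trunc_mul hU hL hcut h0 h1 hz m
  refine weak_of_isTest (η := 2 * R - ρ₂) h.phase₁ h.phase₂ (isCompact_closedBall _ _)
    (by linarith) (fun x hx z hz => ?_) h.conj h.rhs_measurable h.rhs_memLp h.weak hv₁ hv₂ ?_
  · rw [Metric.mem_closedBall, dist_eq_norm] at hx ⊢
    calc ‖x + z - x₀‖ = ‖(x - x₀) + z‖ := by congr 1; abel
      _ ≤ ‖x - x₀‖ + ‖z‖ := norm_add_le _ _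
      _ ≤ 2 * R := by linarith
  · refine h.memLp.mono hv₁.measurable.aestronglyMeasurable (Filter.Eventually.of_forall fun x => ?_)
    by_cases hx : x ∈ Metric.closedBall x₀ (2 * R)
    · rw [indicator_of_mem hx, Real.norm_eq_abs, Real.norm_eq_abs,
        abs_of_nonneg (mul_nonneg (trunc_nonneg _ _ _) (h0 x))]
      refine (mul_le_of_le_one_right (trunc_nonneg _ _ _) (h1 x)).trans ?_
      exact max_le (by linarith [le_abs_self (u x)]) (abs_nonneg _)
    · rw [hz x fun hx' => hx (Metric.closedBall_subset_closedBall hρ₂.le hx'), mul_zero, norm_zero]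
      exact norm_nonneg _

theorem step_arith {E₁ E₂ D Q G A C₂ C₃ c₁ c₂ P I δ T : ℝ} (hc₁ : 0 < c₁)
    (hc₂ : 0 < c₂) (hE₁ : 0 ≤ E₁) (hE₂ : 0 ≤ E₂) (hD : 0 ≤ D) (hQ : 0 ≤ Q) (hP : 1 ≤ P)
    (hδ1 : δ ≤ 1) (hC₂ : 0 ≤ C₂) (hA : 0 ≤ A) (hT : 0 ≤ T)
    (hδ : δ * C₃ ≤ c₂ / 2) (hmain : c₁ * E₁ + c₂ * E₂ ≤ I + C₂ * P * D)
    (hI : I ≤ A * (2 * P * D) + δ * (C₃ * (E₂ + D) + T * Q)) (hG : G = E₁ + E₂ + D) :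
    G ≤ (1 + (1 / c₁ + 2 / c₂) * (2 * A + c₂ + C₂ + T)) * (P * D + Q) := by
  have hPD : D ≤ P * D := le_mul_of_one_le_left hD hP
  have h1 : c₁ * E₁ + c₂ / 2 * E₂ ≤ (2 * A + c₂ + C₂ + T) * (P * D + Q) := by
    have a1 : δ * C₃ * (E₂ + D) ≤ c₂ / 2 * (E₂ + D) :=
      mul_le_mul_of_nonneg_right hδ (by linarith)
    have a2 : δ * (T * Q) ≤ 1 * (T * Q) := mul_le_mul_of_nonneg_right hδ1 (by positivity)
    have a3 : c₂ / 2 * D ≤ c₂ * (P * D) := by nlinarith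
    have a4 : 0 ≤ (2 * A + c₂ + C₂) * Q := by positivity
    have a5 : 0 ≤ T * (P * D) := by positivity
    nlinarith
  set B := (2 * A + c₂ + C₂ + T) * (P * D + Q) with hB
  have hE₁' : E₁ ≤ 1 / c₁ * B := by
    rw [one_div, ← div_eq_inv_mul, le_div_iff₀ hc₁]; nlinarith
  have hE₂' : E₂ ≤ 2 / c₂ * B := by
    rw [div_mul_eq_mul_div, le_div_iff₀ hc₂]; nlinarith
  rw [hG]
  have : (1 + (1 / c₁ + 2 / c₂) * (2 * A + c₂ + C₂ + T)) * (P * D + Q)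
      = P * D + Q + 1 / c₁ * B + 2 / c₂ * B := by rw [hB]; ring
  rw [this]; linarith

set_option maxHeartbeats 1000000 in
theorem exists_step {q κ μ lam₂ : ℝ} (hN : 1 ≤ N) (hq : 1 < q) (hκ : 0 < κ) (hκN : κ < N)
    (hμ : 0 < μ) (hμκ : μ < κ / N) (hlam₂ : 0 < lam₂) :
    ∃ δ : ℝ, 0 < δ ∧ ∀ {p τ₁ τ₂ Λ₁ lam₁ Λ₂ C₁ : ℝ}, 1 < p → p ≤ q → κ ≤ τ₂ → τ₂ ≤ τ₁ → τ₁ < p →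
      τ₂ < q → 0 ≤ Λ₁ → 0 ≤ Λ₂ → 0 < lam₁ → 0 ≤ C₁ →
      ∃ C γ : ℝ, 0 < C ∧ 0 < γ ∧ ∀ {l l' : ℝ} {k₁ b₁ k₂ b₂ : RN N → RN N → ℝ} {g u : RN N → ℝ}
        {x₀ : RN N} {R k' kt : ℝ},
        IsLocalSolution p τ₁ Λ₁ lam₁ q τ₂ Λ₂ lam₂ l l' k₁ b₁ k₂ b₂ g u x₀ R →
        IsScale p τ₁ Λ₁ q τ₂ Λ₂ μ δ C₁ b₁ b₂ g u x₀ R k' kt →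
        ∀ {d ρ h : ℝ}, 0 < d → d ≤ 1 → R ≤ ρ → ρ + d * R ≤ 2 * R → k' ≤ h →
          h + d * kt ≤ k' + kt →
          normExcess p τ₁ q τ₂ u x₀ R kt (h + d * kt) ρ
            ≤ C * d ^ (-γ) * normExcess p τ₁ q τ₂ u x₀ R kt h (ρ + d * R) ^ (1 + (κ / N - μ)) := by
  obtain ⟨CI, hCI, hI⟩ := exists_abs_integral_rhs_le hq hN hμ hμκ hκ hκN
  have hNr : (0 : ℝ) < N := by exact_mod_cast hN
  have hq0 : 0 < q := by linarith
  set c₂ := 2⁻¹ * (2 ^ q)⁻¹ * lam₂ with hc₂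
  have hc₂0 : 0 < c₂ := by positivity
  refine ⟨min 1 (c₂ / 2 / CI), by positivity, ?_⟩
  intro p τ₁ τ₂ Λ₁ lam₁ Λ₂ C₁ hp hpq hκτ hτ hτp hτq hΛ₁ hΛ₂ hlam₁ hC₁
  set δ := min 1 (c₂ / 2 / CI) with hδ
  have hδ0 : 0 < δ := by positivity
  have hδC : δ * CI ≤ c₂ / 2 := by
    have : δ ≤ c₂ / 2 / CI := min_le_right _ _
    rwa [le_div_iff₀ hCI] at this
  have hp0 : 0 < p := by linarith
  have hτ₂0 : 0 < τ₂ := by linarith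
  have hτ₁0 : 0 < τ₁ := by linarith
  have hqp : 1 ≤ q / p := by rw [le_div_iff₀ hp0]; linarith
  obtain ⟨A₁, hA₁, hl₁⟩ := exists_level_estimate (N := N) hN hτ₁0 hτp hp Λ₁ lam₁ (q / p) hΛ₁ hlam₁.le hqp
  obtain ⟨A₂, hA₂, hl₂⟩ := exists_level_estimate (N := N) hN hτ₂0 hτq hq Λ₂ lam₂ 1 hΛ₂ hlam₂.le le_rfl
  obtain ⟨G₁, hG₁, hg₁⟩ := exists_excess_le_gain hN hp.le hκ hκN
  obtain ⟨G₂, hG₂, hg₂⟩ := exists_excess_le_gain hN hq.le hκ hκN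
  set c₁ := 2⁻¹ * (2 ^ p)⁻¹ * lam₁ with hc₁
  have hc₁0 : 0 < c₁ := by positivity
  set ω := (volume (Metric.ball (0 : RN N) 1)).toReal with hω
  have hω0 : 0 ≤ ω := ENNReal.toReal_nonneg
  set A := 1 + 4 ^ q * C₁ with hA
  set C₀ := 1 + (1 / c₁ + 2 / c₂) * (2 * A + c₂ + (A₁ + A₂) + 4 ^ q) with hC₀
  have hC₀0 : 0 < C₀ := by positivity
  set β := κ / N - μ with hβ
  have hβ0 : 0 < β := by linarith
  set γ₀ := (N : ℝ) + τ₁ + p + τ₂ + q with hγ₀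
  refine ⟨(G₁ + G₂) * C₀ * ((ω * 2 ^ (N : ℝ)) ^ μ + 1), γ₀ + p * β, by positivity, by positivity, ?_⟩
  intro l l' k₁ b₁ k₂ b₂ g u x₀ R k' kt hs hsc d ρ h hd hd1 hRρ hρ hk'h hhk
  have hR := hs.R_pos
  have hkt := hsc.pos
  have hdR : 0 < d * R := mul_pos hd hR
  have hdk : 0 < d * kt := mul_pos hd hkt
  have hu : Measurable u := hs.phase₁.measurable
  have hk'0 := hsc.level_nonneg
  set m := h + d * kt with hm
  have hhm : h < m := by rw [hm]; linarith
  set ρ₂ := ρ + d * R / 2 with hρ₂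
  set ρ₁ := ρ + d * R with hρ₁
  have hρρ₂ : ρ < ρ₂ := by rw [hρ₂]; linarith
  have hρ₂₁ : ρ₂ < ρ₁ := by rw [hρ₂, hρ₁]; linarith
  have hBU : Metric.ball x₀ ρ₁ ⊆ Metric.ball x₀ (4 * R) := Metric.ball_subset_ball (by linarith)
  have hU : volume (Metric.ball x₀ (4 * R)) < ⊤ := measure_ball_lt_top
  have hf₁ : ∀ m, ∫⁻ x in Metric.ball x₀ ρ₁, ENNReal.ofReal (trunc u m x ^ p) < ⊤ :=
    hs.phase₁.lintegral_trunc_lt_top' hU hBU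
  have hf₂ : ∀ m, ∫⁻ x in Metric.ball x₀ ρ₁, ENNReal.ofReal (trunc u m x ^ q) < ⊤ :=
    hs.phase₂.lintegral_trunc_lt_top' hU hBU
  have hL : 0 < (ρ₂ - ρ)⁻¹ := inv_pos.2 (sub_pos.2 hρρ₂)
  have hcut : ∀ {θ : ℝ}, 1 ≤ θ →
      IsCutoff (Metric.ball x₀ (4 * R)) θ (ρ₂ - ρ)⁻¹ (fun x => cutoff x₀ ρ ρ₂ x ^ θ) := fun hθ =>
    (isCutoff_cutoff_rpow hρρ₂ hθ).mono (Metric.ball_subset_ball (by linarith))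
  have hφ0 : ∀ (θ : ℝ) x, 0 ≤ cutoff x₀ ρ ρ₂ x ^ θ := fun θ x =>
    Real.rpow_nonneg (cutoff_nonneg _ _ _ _) _
  have hφ1 : ∀ {θ : ℝ}, 1 ≤ θ → ∀ x, cutoff x₀ ρ ρ₂ x ^ θ ≤ 1 := fun hθ x =>
    Real.rpow_le_one (cutoff_nonneg _ _ _ _) (cutoff_le_one _ _ _ _) (by linarith)
  have hφz : ∀ {θ : ℝ}, 1 ≤ θ → ∀ x, x ∉ Metric.ball x₀ ρ₁ → cutoff x₀ ρ ρ₂ x ^ θ = 0 :=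
    fun {θ} hθ x hx => by
      rw [Metric.mem_ball, not_lt, dist_eq_norm] at hx
      rw [cutoff_eq_zero hρρ₂ (by linarith), Real.zero_rpow (by linarith)]
  have hφe : ∀ θ : ℝ, ∀ x ∈ Metric.ball x₀ ρ, cutoff x₀ ρ ρ₂ x ^ θ = 1 := fun θ x hx => by
    rw [Metric.mem_ball, dist_eq_norm] at hx
    rw [cutoff_eq_one hρρ₂ hx.le, Real.one_rpow]
  have hE₁ := hs.phase₁.energy_trunc_mul_lt_top hU hL (hcut hqp) m
  have hE₂ := hs.phase₂.energy_trunc_mul_lt_top hU hL (hcut le_rfl) m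
  have L₁ := hl₁ hR hs.phase₁ hs.lower₁ hs.weight₁_nonneg hs.le_weight₁ hkt hsc.tail₁ hd hd1 hRρ hρ
    hk'h
  have L₂ := hl₂ hR hs.phase₂ hs.lower₂ hs.weight₂_nonneg hs.le_weight₂ hkt hsc.tail₂ hd hd1 hRρ hρ
    hk'h
  rw [div_mul_cancel₀ _ hp0.ne', ← hm, ← hρ₂] at L₁
  rw [one_mul, ← hc₂, ← hm, ← hρ₂] at L₂
  have W := hs.phase_add_phase_eq (m := m) (by linarith) hρρ₂ (by linarith) hq.le
  obtain ⟨c, b, V, hVm, hV0, hb0, hbC, hc, hVn, hgr⟩ := hsc.growth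
  have hle := hsc.level_le
  have I := hI (φ := fun x => cutoff x₀ ρ ρ₂ x ^ (1 : ℝ)) (h := h) (m := m) hκτ hR hu
    ((hcut le_rfl).measurable) hVm (hφ0 1) (hφ1 le_rfl) (hφz le_rfl) hρ hkt hk'0 (by linarith)
    (by linarith) hhm.le hb0 hV0 hδ0.le hVn hc hbC hgr (hf₂ h) hE₂
  simp only [cutoff_rpow_rpow, one_mul] at I
  have g₁ := hg₁ (hκτ.trans hτ) hR hu (hcut hqp).measurable (hφ0 _) (hφ1 hqp) (hφe _) (hφz hqp)
    (hf₁ m) hE₁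
  have g₂ := hg₂ hκτ hR hu (hcut le_rfl).measurable (hφ0 _) (hφ1 le_rfl) (hφe _) (hφz le_rfl)
    (hf₂ m) hE₂
  have S₁ := volume_levelSet_le hp0.le hu hhm (hf₁ h)
  have S₂ := volume_levelSet_le hq0.le hu hhm (hf₂ h)
  have hS0 : (volume (levelSet u m x₀ ρ₁)).toReal ≤ ω * 2 ^ (N : ℝ) * R ^ (N : ℝ) := by
    have h1 : volume (levelSet u m x₀ ρ₁) ≤ ENNReal.ofReal (ω * (2 * R) ^ (N : ℝ)) := by
      rw [← volume_ball_eq hN x₀ (by positivity)]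
      exact measure_mono (inter_subset_left.trans (Metric.ball_subset_ball hρ))
    have h2 := ENNReal.toReal_mono ENNReal.ofReal_ne_top h1
    rw [ENNReal.toReal_ofReal (by positivity), Real.mul_rpow (by norm_num) hR.le, ← mul_assoc] at h2
    exact h2
  have y₁ := excess_anti hp0.le hhm.le le_rfl (hf₁ h)
  have y₂ := excess_anti hq0.le hhm.le le_rfl (hf₂ h)
  rw [show m - h = d * kt by rw [hm]; ring] at S₁ S₂
  have hE₁0 : 0 ≤ (energy p τ₁ fun x => trunc u m x * cutoff x₀ ρ ρ₂ x ^ (q / p)).toReal :=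
    ENNReal.toReal_nonneg
  have hE₂0 : 0 ≤ (energy q τ₂ fun x => trunc u m x * cutoff x₀ ρ ρ₂ x ^ (1 : ℝ)).toReal :=
    ENNReal.toReal_nonneg
  have hY₁0 := excess_nonneg p u h x₀ ρ₁
  have hY₂0 := excess_nonneg q u h x₀ ρ₁
  have hs0 : 0 ≤ (volume (levelSet u m x₀ ρ₁)).toReal := ENNReal.toReal_nonneg
  unfold normExcess
  generalize (energy p τ₁ fun x => trunc u m x * cutoff x₀ ρ ρ₂ x ^ (q / p)).toReal = E₁ at *
  generalize (energy q τ₂ fun x => trunc u m x * cutoff x₀ ρ ρ₂ x ^ (1 : ℝ)).toReal = E₂ at *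
  generalize (volume (levelSet u m x₀ ρ₁)).toReal = s at *
  generalize excess p u h x₀ ρ₁ = Y₁ at *
  generalize excess q u h x₀ ρ₁ = Y₂ at *
  generalize excess p u m x₀ ρ₁ = Z₁ at *
  generalize excess q u m x₀ ρ₁ = Z₂ at *
  generalize excess p u m x₀ ρ = X₁ at *
  generalize excess q u m x₀ ρ = X₂ at *
  have hR₁ : 0 < R ^ (-τ₁) := Real.rpow_pos_of_pos hR _
  have hR₂ : 0 < R ^ (-τ₂) := Real.rpow_pos_of_pos hR _
  set D := R ^ (-τ₁) * Y₁ + R ^ (-τ₂) * Y₂ with hD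
  have hd1' : 0 ≤ R ^ (-τ₁) * Y₁ := by positivity
  have hd2' : 0 ≤ R ^ (-τ₂) * Y₂ := by positivity
  have hD0 : 0 ≤ D := by positivity
  have hdle : ∀ {e : ℝ}, e ≤ γ₀ → d ^ (-e) ≤ d ^ (-γ₀) := fun he =>
    Real.rpow_le_rpow_of_exponent_ge hd hd1 (by linarith)
  set P := d ^ (-γ₀) with hP
  have hP1 : 1 ≤ P := by
    have := hdle (e := 0) (by positivity)
    rwa [neg_zero, Real.rpow_zero] at this
  set Q := R ^ (-τ₂) * kt ^ q * (R ^ (N * μ) * s ^ (1 - μ)) with hQ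
  have hκ1 : κ / N < 1 := by rw [div_lt_one hNr]; exact hκN
  have hQ0 : 0 ≤ Q := by positivity
  set Z := R ^ (-τ₂) * (kt ^ q * s) with hZ
  have hZD : Z ≤ P * D := by
    have h1 : kt ^ q * s ≤ d ^ (-q) * Y₂ := by
      have := mul_le_mul_of_nonneg_left S₂ (by positivity : 0 ≤ kt ^ q)
      rw [Real.mul_rpow hd.le hkt.le, Real.rpow_neg hkt.le q] at this
      have hk : 0 < kt ^ q := by positivity
      refine this.trans (le_of_eq ?_)
      field_simp
    have h2 : d ^ (-q) ≤ P := hdle (by rw [hγ₀]; linarith)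
    calc Z ≤ R ^ (-τ₂) * (d ^ (-q) * Y₂) := mul_le_mul_of_nonneg_left h1 hR₂.le
      _ ≤ R ^ (-τ₂) * (P * Y₂) := by gcongr
      _ = P * (R ^ (-τ₂) * Y₂) := by ring
      _ ≤ P * D := mul_le_mul_of_nonneg_left (by linarith) (by linarith)
  have hmain : c₁ * E₁ + c₂ * E₂ ≤ |∫ x, g x * (trunc u m x * cutoff x₀ ρ ρ₂ x ^ q)|
      + (A₁ + A₂) * P * D := by
    have a1 : A₁ * d ^ (-((N : ℝ) + τ₁ + p)) * (R ^ (-τ₁) * Y₁) ≤ A₁ * P * D := by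
      have := hdle (e := (N : ℝ) + τ₁ + p) (by rw [hγ₀]; linarith)
      gcongr; linarith
    have a2 : A₂ * d ^ (-((N : ℝ) + τ₂ + q)) * (R ^ (-τ₂) * Y₂) ≤ A₂ * P * D := by
      have := hdle (e := (N : ℝ) + τ₂ + q) (by rw [hγ₀]; linarith)
      gcongr; linarith
    have a3 := le_abs_self (∫ x, g x * (trunc u m x * cutoff x₀ ρ ρ₂ x ^ q))
    rw [← W] at a3 ⊢
    have a4 : (A₁ + A₂) * P * D = A₁ * P * D + A₂ * P * D := by ring
    linarith
  have hAI : |∫ x, g x * (trunc u m x * cutoff x₀ ρ ρ₂ x ^ q)|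
      ≤ A * (2 * P * D) + δ * (CI * (E₂ + D) + 4 ^ q * Q) := by
    refine I.trans (add_le_add ?_ ?_)
    · refine mul_le_mul_of_nonneg_left ?_ (by positivity)
      have : D ≤ P * D := le_mul_of_one_le_left hD0 hP1
      linarith
    · refine mul_le_mul_of_nonneg_left (add_le_add ?_ le_rfl) hδ0.le
      exact mul_le_mul_of_nonneg_left (by linarith) hCI.le
  have key := step_arith (G := E₁ + E₂ + D) hc₁0 hc₂0 hE₁0 hE₂0 hD0 hQ0 hP1 (min_le_left _ _)
    (by positivity) (by positivity) (by positivity) hδC hmain hAI rfl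
  rw [← hC₀] at key
  set σ := s * R ^ (-(N : ℝ)) with hσ
  have hσ0 : 0 ≤ σ := by positivity
  have hσκ : s ^ (κ / N) * R ^ (-κ) = σ ^ (κ / N) := by
    rw [hσ, Real.mul_rpow hs0 (by positivity), ← Real.rpow_mul hR.le]
    congr 2; field_simp
  have hσ1 : σ ≤ ω * 2 ^ (N : ℝ) := by
    rw [hσ, Real.rpow_neg hR.le, ← div_eq_mul_inv, div_le_iff₀ (by positivity)]
    exact hS0
  have hσμ : σ ^ (κ / N) ≤ (ω * 2 ^ (N : ℝ)) ^ μ * σ ^ β := by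
    rw [show κ / N = μ + β by rw [hβ]; ring, Real.rpow_add_of_nonneg hσ0 hμ.le hβ0.le]
    exact mul_le_mul_of_nonneg_right (Real.rpow_le_rpow hσ0 hσ1 hμ.le) (by positivity)
  have hσQ : σ ^ (κ / N) * Q = σ ^ β * Z := by
    have e1 : σ ^ β = s ^ β * R ^ (-κ) * R ^ (N * μ) := by
      rw [hσ, Real.mul_rpow hs0 (by positivity), ← Real.rpow_mul hR.le, mul_assoc,
        ← Real.rpow_add hR]
      congr 2
      rw [hβ]; field_simp; ring
    have e2 : s ^ (κ / N) * s ^ (1 - μ) = s ^ β * s := by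
      rw [← Real.rpow_add_of_nonneg hs0 (by positivity) (by linarith),
        ← Real.rpow_add_one' hs0 (by linarith)]
      congr 1; rw [hβ]; ring
    rw [← hσκ, e1, hQ, hZ]
    linear_combination R ^ (-κ) * R ^ (-τ₂) * kt ^ q * R ^ (N * μ) * e2
  have hD' : R ^ (-τ₁) * X₁ + R ^ (-τ₂) * X₂
      ≤ (G₁ + G₂) * C₀ * ((ω * 2 ^ (N : ℝ)) ^ μ + 1) * (P * D * σ ^ β) := by
    have f0 : 0 ≤ σ ^ (κ / N) := by positivity
    have f1 : R ^ (-τ₁) * X₁ ≤ G₁ * σ ^ (κ / N) * (E₁ + E₂ + D) := by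
      rw [hσκ] at g₁
      refine g₁.trans (mul_le_mul_of_nonneg_left ?_ (by positivity))
      have := mul_le_mul_of_nonneg_left y₁ hR₁.le
      linarith
    have f2 : R ^ (-τ₂) * X₂ ≤ G₂ * σ ^ (κ / N) * (E₁ + E₂ + D) := by
      rw [hσκ] at g₂
      refine g₂.trans (mul_le_mul_of_nonneg_left ?_ (by positivity))
      have := mul_le_mul_of_nonneg_left y₂ hR₂.le
      linarith
    calc R ^ (-τ₁) * X₁ + R ^ (-τ₂) * X₂ ≤ (G₁ + G₂) * (σ ^ (κ / N) * (E₁ + E₂ + D)) := by linarith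
      _ ≤ (G₁ + G₂) * (σ ^ (κ / N) * (C₀ * (P * D + Q))) := by gcongr
      _ = (G₁ + G₂) * C₀ * (σ ^ (κ / N) * (P * D) + σ ^ (κ / N) * Q) := by ring
      _ ≤ (G₁ + G₂) * C₀ * ((ω * 2 ^ (N : ℝ)) ^ μ * σ ^ β * (P * D) + σ ^ β * (P * D)) := by
          rw [hσQ]; gcongr
      _ = _ := by ring
  have hk0 : 0 < kt ^ (-p) := Real.rpow_pos_of_pos hkt _
  have hRτN : 0 < R ^ (τ₁ - N) := Real.rpow_pos_of_pos hR _
  set X := R ^ (τ₁ - N) * kt ^ (-p) * D with hX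
  have hX0 : 0 ≤ X := by positivity
  have hσX : σ ≤ d ^ (-p) * X := by
    have h1 : s ≤ d ^ (-p) * kt ^ (-p) * Y₁ := by
      rwa [Real.mul_rpow hd.le hkt.le] at S₁
    have h2 : R ^ (-(N : ℝ)) = R ^ (τ₁ - N) * R ^ (-τ₁) := by
      rw [← Real.rpow_add hR]; ring_nf
    have hdp : 0 < d ^ (-p) := Real.rpow_pos_of_pos hd _
    calc σ ≤ d ^ (-p) * kt ^ (-p) * Y₁ * R ^ (-(N : ℝ)) := by rw [hσ]; gcongr
      _ = d ^ (-p) * (R ^ (τ₁ - N) * kt ^ (-p) * (R ^ (-τ₁) * Y₁)) := by rw [h2]; ring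
      _ ≤ d ^ (-p) * X := by rw [hX]; gcongr; linarith
  have hσβ : σ ^ β ≤ d ^ (-(p * β)) * X ^ β := by
    refine (Real.rpow_le_rpow hσ0 hσX hβ0.le).trans (le_of_eq ?_)
    rw [Real.mul_rpow (by positivity) hX0, ← Real.rpow_mul hd.le, neg_mul]
  calc R ^ (τ₁ - N) * kt ^ (-p) * (R ^ (-τ₁) * X₁ + R ^ (-τ₂) * X₂)
      ≤ R ^ (τ₁ - N) * kt ^ (-p) *
        ((G₁ + G₂) * C₀ * ((ω * 2 ^ (N : ℝ)) ^ μ + 1) * (P * D * σ ^ β)) := by gcongr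
    _ = (G₁ + G₂) * C₀ * ((ω * 2 ^ (N : ℝ)) ^ μ + 1) * (P * X * σ ^ β) := by rw [hX]; ring
    _ ≤ (G₁ + G₂) * C₀ * ((ω * 2 ^ (N : ℝ)) ^ μ + 1) * (P * X * (d ^ (-(p * β)) * X ^ β)) := by
        gcongr
    _ = (G₁ + G₂) * C₀ * ((ω * 2 ^ (N : ℝ)) ^ μ + 1) * d ^ (-(γ₀ + p * β)) * X ^ (1 + β) := by
        rw [neg_add, Real.rpow_add hd (-γ₀) (-(p * β)), Real.rpow_one_add' hX0 (by linarith)]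
        ring

end

/-! ### The iteration -/

theorem exists_fast_decay {C γ β : ℝ} (hC : 0 < C) (hβ : 0 < β) :
    ∃ δ : ℝ, 0 < δ ∧ ∀ X : ℕ → ℝ, (∀ j, 0 ≤ X j) → X 0 ≤ δ →
      (∀ j, X (j + 1) ≤ C * ((1 / 2 : ℝ) ^ (j + 1)) ^ (-γ) * X j ^ (1 + β)) →
      (0 < γ) → Filter.Tendsto X Filter.atTop (nhds 0) := by
  set η : ℝ := (1 / 2 : ℝ) ^ (γ / β) with hη
  have hη0 : 0 < η := by positivity
  have h2γ : (0 : ℝ) < (1 / 2 : ℝ) ^ (-γ) := by positivity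
  set δ : ℝ := (η / (C * (1 / 2 : ℝ) ^ (-γ))) ^ (1 / β) with hδ
  have hδ0 : 0 < δ := by positivity
  refine ⟨δ, hδ0, fun X hX h0 hstep hγ => ?_⟩
  have hη1 : η < 1 := Real.rpow_lt_one (by norm_num) (by norm_num) (by positivity)
  have hδβ : C * (1 / 2 : ℝ) ^ (-γ) * δ ^ β = η := by
    rw [hδ, ← Real.rpow_mul (by positivity), one_div_mul_cancel hβ.ne', Real.rpow_one]
    field_simp
  have hηβ : (1 / 2 : ℝ) ^ (-γ) * η ^ β = 1 := by
    rw [hη, ← Real.rpow_mul (by norm_num), div_mul_cancel₀ _ hβ.ne', ← Real.rpow_add (by norm_num)]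
    simp
  have hpow : ∀ j : ℕ, ((1 / 2 : ℝ) ^ (j + 1)) ^ (-γ) = (1 / 2 : ℝ) ^ (-γ) * ((1 / 2 : ℝ) ^ (-γ)) ^ j := by
    intro j
    rw [← Real.rpow_natCast (1 / 2 : ℝ) (j + 1), ← Real.rpow_mul (by norm_num), mul_comm,
      Real.rpow_mul (by norm_num), Real.rpow_natCast, pow_succ, mul_comm]
  have key : ∀ j, X j ≤ δ * η ^ j := by
    intro j
    induction j with
    | zero => simpa using h0
    | succ j ih =>
      refine (hstep j).trans ?_
      have h1 : X j ^ (1 + β) ≤ (δ * η ^ j) ^ (1 + β) :=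
        Real.rpow_le_rpow (hX j) ih (by linarith)
      have h2 : (δ * η ^ j) ^ (1 + β) = δ * η ^ j * (δ ^ β * (η ^ β) ^ j) := by
        rw [Real.rpow_one_add' (by positivity) (by linarith), Real.mul_rpow hδ0.le (by positivity)]
        congr 2
        rw [← Real.rpow_natCast, ← Real.rpow_mul hη0.le, mul_comm, Real.rpow_mul hη0.le,
          Real.rpow_natCast]
      rw [hpow j]
      calc C * ((1 / 2 : ℝ) ^ (-γ) * ((1 / 2 : ℝ) ^ (-γ)) ^ j) * X j ^ (1 + β)
          ≤ C * ((1 / 2 : ℝ) ^ (-γ) * ((1 / 2 : ℝ) ^ (-γ)) ^ j) *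
            (δ * η ^ j * (δ ^ β * (η ^ β) ^ j)) := by
            rw [← h2]
            exact mul_le_mul_of_nonneg_left h1 (by positivity)
        _ = (C * (1 / 2 : ℝ) ^ (-γ) * δ ^ β) * ((1 / 2 : ℝ) ^ (-γ) * η ^ β) ^ j * (δ * η ^ j) := by
            rw [mul_pow]; ring
        _ = δ * η ^ (j + 1) := by rw [hδβ, hηβ, one_pow, mul_one, pow_succ]; ring
  refine squeeze_zero hX key ?_
  have := (tendsto_pow_atTop_nhds_zero_of_lt_one hη0.le hη1).const_mul δ
  simpa using this

section

variable {N : ℕ}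

theorem exists_ae_le {q κ μ lam₂ : ℝ} (hN : 1 ≤ N) (hq : 1 < q) (hκ : 0 < κ) (hκN : κ < N)
    (hμ : 0 < μ) (hμκ : μ < κ / N) (hlam₂ : 0 < lam₂) :
    ∃ δ : ℝ, 0 < δ ∧ ∀ {p τ₁ τ₂ Λ₁ lam₁ Λ₂ C₁ : ℝ}, 1 < p → p ≤ q → κ ≤ τ₂ → τ₂ ≤ τ₁ → τ₁ < p →
      τ₂ < q → 0 ≤ Λ₁ → 0 ≤ Λ₂ → 0 < lam₁ → 0 ≤ C₁ →
      ∃ C : ℝ, 1 ≤ C ∧ ∀ {l l' : ℝ} {k₁ b₁ k₂ b₂ : RN N → RN N → ℝ} {g u : RN N → ℝ}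
        {x₀ : RN N} {R k' kt : ℝ},
        IsLocalSolution p τ₁ Λ₁ lam₁ q τ₂ Λ₂ lam₂ l l' k₁ b₁ k₂ b₂ g u x₀ R →
        IsScale p τ₁ Λ₁ q τ₂ Λ₂ μ δ C₁ b₁ b₂ g u x₀ R k' kt →
        C ^ p * (R ^ (-(N : ℝ)) * (excess p u k' x₀ (2 * R)
          + (R / 2) ^ (τ₁ - τ₂) * excess q u k' x₀ (2 * R))) ≤ kt ^ p →
        ∀ᵐ x ∂(volume.restrict (Metric.ball x₀ R)), u x ≤ k' + kt := by
  obtain ⟨δ, hδ, hstep⟩ := exists_step hN hq hκ hκN hμ hμκ hlam₂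
  refine ⟨δ, hδ, ?_⟩
  intro p τ₁ τ₂ Λ₁ lam₁ Λ₂ C₁ hp hpq hκτ hτ hτp hτq hΛ₁ hΛ₂ hlam₁ hC₁
  obtain ⟨C₀, γ, hC₀, hγ, hst⟩ := hstep hp hpq hκτ hτ hτp hτq hΛ₁ hΛ₂ hlam₁ hC₁
  obtain ⟨ε, hε, hdecay⟩ := exists_fast_decay (γ := γ) hC₀ (by linarith : 0 < κ / N - μ)
  have hp0 : 0 < p := by linarith
  have hq0 : 0 < q := by linarith
  refine ⟨max 1 ((2 ^ (τ₁ - τ₂) / ε) ^ (1 / p)), le_max_left _ _, ?_⟩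
  set C := max 1 ((2 ^ (τ₁ - τ₂) / ε) ^ (1 / p)) with hC
  have hC1 : 1 ≤ C := le_max_left _ _
  have hCp : 2 ^ (τ₁ - τ₂) / ε ≤ C ^ p := by
    have := Real.rpow_le_rpow (by positivity) (le_max_right (1 : ℝ) ((2 ^ (τ₁ - τ₂) / ε) ^ (1 / p)))
      hp0.le
    rwa [← Real.rpow_mul (by positivity), one_div_mul_cancel hp0.ne', Real.rpow_one] at this
  intro l l' k₁ b₁ k₂ b₂ g u x₀ R k' kt hs hsc hkC
  have hR := hs.R_pos
  have hkt := hsc.pos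
  have hU : volume (Metric.ball x₀ (4 * R)) < ⊤ := measure_ball_lt_top
  have hf₁ : ∀ {ρ}, ρ ≤ 2 * R → ∀ m,
      ∫⁻ x in Metric.ball x₀ ρ, ENNReal.ofReal (trunc u m x ^ p) < ⊤ := fun hρ =>
    hs.phase₁.lintegral_trunc_lt_top' hU (Metric.ball_subset_ball (by linarith))
  have hf₂ : ∀ {ρ}, ρ ≤ 2 * R → ∀ m,
      ∫⁻ x in Metric.ball x₀ ρ, ENNReal.ofReal (trunc u m x ^ q) < ⊤ := fun hρ =>
    hs.phase₂.lintegral_trunc_lt_top' hU (Metric.ball_subset_ball (by linarith))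
  have hne : ∀ h ρ, 0 ≤ normExcess p τ₁ q τ₂ u x₀ R kt h ρ := fun h ρ => by
    have := excess_nonneg p u h x₀ ρ
    have := excess_nonneg q u h x₀ ρ
    unfold normExcess
    positivity
  set X : ℕ → ℝ := fun j => normExcess p τ₁ q τ₂ u x₀ R kt
    (k' + (1 - (1 / 2 : ℝ) ^ j) * kt) (R * (1 + (1 / 2 : ℝ) ^ j)) with hX
  have hX0 : X 0 ≤ ε := by
    simp only [hX, pow_zero, sub_self, zero_mul, add_zero]
    rw [show R * (1 + 1) = 2 * R by ring]
    unfold normExcess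
    have hY₁ := excess_nonneg p u k' x₀ (2 * R)
    have hY₂ := excess_nonneg q u k' x₀ (2 * R)
    generalize excess p u k' x₀ (2 * R) = Y₁ at *
    generalize excess q u k' x₀ (2 * R) = Y₂ at *
    have e1 : R ^ (τ₁ - N) * R ^ (-τ₁) = R ^ (-(N : ℝ)) := by
      rw [← Real.rpow_add hR]; ring_nf
    have e2 : R ^ (τ₁ - N) * R ^ (-τ₂) = R ^ (-(N : ℝ)) * R ^ (τ₁ - τ₂) := by
      rw [← Real.rpow_add hR, ← Real.rpow_add hR]; ring_nf
    have e3 : (R / 2) ^ (τ₁ - τ₂) = R ^ (τ₁ - τ₂) / 2 ^ (τ₁ - τ₂) := Real.div_rpow hR.le (by norm_num) _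
    rw [e3] at hkC
    have h2 : (1 : ℝ) ≤ 2 ^ (τ₁ - τ₂) := Real.one_le_rpow one_le_two (by linarith)
    have hRN : 0 < R ^ (-(N : ℝ)) := Real.rpow_pos_of_pos hR _
    have hRτ : 0 < R ^ (τ₁ - τ₂) := Real.rpow_pos_of_pos hR _
    have hkp : 0 < kt ^ p := by positivity
    have h3 : 2 ^ (τ₁ - τ₂) / ε * (R ^ (-(N : ℝ)) * (Y₁ + R ^ (τ₁ - τ₂) / 2 ^ (τ₁ - τ₂) * Y₂))
        ≤ kt ^ p := (mul_le_mul_of_nonneg_right hCp (by positivity)).trans hkC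
    have h4 : R ^ (-(N : ℝ)) * (Y₁ + R ^ (τ₁ - τ₂) * Y₂) ≤ ε * kt ^ p := by
      have h5 : R ^ (-(N : ℝ)) * (Y₁ + R ^ (τ₁ - τ₂) * Y₂)
          ≤ R ^ (-(N : ℝ)) * (2 ^ (τ₁ - τ₂) * Y₁ + R ^ (τ₁ - τ₂) * Y₂) := by
        gcongr
        exact le_mul_of_one_le_left hY₁ h2
      have h6 : R ^ (-(N : ℝ)) * (2 ^ (τ₁ - τ₂) * Y₁ + R ^ (τ₁ - τ₂) * Y₂)
          = ε * (2 ^ (τ₁ - τ₂) / ε *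
            (R ^ (-(N : ℝ)) * (Y₁ + R ^ (τ₁ - τ₂) / 2 ^ (τ₁ - τ₂) * Y₂))) := by
        field_simp
      rw [h6] at h5
      exact h5.trans (mul_le_mul_of_nonneg_left h3 hε.le)
    calc R ^ (τ₁ - N) * kt ^ (-p) * (R ^ (-τ₁) * Y₁ + R ^ (-τ₂) * Y₂)
        = kt ^ (-p) * ((R ^ (τ₁ - N) * R ^ (-τ₁)) * Y₁ + (R ^ (τ₁ - N) * R ^ (-τ₂)) * Y₂) := by ring
      _ = kt ^ (-p) * (R ^ (-(N : ℝ)) * (Y₁ + R ^ (τ₁ - τ₂) * Y₂)) := by rw [e1, e2]; ring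
      _ ≤ kt ^ (-p) * (ε * kt ^ p) := by gcongr
      _ = ε := by rw [Real.rpow_neg hkt.le]; field_simp
  have hhalf : ∀ j : ℕ, (0 : ℝ) < (1 / 2 : ℝ) ^ j ∧ (1 / 2 : ℝ) ^ j ≤ 1 := fun j =>
    ⟨by positivity, pow_le_one₀ (by norm_num) (by norm_num)⟩
  have hXs : ∀ j, X (j + 1) ≤ C₀ * ((1 / 2 : ℝ) ^ (j + 1)) ^ (-γ) * X j ^ (1 + (κ / N - μ)) := by
    intro j
    obtain ⟨a0, a1⟩ := hhalf j
    have hpw : (1 / 2 : ℝ) ^ (j + 1) = (1 / 2 : ℝ) ^ j / 2 := by rw [pow_succ]; ring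
    have := hst hs hsc (d := (1 / 2 : ℝ) ^ (j + 1)) (ρ := R * (1 + (1 / 2 : ℝ) ^ (j + 1)))
      (h := k' + (1 - (1 / 2 : ℝ) ^ j) * kt) (hhalf _).1 (hhalf _).2
      (by have := mul_pos hR (hhalf (j + 1)).1; linarith)
      (by rw [hpw]; nlinarith) (by have := mul_nonneg (sub_nonneg.2 a1) hkt.le; linarith)
      (by rw [hpw]; nlinarith)
    rw [show k' + (1 - (1 / 2 : ℝ) ^ j) * kt + (1 / 2 : ℝ) ^ (j + 1) * kt
        = k' + (1 - (1 / 2 : ℝ) ^ (j + 1)) * kt by rw [hpw]; ring,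
      show R * (1 + (1 / 2 : ℝ) ^ (j + 1)) + (1 / 2 : ℝ) ^ (j + 1) * R
        = R * (1 + (1 / 2 : ℝ) ^ j) by rw [hpw]; ring] at this
    exact this
  have hlim := hdecay X (fun j => hne _ _) hX0 hXs hγ
  have hle : ∀ j, normExcess p τ₁ q τ₂ u x₀ R kt (k' + kt) R ≤ X j := by
    intro j
    obtain ⟨a0, a1⟩ := hhalf j
    have h1 : k' + (1 - (1 / 2 : ℝ) ^ j) * kt ≤ k' + kt := by nlinarith
    have h2 : R ≤ R * (1 + (1 / 2 : ℝ) ^ j) := by nlinarith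
    have h3 : R * (1 + (1 / 2 : ℝ) ^ j) ≤ 2 * R := by nlinarith
    have b1 := excess_anti (r := p) hp0.le h1 h2 (hf₁ h3 _)
    have b2 := excess_anti (r := q) hq0.le h1 h2 (hf₂ h3 _)
    simp only [hX]
    unfold normExcess
    gcongr
  have h0 : normExcess p τ₁ q τ₂ u x₀ R kt (k' + kt) R ≤ 0 :=
    ge_of_tendsto' hlim hle
  have hz : excess p u (k' + kt) x₀ R = 0 := by
    have b1 := excess_nonneg p u (k' + kt) x₀ R
    have b2 := excess_nonneg q u (k' + kt) x₀ R
    unfold normExcess at h0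
    have c1 : 0 < R ^ (τ₁ - N) * kt ^ (-p) := by positivity
    have c2 : 0 < R ^ (-τ₁) := by positivity
    have c3 : 0 < R ^ (-τ₂) := by positivity
    have c4 := nonpos_of_mul_nonpos_right h0 c1
    have c5 : R ^ (-τ₁) * excess p u (k' + kt) x₀ R ≤ 0 := by
      have := mul_nonneg c3.le b2
      linarith
    exact le_antisymm (nonpos_of_mul_nonpos_right c5 c2) b1
  have hz' : ∫⁻ x in Metric.ball x₀ R, ENNReal.ofReal (trunc u (k' + kt) x ^ p) = 0 :=
    ((ENNReal.toReal_eq_zero_iff _).1 hz).resolve_right (hf₁ (by linarith) _).ne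
  have hm := measurable_trunc hs.phase₁.measurable (k' + kt)
  rw [lintegral_eq_zero_iff (by fun_prop)] at hz'
  filter_upwards [hz'] with x hx
  by_contra hlt
  rw [not_le] at hlt
  have h1 : trunc u (k' + kt) x = u x - (k' + kt) := max_eq_left (by linarith)
  simp only [Pi.zero_apply, ENNReal.ofReal_eq_zero, h1] at hx
  have := Real.rpow_pos_of_pos (sub_pos.2 hlt) p
  linarith

end

/-! ### Almost everywhere equality and change of sign -/

section

variable {N : ℕ} {u u' : RN N → ℝ}

theorem gagliardo_congr (h : u =ᵐ[volume] u') (σ r : ℝ) (D : Set (RN N)) :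
    gagliardo σ r D u = gagliardo σ r D u' := by
  unfold gagliardo
  refine lintegral_congr_ae ((ae_restrict_of_ae h).mono fun x hx => ?_)
  refine lintegral_congr_ae ((ae_restrict_of_ae h).mono fun y hy => ?_)
  simp only
  rw [hx, hy]

theorem MemFracSobolev.congr {σ r : ℝ} {D : Set (RN N)} (hu : MemFracSobolev σ r D u)
    (h : u =ᵐ[volume] u') : MemFracSobolev σ r D u' :=
  ⟨(memLp_congr_ae (ae_restrict_of_ae h)).1 hu.memLp, gagliardo_congr h σ r D ▸ hu.energy_lt_top⟩

theorem MemTailSpace.congr {σ r : ℝ} (hu : MemTailSpace σ r u) (h : u =ᵐ[volume] u') :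
    MemTailSpace σ r u' where
  memLp_loc K hK := (memLp_congr_ae (ae_restrict_of_ae h)).1 (hu.memLp_loc K hK)
  tail_lt_top := by
    refine lt_of_eq_of_lt (lintegral_congr_ae (h.mono fun y hy => ?_)) hu.tail_lt_top
    simp only
    rw [hy]

theorem MemWeightedTailSpace.congr {σ r : ℝ} {a : RN N → RN N → ℝ}
    (hu : MemWeightedTailSpace a σ r u) (h : u =ᵐ[volume] u') : MemWeightedTailSpace a σ r u' where
  memLp_loc K hK := (memLp_congr_ae (ae_restrict_of_ae h)).1 (hu.memLp_loc K hK)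
  tail_lt_top := by
    refine lt_of_eq_of_lt (iSup_congr fun x => lintegral_congr_ae (h.mono fun y hy => ?_))
      hu.tail_lt_top
    simp only
    rw [hy]

theorem formH_congr (h : u =ᵐ[volume] u') (p q : ℝ) (Ksp Ktq a : RN N → RN N → ℝ)
    (v : RN N → ℝ) : formH p q Ksp Ktq a u v = formH p q Ksp Ktq a u' v := by
  unfold formH
  congr 1
  all_goals
    refine integral_congr_ae (h.mono fun x hx => ?_)
    refine integral_congr_ae (h.mono fun y hy => ?_)
    simp only
    rw [hx, hy]

theorem SolvesDoublePhase.congr {s p t q Λ₁ Λ₂ M c₁ c₂ l : ℝ} {Ω : Set (RN N)}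
    {Ksp Ktq a : RN N → RN N → ℝ} {f : RN N → ℝ → ℝ}
    (hs : SolvesDoublePhase s p t q Λ₁ Λ₂ M c₁ c₂ l Ω Ksp Ktq a f u) (h : u =ᵐ[volume] u') :
    SolvesDoublePhase s p t q Λ₁ Λ₂ M c₁ c₂ l Ω Ksp Ktq a f u' where
  isOpen := hs.isOpen
  isBounded := hs.isBounded
  kernel_sp := hs.kernel_sp
  kernel_tq := hs.kernel_tq
  weight := hs.weight
  c₁_nonneg := hs.c₁_nonneg
  c₂_nonneg := hs.c₂_nonneg
  one_lt_l := hs.one_lt_l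
  l_lt_critExp := hs.l_lt_critExp
  growth := hs.growth
  memSobolevLoc := fun U hU hb => (hs.memSobolevLoc U hU hb).congr h
  solution := by
    have hf : (fun x => f x (u x)) =ᵐ[volume.restrict Ω] fun x => f x (u' x) :=
      (ae_restrict_of_ae h).mono fun x hx => by simp only [hx]
    refine ⟨hs.solution.memSobolev.congr h, hs.solution.memTail.congr h,
      hs.solution.memWeightedTail.congr h, hs.solution.rhs_measurable.congr hf,
      fun v hv hc hsupp => ?_⟩
    rw [← formH_congr h, hs.solution.weak v hv hc hsupp]
    exact integral_congr_ae (hf.mono fun x hx => by simp only at hx ⊢; rw [hx])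

theorem supBound_congr (h : u =ᵐ[volume] u') (s p t q : ℝ) (a : RN N → RN N → ℝ)
    (k θ ε ρ C : ℝ) (x₀ : RN N) (R : ℝ) :
    supBound s p t q a k θ ε ρ C u x₀ R = supBound s p t q a k θ ε ρ C u' x₀ R := by
  have hm : (fun x => max (u x - k) 0) =ᵐ[volume] fun x => max (u' x - k) 0 :=
    h.mono fun x hx => by simp only [hx]
  have h1 : tail s p (fun x => max (u x - k) 0) x₀ R
      = tail s p (fun x => max (u' x - k) 0) x₀ R := by
    unfold tail
    congr 2
    exact lintegral_congr_ae ((ae_restrict_of_ae hm).mono fun y hy => by simp only at hy ⊢; rw [hy])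
  have h2 : weightedTail a t q (fun x => max (u x - k) 0) x₀ R
      = weightedTail a t q (fun x => max (u' x - k) 0) x₀ R := by
    unfold weightedTail
    congr 2
    exact iSup_congr fun z =>
      lintegral_congr_ae ((ae_restrict_of_ae hm).mono fun y hy => by simp only at hy ⊢; rw [hy])
  unfold supBound
  rw [h1, h2, eLpNorm_congr_ae (ae_restrict_of_ae hm), eLpNorm_congr_ae (ae_restrict_of_ae hm)]

theorem gagliardo_neg (σ r : ℝ) (D : Set (RN N)) (u : RN N → ℝ) :
    gagliardo σ r D (fun x => -u x) = gagliardo σ r D u := by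
  unfold gagliardo
  refine lintegral_congr fun x => lintegral_congr fun y => ?_
  rw [show -u x - -u y = -(u x - u y) by ring, abs_neg]

theorem MemFracSobolev.neg {σ r : ℝ} {D : Set (RN N)} (hu : MemFracSobolev σ r D u) :
    MemFracSobolev σ r D fun x => -u x :=
  ⟨hu.memLp.neg, gagliardo_neg σ r D u ▸ hu.energy_lt_top⟩

theorem MemTailSpace.neg {σ r : ℝ} (hu : MemTailSpace σ r u) :
    MemTailSpace σ r fun x => -u x :=
  ⟨fun K hK => (hu.memLp_loc K hK).neg, by simpa only [abs_neg] using hu.tail_lt_top⟩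

theorem MemWeightedTailSpace.neg {σ r : ℝ} {a : RN N → RN N → ℝ}
    (hu : MemWeightedTailSpace a σ r u) : MemWeightedTailSpace a σ r fun x => -u x :=
  ⟨fun K hK => (hu.memLp_loc K hK).neg, by simpa only [abs_neg] using hu.tail_lt_top⟩

theorem formH_neg (p q : ℝ) (Ksp Ktq a : RN N → RN N → ℝ) (u v : RN N → ℝ) :
    formH p q Ksp Ktq a (fun x => -u x) v = -formH p q Ksp Ktq a u v := by
  unfold formH
  have e : ∀ r x y, hPow r (-u x - -u y) = -hPow r (u x - u y) := fun r x y => by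
    rw [← hPow_neg]; congr 1; ring
  simp_rw [e, mul_neg, neg_mul, integral_neg]
  ring

theorem SolvesDoublePhase.neg {s p t q Λ₁ Λ₂ M c₁ c₂ l : ℝ} {Ω : Set (RN N)}
    {Ksp Ktq a : RN N → RN N → ℝ} {f : RN N → ℝ → ℝ}
    (hs : SolvesDoublePhase s p t q Λ₁ Λ₂ M c₁ c₂ l Ω Ksp Ktq a f u) :
    SolvesDoublePhase s p t q Λ₁ Λ₂ M c₁ c₂ l Ω Ksp Ktq a (fun x τ => -f x (-τ))
      (fun x => -u x) where
  isOpen := hs.isOpen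
  isBounded := hs.isBounded
  kernel_sp := hs.kernel_sp
  kernel_tq := hs.kernel_tq
  weight := hs.weight
  c₁_nonneg := hs.c₁_nonneg
  c₂_nonneg := hs.c₂_nonneg
  one_lt_l := hs.one_lt_l
  l_lt_critExp := hs.l_lt_critExp
  growth := fun x hx τ => by simpa only [abs_neg] using hs.growth x hx (-τ)
  memSobolevLoc := fun U hU hb => (hs.memSobolevLoc U hU hb).neg
  solution := by
    refine ⟨hs.solution.memSobolev.neg, hs.solution.memTail.neg, hs.solution.memWeightedTail.neg,
      by simp only [neg_neg]; exact hs.solution.rhs_measurable.neg, fun v hv hc hsupp => ?_⟩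
    rw [formH_neg, hs.solution.weak v hv hc hsupp, ← integral_neg]
    simp only [neg_neg, neg_mul]

/-- The sup estimate follows from the bound of the positive part of `u` and of `-u`. -/
theorem supEstimate_of_posPart {s p t q : ℝ} {a : RN N → RN N → ℝ} {k θ ε ρ C : ℝ} {x₀ : RN N}
    {R : ℝ}
    (h₁ : eLpNorm (fun x => max (u x) 0) ⊤ (volume.restrict (Metric.ball x₀ R))
      ≤ supBound s p t q a k θ ε ρ C u x₀ R)
    (h₂ : eLpNorm (fun x => max (-u x) 0) ⊤ (volume.restrict (Metric.ball x₀ R))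
      ≤ supBound s p t q a k θ ε ρ C (fun x => -u x) x₀ R) :
    SupEstimate s p t q a k θ ε ρ C u x₀ R := by
  refine ⟨h₁, h₂, ?_⟩
  rw [eLpNorm_exponent_top] at h₁ h₂ ⊢
  refine essSup_le_of_ae_le _ ?_
  filter_upwards [ae_le_eLpNormEssSup (f := fun x => max (u x) 0)
      (μ := volume.restrict (Metric.ball x₀ R)),
    ae_le_eLpNormEssSup (f := fun x => max (-u x) 0)
      (μ := volume.restrict (Metric.ball x₀ R))] with x hx₁ hx₂
  rcases le_total 0 (u x) with h | h
  · rw [max_eq_left h] at hx₁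
    exact (hx₁.trans h₁).trans (le_max_left _ _)
  · rw [max_eq_left (by linarith), enorm_neg] at hx₂
    exact (hx₂.trans h₂).trans (le_max_right _ _)

end

/-! ### From solutions in `Ω` to local solutions -/

section

variable {N : ℕ} {u : RN N → ℝ}

theorem closedBall_subset_of_lt_infDist_frontier {Ω : Set (RN N)} (hΩ : IsOpen Ω) {x₀ : RN N}
    (hx₀ : x₀ ∈ Ω) {ρ : ℝ} (hρ : 0 ≤ ρ) (h : ρ < Metric.infDist x₀ (frontier Ω)) :
    Metric.closedBall x₀ ρ ⊆ Ω := by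
  refine (convex_closedBall x₀ ρ).isPreconnected.subset_of_closure_inter_subset hΩ
    ⟨x₀, Metric.mem_closedBall_self hρ, hx₀⟩ ?_
  rintro y ⟨hy, hyb⟩
  by_contra hn
  have hf : y ∈ frontier Ω := ⟨hy, by rwa [hΩ.interior_eq]⟩
  have := Metric.infDist_le_dist_of_mem (x := x₀) hf
  rw [Metric.mem_closedBall, dist_comm] at hyb
  linarith

theorem mul_one_add_norm_le {x₀ x y : RN N} {ρ₁ ρ₂ : ℝ} (hρ : ρ₁ ≤ ρ₂)
    (hx : x ∈ Metric.closedBall x₀ ρ₁) (hy : y ∉ Metric.ball x₀ ρ₂) :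
    (ρ₂ - ρ₁) * (1 + ‖y‖) ≤ (1 + ‖x₀‖ + ρ₂) * ‖x - y‖ := by
  rw [Metric.mem_closedBall, dist_eq_norm] at hx
  rw [Metric.mem_ball, not_lt, dist_eq_norm] at hy
  have h1 : ‖y - x₀‖ ≤ ‖x - y‖ + ‖x - x₀‖ := by
    calc ‖y - x₀‖ = ‖(x - x₀) - (x - y)‖ := by congr 1; abel
      _ ≤ ‖x - x₀‖ + ‖x - y‖ := norm_sub_le _ _
      _ = _ := add_comm _ _
  have h2 : ‖y‖ ≤ ‖y - x₀‖ + ‖x₀‖ := by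
    calc ‖y‖ = ‖(y - x₀) + x₀‖ := by congr 1; abel
      _ ≤ _ := norm_add_le _ _
  have h0 : 0 ≤ ‖x - x₀‖ := norm_nonneg _
  have h3 : ρ₂ - ρ₁ ≤ ‖x - y‖ := by linarith
  have h4 : 0 ≤ 1 + ‖x₀‖ + ρ₁ := by have := norm_nonneg x₀; linarith
  nlinarith

theorem inv_rpow_le_mul_inv_rpow {x₀ x y : RN N} {ρ₁ ρ₂ P : ℝ} (hP : 0 ≤ P) (hρ₁ : 0 ≤ ρ₁)
    (hρ : ρ₁ < ρ₂) (hx : x ∈ Metric.closedBall x₀ ρ₁) (hy : y ∉ Metric.ball x₀ ρ₂) :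
    (‖x - y‖ ^ P)⁻¹ ≤ ((1 + ‖x₀‖ + ρ₂) / (ρ₂ - ρ₁)) ^ P * ((1 + ‖y‖) ^ P)⁻¹ := by
  have h := mul_one_add_norm_le hρ.le hx hy
  have hd : 0 < ρ₂ - ρ₁ := by linarith
  have hA : 0 < 1 + ‖x₀‖ + ρ₂ := by have := norm_nonneg x₀; linarith
  have h1y : 0 < 1 + ‖y‖ := by have := norm_nonneg y; linarith
  have hxy : 0 < ‖x - y‖ := by
    by_contra hn
    have : ‖x - y‖ = 0 := le_antisymm (not_lt.1 hn) (norm_nonneg _)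
    rw [this, mul_zero] at h
    have := mul_pos hd h1y
    linarith
  have h2 : (1 + ‖y‖) ≤ (1 + ‖x₀‖ + ρ₂) / (ρ₂ - ρ₁) * ‖x - y‖ := by
    rw [div_mul_eq_mul_div, le_div_iff₀ hd]; linarith
  have h3 := Real.rpow_le_rpow h1y.le h2 hP
  rw [Real.mul_rpow (by positivity) hxy.le] at h3
  have h4 : 0 < ‖x - y‖ ^ P := Real.rpow_pos_of_pos hxy _
  have h5 : 0 < (1 + ‖y‖) ^ P := Real.rpow_pos_of_pos h1y _
  rw [← div_eq_mul_inv, le_div_iff₀ h5, inv_mul_le_iff₀ h4]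
  linarith

theorem lintegral_weight_mul_lt_top {A : RN N → RN N → ℝ} {e P : ℝ} (hP : 0 ≤ P)
    (hA : ∀ x y, 0 ≤ A x y)
    (hfin : ⨆ x, ∫⁻ y, ENNReal.ofReal (A x y * (|u y| ^ e / (1 + ‖y‖) ^ P)) < ⊤)
    (x₀ : RN N) {ρ₁ ρ₂ : ℝ} (hρ₁ : 0 ≤ ρ₁) (hρ : ρ₁ < ρ₂) :
    ∃ T : ℝ, 0 ≤ T ∧ ∀ z, ∀ x ∈ Metric.closedBall x₀ ρ₁, ∫⁻ y in (Metric.ball x₀ ρ₂)ᶜ,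
      ENNReal.ofReal (A z y * (|u y| ^ e / ‖x - y‖ ^ P)) ≤ ENNReal.ofReal T := by
  set S := ⨆ x, ∫⁻ y, ENNReal.ofReal (A x y * (|u y| ^ e / (1 + ‖y‖) ^ P)) with hS
  set B := ((1 + ‖x₀‖ + ρ₂) / (ρ₂ - ρ₁)) ^ P with hB
  have hd : 0 < ρ₂ - ρ₁ := by linarith
  have hB0 : 0 ≤ B := by
    have h := norm_nonneg x₀
    have : 0 ≤ 1 + ‖x₀‖ + ρ₂ := by linarith
    positivity
  refine ⟨B * S.toReal, by positivity, fun z x hx => ?_⟩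
  calc ∫⁻ y in (Metric.ball x₀ ρ₂)ᶜ, ENNReal.ofReal (A z y * (|u y| ^ e / ‖x - y‖ ^ P))
      ≤ ∫⁻ y in (Metric.ball x₀ ρ₂)ᶜ,
        ENNReal.ofReal B * ENNReal.ofReal (A z y * (|u y| ^ e / (1 + ‖y‖) ^ P)) := by
        refine setLIntegral_mono' measurableSet_ball.compl fun y hy => ?_
        rw [← ENNReal.ofReal_mul hB0]
        apply ENNReal.ofReal_le_ofReal
        have h1 := inv_rpow_le_mul_inv_rpow hP hρ₁ hρ hx hy
        have h2 : 0 ≤ A z y * |u y| ^ e := mul_nonneg (hA z y) (by positivity)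
        have := mul_le_mul_of_nonneg_left h1 h2
        rw [← hB] at this
        calc A z y * (|u y| ^ e / ‖x - y‖ ^ P) = A z y * |u y| ^ e * (‖x - y‖ ^ P)⁻¹ := by
              rw [div_eq_mul_inv]; ring
          _ ≤ _ := this
          _ = _ := by rw [div_eq_mul_inv]; ring
    _ = ENNReal.ofReal B * ∫⁻ y in (Metric.ball x₀ ρ₂)ᶜ,
          ENNReal.ofReal (A z y * (|u y| ^ e / (1 + ‖y‖) ^ P)) :=
        lintegral_const_mul' _ _ ENNReal.ofReal_ne_top
    _ ≤ ENNReal.ofReal B * S :=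
        mul_le_mul' le_rfl ((setLIntegral_le_lintegral _ _).trans
          (le_iSup (fun x => ∫⁻ y, ENNReal.ofReal (A x y * (|u y| ^ e / (1 + ‖y‖) ^ P))) z))
    _ = ENNReal.ofReal (B * S.toReal) := by
        rw [ENNReal.ofReal_mul hB0, ENNReal.ofReal_toReal hfin.ne]

theorem isPhase_of_tail {r τ Λ R : ℝ} {k A : RN N → RN N → ℝ} {x₀ : RN N} (hN : 1 ≤ N) (hr : 1 < r)
    (hτ : 0 < τ) (hτr : τ < r) (hΛ : 0 ≤ Λ) (hR : 0 < R) (hkm : Measurable (Function.uncurry k))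
    (hk0 : ∀ x y, x ≠ y → 0 ≤ k x y) (hks : ∀ x y, k x y = k y x)
    (hk : ∀ x y, x ≠ y → k x y ≤ Λ / ‖x - y‖ ^ ((N : ℝ) + τ)) {Λ' : ℝ} (hΛ' : 0 ≤ Λ')
    (hA : ∀ x y, 0 ≤ A x y) (hkA : ∀ x y, x ≠ y → k x y ≤ Λ' * A x y / ‖x - y‖ ^ ((N : ℝ) + τ))
    (hu : Measurable u)
    (hur : ∫⁻ x in Metric.ball x₀ (4 * R), ENNReal.ofReal (|u x| ^ r) < ⊤)
    (hue : energyOn r τ (Metric.ball x₀ (4 * R)) u < ⊤)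
    (hfin : ⨆ x, ∫⁻ y, ENNReal.ofReal (A x y * (|u y| ^ (r - 1) / (1 + ‖y‖) ^ ((N : ℝ) + τ))) < ⊤) :
    IsPhase r τ Λ (2 * R) k (Metric.ball x₀ (4 * R)) (Metric.closedBall x₀ (2 * R)) u where
  one_le_dim := hN
  one_lt := hr
  τ_pos := hτ
  τ_lt := hτr
  Λ_nonneg := hΛ
  kernel_measurable := hkm
  kernel_nonneg := hk0
  kernel_symm := hks
  kernel_le := hk
  measurable := hu
  measurableSet_U := measurableSet_ball
  measurableSet_K := measurableSet_closedBall
  subset := Metric.closedBall_subset_ball (by linarith)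
  volume_K := measure_closedBall_lt_top
  gap_pos := by linarith
  gap x hx y hy := by
    rw [Metric.mem_closedBall, dist_eq_norm] at hx
    rw [Metric.mem_ball, not_lt, dist_eq_norm] at hy
    have : ‖y - x₀‖ ≤ ‖x - x₀‖ + ‖x - y‖ := by
      calc ‖y - x₀‖ = ‖(x - x₀) - (x - y)‖ := by congr 1; abel
        _ ≤ ‖x - x₀‖ + ‖x - y‖ := norm_sub_le _ _
    linarith
  lintegral_lt_top := hur
  energyOn_lt_top := hue
  tail := by
    obtain ⟨T, hT, h⟩ := lintegral_weight_mul_lt_top (by positivity) hA hfin x₀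
      (by linarith : 0 ≤ 2 * R) (by linarith : 2 * R < 4 * R)
    refine ⟨Λ' * T, by positivity, fun x hx => ?_⟩
    rw [ENNReal.ofReal_mul hΛ']
    refine le_trans ?_ (mul_le_mul' le_rfl (h x x hx))
    rw [← lintegral_const_mul' _ _ ENNReal.ofReal_ne_top]
    refine setLIntegral_mono' measurableSet_ball.compl fun y hy => ?_
    rw [← ENNReal.ofReal_mul hΛ']
    apply ENNReal.ofReal_le_ofReal
    have hxy : x ≠ y := by
      rintro rfl
      rw [Metric.mem_closedBall] at hx
      rw [mem_compl_iff, Metric.mem_ball, not_lt] at hy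
      linarith
    calc k x y * |u y| ^ (r - 1)
        ≤ Λ' * A x y / ‖x - y‖ ^ ((N : ℝ) + τ) * |u y| ^ (r - 1) :=
          mul_le_mul_of_nonneg_right (hkA x y hxy) (by positivity)
      _ = _ := by ring

theorem IsKernel.measurable {σ r Λ : ℝ} {k : RN N → RN N → ℝ} (h : IsKernel σ r Λ k) :
    Measurable (Function.uncurry k) := by
  have h1 : Measurable (k 0) := measurable_of_continuousOn_compl_singleton 0 (h.cont 0)
  have h2 : Function.uncurry k = fun z : RN N × RN N => k 0 (z.2 - z.1) := by
    funext z
    have := h.transl 0 (z.2 - z.1) z.1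
    rw [zero_add, sub_add_cancel] at this
    exact this
  rw [h2]
  exact h1.comp (by fun_prop)

theorem IsKernel.nonneg {σ r Λ : ℝ} {k : RN N → RN N → ℝ} (h : IsKernel σ r Λ k) {x y : RN N}
    (hxy : x ≠ y) : 0 ≤ k x y := by
  have := h.const_pos
  exact le_trans (by positivity) (h.lower x y hxy)

theorem Exponents.tq_pos {s p t q : ℝ} (h : Exponents N s p t q) : 0 < t * q := by
  have := h.one_lt_p; have := h.p_le_q
  exact mul_pos h.t_pos (by linarith)

theorem Exponents.one_le_dim {s p t q : ℝ} (h : Exponents N s p t q) : 1 ≤ N := by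
  have h1 := h.tq_pos
  have h2 := h.tq_le_N
  have : (0 : ℝ) < N := by linarith
  exact_mod_cast this

theorem MemFracSobolevLoc.lintegral_lt_top {t q κ : ℝ} (hN : 1 ≤ N) (hq : 1 < q) (ht : 0 < t)
    (ht1 : t < 1) (hκ : 0 < κ) (hκN : κ < N) (hκt : κ ≤ t * q) (hu : Measurable u)
    (h : MemFracSobolevLoc t q u) {B : Set (RN N)} (hB : Bornology.IsBounded B) :
    ∫⁻ x in B, ENNReal.ofReal (|u x| ^ (N * q / (N - κ))) < ⊤ := by
  obtain ⟨a, ha, hBa⟩ := hB.subset_closedBall_lt 0 0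
  have hab : a < a + 1 := by linarith
  obtain ⟨K, hK, hE⟩ := exists_energy_mul_cutoff_le (N := N) (r := q) hN
    (mul_pos ht (by linarith)) (by nlinarith : t * q < q)
  obtain ⟨C, hC, hS⟩ := exists_sobolev_scaled hN hq.le hκ hκN
  have hcut := isCutoff_cutoff_rpow (x₀ := (0 : RN N)) hab le_rfl
  set ψ : RN N → ℝ := fun x => cutoff 0 a (a + 1) x ^ (1 : ℝ) with hψ
  have hmem := h (Metric.ball 0 (a + 1)) Metric.isOpen_ball Metric.isBounded_ball
  have hq0 : 0 < q := by linarith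
  have hL := (memLp_ofReal_iff hq0 hu.aestronglyMeasurable).1 hmem.memLp
  have hen : energyOn q (t * q) (Metric.ball 0 (a + 1)) u < ⊤ := hmem.energy_lt_top
  have hE' : energy q (t * q) (fun x => u x * ψ x) < ⊤ := by
    refine (hE _ measurableSet_ball 1 _ (by simp) ψ hcut u hu).trans_lt ?_
    exact ENNReal.mul_lt_top ENNReal.ofReal_lt_top
      (ENNReal.add_lt_top.2 ⟨hen, ENNReal.mul_lt_top ENNReal.ofReal_lt_top hL⟩)
  have hψ0 : ∀ x, 0 ≤ ψ x := fun x => Real.rpow_nonneg (cutoff_nonneg _ _ _ _) _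
  have hψ1 : ∀ x, ψ x ≤ 1 := fun x =>
    Real.rpow_le_one (cutoff_nonneg _ _ _ _) (cutoff_le_one _ _ _ _) zero_le_one
  have hL' : ∫⁻ x, ENNReal.ofReal (|u x * ψ x| ^ q) < ⊤ := by
    refine lt_of_le_of_lt ?_ hL
    rw [← lintegral_indicator measurableSet_ball]
    refine lintegral_mono fun x => ?_
    simp only
    by_cases hx : x ∈ Metric.ball (0 : RN N) (a + 1)
    · rw [indicator_of_mem hx, abs_mul, abs_of_nonneg (hψ0 x)]
      exact ENNReal.ofReal_le_ofReal (Real.rpow_le_rpow (mul_nonneg (abs_nonneg _) (hψ0 x))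
        (mul_le_of_le_one_right (abs_nonneg _) (hψ1 x)) hq0.le)
    · simp [hcut.eq_zero x hx, Real.zero_rpow hq0.ne']
  have hsob := hS (t * q) hκt 1 one_pos (fun x => u x * ψ x) (hu.mul hcut.measurable) hL'
  have hNr : (0 : ℝ) < N := by exact_mod_cast hN
  have hκ1 : 0 < 1 - κ / N := by rw [sub_pos, div_lt_one hNr]; exact hκN
  have hfin : (∫⁻ y, ENNReal.ofReal (|u y * ψ y| ^ (N * q / (N - κ)))) ^ (1 - κ / N) < ⊤ :=
    hsob.trans_lt (ENNReal.add_lt_top.2 ⟨ENNReal.mul_lt_top ENNReal.ofReal_lt_top hE',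
      ENNReal.mul_lt_top ENNReal.ofReal_lt_top hL'⟩)
  refine lt_of_le_of_lt ?_ ((ENNReal.rpow_lt_top_iff_of_pos hκ1).1 hfin)
  refine (lintegral_mono_set hBa).trans (le_trans ?_
    (setLIntegral_le_lintegral (Metric.closedBall 0 a) _))
  refine setLIntegral_mono' measurableSet_closedBall fun x hx => ?_
  have : ψ x = 1 := by
    rw [hψ]
    simp only
    rw [cutoff_eq_one hab (by simpa using hx), Real.one_rpow]
  rw [this, mul_one]

theorem exists_exponent_of_lt_critExp {s p t q l : ℝ} (hE : Exponents N s p t q) (hl : 1 < l)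
    (h : ENNReal.ofReal l < critExp N t q) :
    ∃ κ : ℝ, 0 < κ ∧ κ < N ∧ κ ≤ t * q ∧ l ≤ N * q / (N - κ) := by
  have hN : (0 : ℝ) < N := by exact_mod_cast hE.one_le_dim
  have hq : 1 < q := lt_of_lt_of_le hE.one_lt_p hE.p_le_q
  unfold critExp at h
  split_ifs at h with ht
  · exact ⟨t * q, hE.tq_pos, ht, le_rfl, ((ENNReal.ofReal_lt_ofReal_iff_of_nonneg (by linarith)).1 h).le⟩
  · have h1 : 0 < min ((N : ℝ) / 2) (N * q / l) := by positivity
    refine ⟨N - min ((N : ℝ) / 2) (N * q / l), ?_, by linarith, by linarith, ?_⟩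
    · have := min_le_left ((N : ℝ) / 2) (N * q / l); linarith
    · rw [sub_sub_cancel, le_div_iff₀ h1]
      calc l * min ((N : ℝ) / 2) (N * q / l) ≤ l * (N * q / l) := by
            gcongr; exact min_le_right _ _
        _ = N * q := by field_simp

theorem lintegral_rpow_lt_top_of_le {l m : ℝ} {B : Set (RN N)} (hl : 0 ≤ l) (hlm : l ≤ m)
    (hB : volume B < ⊤) (h : ∫⁻ x in B, ENNReal.ofReal (|u x| ^ m) < ⊤) :
    ∫⁻ x in B, ENNReal.ofReal (|u x| ^ l) < ⊤ := by
  have hle : ∀ x, ENNReal.ofReal (|u x| ^ l) ≤ 1 + ENNReal.ofReal (|u x| ^ m) := fun x => by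
    rw [← ENNReal.ofReal_one, ← ENNReal.ofReal_add zero_le_one (by positivity)]
    apply ENNReal.ofReal_le_ofReal
    rcases le_total (|u x|) 1 with h1 | h1
    · have := Real.rpow_le_one (abs_nonneg (u x)) h1 hl
      have : 0 ≤ |u x| ^ m := by positivity
      linarith
    · have := Real.rpow_le_rpow_of_exponent_le h1 hlm
      linarith
  refine (lintegral_mono hle).trans_lt ?_
  rw [lintegral_add_left measurable_const]
  exact ENNReal.add_lt_top.2 ⟨by simpa using hB, h⟩

end

section

variable {N : ℕ} {u : RN N → ℝ} {s p t q Λ₁ Λ₂ M c₁ c₂ l : ℝ} {Ω : Set (RN N)}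
  {Ksp Ktq a : RN N → RN N → ℝ} {f : RN N → ℝ → ℝ}

theorem SolvesDoublePhase.exists_rhs (h : SolvesDoublePhase s p t q Λ₁ Λ₂ M c₁ c₂ l Ω Ksp Ktq a f u)
    (hu : Measurable u) {K : Set (RN N)} (hK : MeasurableSet K) (hKΩ : K ⊆ Ω) :
    ∃ g : RN N → ℝ, Measurable g ∧ (∀ x ∈ K, |g x| ≤ c₁ + c₂ * |u x| ^ (l - 1)) ∧
      (∀ x, x ∉ K → g x = 0) ∧ ∀ᵐ x, x ∈ K → g x = f x (u x) := by
  have hc₁ := h.c₁_nonneg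
  have hc₂ := h.c₂_nonneg
  obtain ⟨g₀, hg₀, hae⟩ := h.solution.rhs_measurable
  set B : RN N → ℝ := fun x => c₁ + c₂ * |u x| ^ (l - 1) with hB
  have hBm : Measurable B := by fun_prop
  have hB0 : ∀ x, 0 ≤ B x := fun x => by positivity
  refine ⟨K.indicator fun x => max (-B x) (min (g₀ x) (B x)),
    ((hBm.neg.max (hg₀.measurable.min hBm)).indicator hK), fun x hx => ?_,
    fun x hx => indicator_of_notMem hx _, ?_⟩
  · rw [indicator_of_mem hx, abs_le]
    exact ⟨le_max_left _ _, max_le (by linarith [hB0 x]) (min_le_right _ _)⟩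
  · rw [Filter.EventuallyEq, ae_restrict_iff' h.isOpen.measurableSet] at hae
    filter_upwards [hae] with x hx hxK
    rw [indicator_of_mem hxK, ← hx (hKΩ hxK)]
    have := abs_le.1 (h.growth x (hKΩ hxK) (u x))
    rw [min_eq_left this.2, max_eq_right this.1]

theorem SolvesDoublePhase.memLp_indicator (hE : Exponents N s p t q)
    (h : SolvesDoublePhase s p t q Λ₁ Λ₂ M c₁ c₂ l Ω Ksp Ktq a f u)
    (hu : Measurable u) {K : Set (RN N)} (hK : MeasurableSet K) (hKb : Bornology.IsBounded K) :
    MemLp (K.indicator u) (ENNReal.ofReal l) := by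
  have hl := h.one_lt_l
  have hq : 1 < q := lt_of_lt_of_le hE.one_lt_p hE.p_le_q
  obtain ⟨κ, hκ, hκN, hκt, hle⟩ := exists_exponent_of_lt_critExp hE hl h.l_lt_critExp
  rw [memLp_indicator_iff_restrict hK, memLp_ofReal_iff (by linarith) hu.aestronglyMeasurable]
  exact lintegral_rpow_lt_top_of_le (by linarith) hle hKb.measure_lt_top
    (h.memSobolevLoc.lintegral_lt_top hE.one_le_dim hq hE.t_pos hE.t_lt_one hκ hκN hκt hu hKb)

theorem memLp_of_growth {g : RN N → ℝ} {l' : ℝ} {K : Set (RN N)} (hl : l.HolderConjugate l')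
    (hc₁ : 0 ≤ c₁) (hc₂ : 0 ≤ c₂) (hK : MeasurableSet K) (hKf : volume K < ⊤) (hu : Measurable u)
    (huK : MemLp (K.indicator u) (ENNReal.ofReal l)) (hg : Measurable g)
    (hgK : ∀ x ∈ K, |g x| ≤ c₁ + c₂ * |u x| ^ (l - 1)) (hg0 : ∀ x, x ∉ K → g x = 0) :
    MemLp g (ENNReal.ofReal l') := by
  have hl1 := hl.lt
  have hl'0 : 0 < l' := hl.symm.pos
  rw [memLp_indicator_iff_restrict hK, memLp_ofReal_iff (by linarith) hu.aestronglyMeasurable] at huK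
  have hgi : g = K.indicator g := by
    funext x
    by_cases hx : x ∈ K
    · rw [indicator_of_mem hx]
    · rw [indicator_of_notMem hx, hg0 x hx]
  rw [hgi, memLp_indicator_iff_restrict hK]
  have h1 : MemLp (fun x => |u x| ^ (l - 1)) (ENNReal.ofReal l') (volume.restrict K) := by
    rw [memLp_ofReal_iff hl'0
      (by fun_prop : Measurable fun x => |u x| ^ (l - 1)).aestronglyMeasurable]
    have e : ∀ x, |(|u x| ^ (l - 1))| ^ l' = |u x| ^ l := fun x => by
      rw [abs_of_nonneg (by positivity), ← Real.rpow_mul (abs_nonneg _), hl.sub_one_mul_conj]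
    simp_rw [e]
    exact huK
  have : IsFiniteMeasure (volume.restrict K) := ⟨by simpa using hKf⟩
  have h2 : MemLp (fun x => c₁ + c₂ * |u x| ^ (l - 1)) (ENNReal.ofReal l') (volume.restrict K) :=
    (memLp_const c₁).add (h1.const_mul c₂)
  refine h2.mono hg.aestronglyMeasurable ((ae_restrict_iff' hK).2 (Filter.Eventually.of_forall
    fun x hx => ?_))
  rw [Real.norm_eq_abs, Real.norm_eq_abs, abs_of_nonneg (by positivity : 0 ≤ c₁ + c₂ * |u x| ^ (l - 1))]
  exact hgK x hx

theorem formH_eq_phaseIntegrand (u v : RN N → ℝ) :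
    formH p q Ksp Ktq a u v = (∫ x, ∫ y, phaseIntegrand p Ksp u v (x, y))
      + ∫ x, ∫ y, phaseIntegrand q (fun x y => a x y * Ktq x y) u v (x, y) := by
  unfold formH phaseIntegrand
  congr 1
  refine integral_congr_ae (Filter.Eventually.of_forall fun x => integral_congr_ae
    (Filter.Eventually.of_forall fun y => ?_))
  simp only
  ring

theorem SolvesDoublePhase.exists_isLocalSolution (hE : Exponents N s p t q)
    (h : SolvesDoublePhase s p t q Λ₁ Λ₂ M c₁ c₂ l Ω Ksp Ktq a f u) (hu : Measurable u) {a₀ : ℝ}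
    (ha₀ : 0 < a₀) (ha : ∀ x ∈ Ω, ∀ y ∈ Ω, a₀ ≤ a x y) {x₀ : RN N} {R : ℝ} (hR : 0 < R)
    (hball : Metric.closedBall x₀ (2 * R) ⊆ Ω) :
    ∃ (l' : ℝ) (g : RN N → ℝ),
      IsLocalSolution p (s * p) |Λ₁| (1 / (|Λ₁| + 1)) q (t * q) (|Λ₂| * (|M| + 1)) (a₀ / (|Λ₂| + 1))
        l l' Ksp (fun _ _ => |Λ₁|) (fun x y => a x y * Ktq x y) (fun x y => |Λ₂| * a x y) g u x₀ R ∧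
      ∀ x ∈ Metric.closedBall x₀ (2 * R), |g x| ≤ c₁ + c₂ * |u x| ^ (l - 1) := by
  have hN := hE.one_le_dim
  have hp := hE.one_lt_p
  have hq : 1 < q := lt_of_lt_of_le hp hE.p_le_q
  have htq := hE.tq_pos
  have hsp : 0 < s * p := mul_pos hE.s_pos (by linarith)
  have htq' : t * q < q := by have := hE.t_lt_one; nlinarith
  have hsp' : s * p < p := by have := hE.s_lt_one; nlinarith
  have hΛ₁ := h.kernel_sp.const_pos
  have hΛ₂ := h.kernel_tq.const_pos
  have hM : 0 < M := lt_of_lt_of_le (h.weight.pos 0 0) (h.weight.le 0 0)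
  set K := Metric.closedBall x₀ (2 * R) with hK
  have hKm : MeasurableSet K := measurableSet_closedBall
  obtain ⟨g, hgm, hgK, hg0, hgae⟩ := h.exists_rhs hu hKm hball
  have hl : l.HolderConjugate (Real.conjExponent l) := Real.HolderConjugate.conjExponent h.one_lt_l
  have huK := h.memLp_indicator hE hu hKm Metric.isBounded_closedBall
  have hsub : Metric.ball x₀ (2 * R) ⊆ Ω := Metric.ball_subset_closedBall.trans hball
  have hmemq := h.memSobolevLoc (Metric.ball x₀ (4 * R)) Metric.isOpen_ball Metric.isBounded_ball
  have hpos : ∀ {x y : RN N} (e : ℝ), x ≠ y → 0 < ‖x - y‖ ^ e := fun e hxy =>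
    Real.rpow_pos_of_pos (norm_pos_iff.2 (sub_ne_zero.2 hxy)) _
  refine ⟨Real.conjExponent l, g, ⟨hR, ?_, ?_, ?_, ?_, fun _ _ => abs_nonneg _, fun x y =>
    mul_nonneg (abs_nonneg _) (h.weight.pos x y).le, ?_, ?_, hl, hgm,
    memLp_of_growth hl h.c₁_nonneg h.c₂_nonneg hKm measure_closedBall_lt_top hu huK hgm hgK hg0,
    huK, ?_⟩, hgK⟩
  · refine isPhase_of_tail (A := fun _ _ => 1) (Λ' := Λ₁) hN hp hsp hsp' (abs_nonneg _) hR
      h.kernel_sp.measurable (fun x y hxy => h.kernel_sp.nonneg hxy) h.kernel_sp.symm ?_ hΛ₁.le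
      (fun _ _ => zero_le_one) ?_ hu ?_ ?_ ?_
    · rw [abs_of_pos hΛ₁]; exact h.kernel_sp.upper
    · simpa only [mul_one] using h.kernel_sp.upper
    · have := (memLp_ofReal_iff (by linarith) hu.aestronglyMeasurable).1 h.solution.memSobolev.memLp
      rw [Measure.restrict_univ] at this
      exact (setLIntegral_le_lintegral _ _).trans_lt this
    · have := h.solution.memSobolev.energy_lt_top
      rw [gagliardo_univ] at this
      refine lt_of_le_of_lt ?_ this
      exact (setLIntegral_le_lintegral _ _).trans (lintegral_mono fun _ => setLIntegral_le_lintegral _ _)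
    · simp only [one_mul, iSup_const]
      exact h.solution.memTail.tail_lt_top
  · refine isPhase_of_tail (A := a) (Λ' := Λ₂) hN hq htq htq' (by positivity) hR ?_ (fun x y hxy =>
      mul_nonneg (h.weight.pos x y).le (h.kernel_tq.nonneg hxy)) (fun x y => ?_) (fun x y hxy => ?_)
      hΛ₂.le (fun x y => (h.weight.pos x y).le) (fun x y hxy => ?_) hu ?_ hmemq.energy_lt_top
      h.solution.memWeightedTail.tail_lt_top
    · exact h.weight.cont.measurable.mul h.kernel_tq.measurable
    · rw [h.weight.symm x y, h.kernel_tq.symm x y]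
    · have h1 := h.kernel_tq.upper x y hxy
      have h2 := hpos ((N : ℝ) + t * q) hxy
      have h3 : a x y ≤ |M| + 1 := by linarith [h.weight.le x y, le_abs_self M]
      rw [abs_of_pos hΛ₂]
      calc a x y * Ktq x y ≤ (|M| + 1) * (Λ₂ / ‖x - y‖ ^ ((N : ℝ) + t * q)) :=
            mul_le_mul h3 h1 (h.kernel_tq.nonneg hxy) (by positivity)
        _ = _ := by ring
    · have h1 := mul_le_mul_of_nonneg_left (h.kernel_tq.upper x y hxy) (h.weight.pos x y).le
      refine h1.trans (le_of_eq ?_)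
      ring
    · exact (memLp_ofReal_iff (by linarith) hu.aestronglyMeasurable).1 hmemq.memLp
  · intro x _ y _ hxy
    refine le_trans ?_ (h.kernel_sp.lower x y hxy)
    have h2 := hpos ((N : ℝ) + s * p) hxy
    rw [abs_of_pos hΛ₁, div_div]
    apply one_div_le_one_div_of_le (by positivity)
    nlinarith
  · intro x hx y hy hxy
    have h1 := h.kernel_tq.lower x y hxy
    have h2 := hpos ((N : ℝ) + t * q) hxy
    have h3 := ha x (hsub hx) y (hsub hy)
    rw [abs_of_pos hΛ₂]
    calc a₀ / (Λ₂ + 1) / ‖x - y‖ ^ ((N : ℝ) + t * q)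
        = a₀ * (1 / ((Λ₂ + 1) * ‖x - y‖ ^ ((N : ℝ) + t * q))) := by rw [div_div]; ring
      _ ≤ a₀ * (1 / (Λ₂ * ‖x - y‖ ^ ((N : ℝ) + t * q))) := by
          refine mul_le_mul_of_nonneg_left (one_div_le_one_div_of_le (by positivity) ?_) ha₀.le
          nlinarith
      _ ≤ a x y * Ktq x y := mul_le_mul h3 h1 (by positivity) (by linarith)
  · intro x y hxy
    rw [abs_of_pos hΛ₁]; exact h.kernel_sp.upper x y hxy
  · intro x y hxy
    have h1 := mul_le_mul_of_nonneg_left (h.kernel_tq.upper x y hxy) (h.weight.pos x y).le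
    rw [abs_of_pos hΛ₂]
    refine h1.trans (le_of_eq ?_)
    ring
  · intro w hw hwK
    have hcs : HasCompactSupport w := HasCompactSupport.intro (isCompact_closedBall x₀ (2 * R)) hwK
    have hts : tsupport w ⊆ K := closure_minimal (fun x hx => by
      by_contra hn
      exact hx (hwK x hn)) Metric.isClosed_closedBall
    rw [← formH_eq_phaseIntegrand, h.solution.weak w hw hcs (hts.trans hball),
      ← integral_indicator h.isOpen.measurableSet]
    refine integral_congr_ae (hgae.mono fun x hx => ?_)
    by_cases hxK : x ∈ K
    · simp only
      rw [indicator_of_mem (hball hxK), hx hxK]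
    · simp only [indicator, hwK x hxK, mul_zero, ite_self]

end

/-! ### The bound of the positive part -/

theorem le_ofReal_of_rpow_le {I : ℝ≥0∞} {R τ e kt : ℝ} (hR : 0 < R) (he : 0 < e) (hkt : 0 ≤ kt)
    (h : (ENNReal.ofReal (R ^ τ) * I) ^ (1 / e) ≤ ENNReal.ofReal kt) :
    I ≤ ENNReal.ofReal (R ^ (-τ) * kt ^ e) := by
  have h1 := ENNReal.rpow_le_rpow h he.le
  rw [← ENNReal.rpow_mul, one_div_mul_cancel he.ne', ENNReal.rpow_one,
    ENNReal.ofReal_rpow_of_nonneg hkt he.le] at h1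
  have h2 : ENNReal.ofReal (R ^ (-τ)) * ENNReal.ofReal (R ^ τ) = 1 := by
    rw [← ENNReal.ofReal_mul (by positivity), ← Real.rpow_add hR]
    simp
  calc I = ENNReal.ofReal (R ^ (-τ)) * (ENNReal.ofReal (R ^ τ) * I) := by
        rw [← mul_assoc, h2, one_mul]
    _ ≤ ENNReal.ofReal (R ^ (-τ)) * ENNReal.ofReal (kt ^ e) := mul_le_mul' le_rfl h1
    _ = _ := (ENNReal.ofReal_mul (by positivity)).symm

theorem eLpNorm_rpow_eq_lintegral {X : Type*} [MeasurableSpace X] {ν : Measure X} (f : X → ℝ)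
    {r : ℝ} (hr : 0 < r) :
    eLpNorm f (ENNReal.ofReal r) ν ^ r = ∫⁻ x, ENNReal.ofReal (|f x| ^ r) ∂ν := by
  have h0 : ENNReal.ofReal r ≠ 0 := by simpa using hr
  rw [eLpNorm_eq_lintegral_rpow_enorm_toReal h0 ENNReal.ofReal_ne_top, ENNReal.toReal_ofReal hr.le,
    ← ENNReal.rpow_mul, one_div_mul_cancel hr.ne', ENNReal.rpow_one]
  refine lintegral_congr fun x => ?_
  rw [← ofReal_norm, Real.norm_eq_abs, ENNReal.ofReal_rpow_of_nonneg (abs_nonneg _) hr.le]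

section

variable {N : ℕ} {u : RN N → ℝ} {s p t q Λ₁ Λ₂ M c₁ c₂ l : ℝ} {Ω : Set (RN N)}
  {Ksp Ktq a : RN N → RN N → ℝ} {f : RN N → ℝ → ℝ}

theorem eLpNorm_trunc_rpow {r m ρ : ℝ} {x₀ : RN N} (hr : 0 < r)
    (hfin : ∫⁻ x in Metric.ball x₀ ρ, ENNReal.ofReal (trunc u m x ^ r) < ⊤) :
    eLpNorm (fun x => max (u x - m) 0) (ENNReal.ofReal r) (volume.restrict (Metric.ball x₀ ρ)) ^ r
      = ENNReal.ofReal (excess r u m x₀ ρ) := by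
  rw [eLpNorm_rpow_eq_lintegral _ hr, excess, ENNReal.ofReal_toReal hfin.ne]
  refine lintegral_congr fun x => ?_
  rw [abs_of_nonneg (le_max_right _ _)]
  rfl

/-- The lower order term `c₂|u|^(l-1)` is controlled, above the level `k'`, by a bounded and an
integrable multiple of `u^(q-1)`. -/
def IsGrowthControlled (t q μ δ C₁ c₂ l k' : ℝ) (u : RN N → ℝ) (x₀ : RN N) (R : ℝ) : Prop :=
  ∃ (b : ℝ) (V : RN N → ℝ), Measurable V ∧ (∀ x, 0 ≤ V x) ∧ 0 ≤ b ∧ b ≤ C₁ * R ^ (-(t * q)) ∧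
    (∫⁻ x in Metric.ball x₀ (2 * R), ENNReal.ofReal (V x) ^ (1 / μ)) ^ μ
      ≤ ENNReal.ofReal (δ * R ^ (N * μ - t * q)) ∧
    ∀ x ∈ Metric.ball x₀ (2 * R), k' < u x → c₂ * |u x| ^ (l - 1) ≤ (b + V x) * u x ^ (q - 1)

theorem SolvesDoublePhase.eLpNorm_posPart_le (hE : Exponents N s p t q)
    (h : SolvesDoublePhase s p t q Λ₁ Λ₂ M c₁ c₂ l Ω Ksp Ktq a f u) (hu : Measurable u) {a₀ : ℝ}
    (ha₀ : 0 < a₀) (ha : ∀ x ∈ Ω, ∀ y ∈ Ω, a₀ ≤ a x y) {x₀ : RN N} {R : ℝ} (hR : 0 < R)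
    (hball : Metric.closedBall x₀ (2 * R) ⊆ Ω) {μ δ C₁ C k' ε : ℝ} (hC : 1 ≤ C) (hk'0 : 0 ≤ k')
    (hcore : ∀ {l' kt : ℝ} {g : RN N → ℝ},
      IsLocalSolution p (s * p) |Λ₁| (1 / (|Λ₁| + 1)) q (t * q) (|Λ₂| * (|M| + 1)) (a₀ / (|Λ₂| + 1))
        l l' Ksp (fun _ _ => |Λ₁|) (fun x y => a x y * Ktq x y) (fun x y => |Λ₂| * a x y) g u x₀ R →
      IsScale p (s * p) |Λ₁| q (t * q) (|Λ₂| * (|M| + 1)) μ δ C₁ (fun _ _ => |Λ₁|)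
        (fun x y => |Λ₂| * a x y) g u x₀ R k' kt →
      C ^ p * (R ^ (-(N : ℝ)) * (excess p u k' x₀ (2 * R)
          + (R / 2) ^ (s * p - t * q) * excess q u k' x₀ (2 * R))) ≤ kt ^ p →
        ∀ᵐ x ∂(volume.restrict (Metric.ball x₀ R)), u x ≤ k' + kt)
    (hε : R ^ (t * q) ≤ R ^ ((t * q / (q - 1) + N * ε) / q * (q - 1)))
    (hgr : IsGrowthControlled t q μ δ C₁ c₂ l k' u x₀ R) :
    eLpNorm (fun x => max (u x) 0) ⊤ (volume.restrict (Metric.ball x₀ R))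
      ≤ supBound s p t q a k' (c₁ ^ (1 / (q - 1))) ε (t * q / (q - 1)) C u x₀ R := by
  have hp := hE.one_lt_p
  have hq : 1 < q := lt_of_lt_of_le hp hE.p_le_q
  have hp0 : 0 < p := by linarith
  have hq0 : 0 < q := by linarith
  have hc₁ := h.c₁_nonneg
  obtain ⟨l', g, hs, hg⟩ := h.exists_isLocalSolution hE hu ha₀ ha hR hball
  by_cases hS : supBound s p t q a k' (c₁ ^ (1 / (q - 1))) ε (t * q / (q - 1)) C u x₀ R = ⊤
  · rw [hS]; exact le_top
  have hU : volume (Metric.ball x₀ (4 * R)) < ⊤ := measure_ball_lt_top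
  have hsub : Metric.ball x₀ (2 * R) ⊆ Metric.ball x₀ (4 * R) :=
    Metric.ball_subset_ball (by linarith)
  have hYp := hs.phase₁.lintegral_trunc_lt_top' hU hsub k'
  have hYq := hs.phase₂.lintegral_trunc_lt_top' hU hsub k'
  refine ENNReal.le_of_forall_pos_le_add fun ζ hζ _ => ?_
  have hζ' : (0 : ℝ) < ζ := hζ
  unfold supBound at hS ⊢
  rw [eLpNorm_trunc_rpow hp0 hYp, eLpNorm_trunc_rpow hq0 hYq] at hS ⊢
  have hY₁ := excess_nonneg p u k' x₀ (2 * R)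
  have hY₂ := excess_nonneg q u k' x₀ (2 * R)
  set X := 1 / R ^ N * (excess p u k' x₀ (2 * R)
    + (R / 2) ^ (s * p - t * q) * excess q u k' x₀ (2 * R)) with hX
  have hX0 : 0 ≤ X := by positivity
  have e5 : ENNReal.ofReal C * (ENNReal.ofReal (1 / R ^ N) *
      (ENNReal.ofReal (excess p u k' x₀ (2 * R))
        + ENNReal.ofReal ((R / 2) ^ (s * p - t * q)) * ENNReal.ofReal (excess q u k' x₀ (2 * R))))
        ^ (1 / p) = ENNReal.ofReal (C * X ^ (1 / p)) := by
    rw [← ENNReal.ofReal_mul (by positivity), ← ENNReal.ofReal_add hY₁ (by positivity),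
      ← ENNReal.ofReal_mul (by positivity), ENNReal.ofReal_rpow_of_nonneg hX0 (by positivity),
      ← ENNReal.ofReal_mul (by linarith)]
  rw [e5] at hS ⊢
  set T₁ := tail s p (fun x => max (u x - k') 0) x₀ R with hT₁
  set T₂ := weightedTail a t q (fun x => max (u x - k') 0) x₀ R with hT₂
  have hT₁t : T₁ ≠ ⊤ := fun e => hS (by simp [e])
  have hT₂t : T₂ ≠ ⊤ := fun e => hS (by simp [e])
  set r₃ := R ^ ((t * q / (q - 1) + N * ε) / q) * c₁ ^ (1 / (q - 1)) with hr₃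
  have hr₃0 : 0 ≤ r₃ := by positivity
  set r₅ := C * X ^ (1 / p) with hr₅
  have hr₅0 : 0 ≤ r₅ := by positivity
  have hr₁0 : 0 ≤ T₁.toReal := ENNReal.toReal_nonneg
  have hr₂0 : 0 ≤ T₂.toReal := ENNReal.toReal_nonneg
  set kt := T₁.toReal + T₂.toReal + r₃ + k' + r₅ + ζ with hkt
  have hkt0 : 0 < kt := by positivity
  have h₁ : T₁ ≤ ENNReal.ofReal kt := by
    rw [← ENNReal.ofReal_toReal hT₁t]; exact ENNReal.ofReal_le_ofReal (by linarith)
  have h₂ : T₂ ≤ ENNReal.ofReal kt := by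
    rw [← ENNReal.ofReal_toReal hT₂t]; exact ENNReal.ofReal_le_ofReal (by linarith)
  have h₃ : r₃ ≤ kt := by linarith
  have h₅ : r₅ ≤ kt := by linarith
  have hgoal : T₁ + T₂ + ENNReal.ofReal r₃ + ENNReal.ofReal (2 * k') + ENNReal.ofReal r₅ + ζ
      = ENNReal.ofReal (k' + kt) := by
    rw [show k' + kt = T₁.toReal + T₂.toReal + r₃ + 2 * k' + r₅ + ζ by rw [hkt]; ring,
      ENNReal.ofReal_add (by positivity) hζ'.le, ENNReal.ofReal_add (by positivity) hr₅0,
      ENNReal.ofReal_add (by positivity) (by positivity),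
      ENNReal.ofReal_add (by positivity) hr₃0, ENNReal.ofReal_add hr₁0 hr₂0,
      ENNReal.ofReal_toReal hT₁t, ENNReal.ofReal_toReal hT₂t, ENNReal.ofReal_coe_nnreal]
  rw [hgoal]
  have hcond : C ^ p * (R ^ (-(N : ℝ)) * (excess p u k' x₀ (2 * R)
      + (R / 2) ^ (s * p - t * q) * excess q u k' x₀ (2 * R))) ≤ kt ^ p := by
    have h6 := Real.rpow_le_rpow hr₅0 h₅ hp0.le
    rw [hr₅, Real.mul_rpow (by linarith) (by positivity), ← Real.rpow_mul hX0,
      one_div_mul_cancel hp0.ne', Real.rpow_one] at h6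
    rwa [Real.rpow_neg hR.le, Real.rpow_natCast, inv_eq_one_div]
  obtain ⟨b, V, hVm, hV0, hb0, hbC, hVn, hV⟩ := hgr
  have hscale : IsScale p (s * p) |Λ₁| q (t * q) (|Λ₂| * (|M| + 1)) μ δ C₁ (fun _ _ => |Λ₁|)
      (fun x y => |Λ₂| * a x y) g u x₀ R k' kt := by
    refine ⟨hkt0, hk'0, by linarith, fun _ => ?_, fun z => ?_, c₁, b, V, hVm, hV0, hb0, hbC, ?_,
      hVn, fun x hx hxk => ?_⟩
    · have h7 := le_ofReal_of_rpow_le hR (by linarith) hkt0.le h₁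
      rw [ENNReal.ofReal_mul (abs_nonneg _)]
      refine le_trans (le_of_eq ?_) (mul_le_mul' le_rfl h7)
      rw [← lintegral_const_mul' _ _ ENNReal.ofReal_ne_top]
      refine lintegral_congr fun y => ?_
      rw [← ENNReal.ofReal_mul (abs_nonneg _), abs_of_nonneg (le_max_right (u y - k') 0)]
      rfl
    · have h7 := (le_iSup (fun z => ∫⁻ y in (Metric.ball x₀ R)ᶜ, ENNReal.ofReal
        (a z y * (|max (u y - k') 0| ^ (q - 1) / ‖x₀ - y‖ ^ ((N : ℝ) + t * q)))) z).trans
        (le_ofReal_of_rpow_le hR (by linarith) hkt0.le h₂)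
      have h8 : ENNReal.ofReal (|Λ₂| * (R ^ (-(t * q)) * kt ^ (q - 1)))
          ≤ ENNReal.ofReal (|Λ₂| * (|M| + 1) * (R ^ (-(t * q)) * kt ^ (q - 1))) := by
        apply ENNReal.ofReal_le_ofReal
        refine mul_le_mul_of_nonneg_right ?_ (by positivity)
        exact le_mul_of_one_le_right (abs_nonneg _) (by linarith [abs_nonneg M])
      refine le_trans ?_ h8
      rw [ENNReal.ofReal_mul (abs_nonneg _)]
      refine le_trans (le_of_eq ?_) (mul_le_mul' le_rfl h7)
      rw [← lintegral_const_mul' _ _ ENNReal.ofReal_ne_top]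
      refine lintegral_congr fun y => ?_
      rw [← ENNReal.ofReal_mul (abs_nonneg _), abs_of_nonneg (le_max_right (u y - k') 0), mul_assoc]
      rfl
    · have hq1 : 0 < q - 1 := by linarith
      have h7 := Real.rpow_le_rpow hr₃0 h₃ hq1.le
      rw [hr₃, Real.mul_rpow (by positivity) (by positivity), ← Real.rpow_mul hR.le,
        ← Real.rpow_mul hc₁, one_div_mul_cancel hq1.ne', Real.rpow_one] at h7
      have h8 : R ^ (t * q) * c₁ ≤ kt ^ (q - 1) :=
        (mul_le_mul_of_nonneg_right hε hc₁).trans h7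
      have h9 : 0 < R ^ (t * q) := Real.rpow_pos_of_pos hR _
      rw [Real.rpow_neg hR.le, inv_mul_eq_div, le_div_iff₀ h9]
      linarith
    · have h7 := hg x (Metric.ball_subset_closedBall hx)
      have h8 := hV x hx hxk
      linarith
  rw [eLpNorm_exponent_top]
  refine essSup_le_of_ae_le _ ?_
  filter_upwards [hcore hs hscale hcond] with x hx
  rw [← ofReal_norm, Real.norm_eq_abs, abs_of_nonneg (le_max_right _ _)]
  exact ENNReal.ofReal_le_ofReal (max_le hx (by positivity))

/-- The sup estimate for a solution, from the conclusion of the iteration. -/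
theorem SolvesDoublePhase.supEstimate (hE : Exponents N s p t q)
    (h : SolvesDoublePhase s p t q Λ₁ Λ₂ M c₁ c₂ l Ω Ksp Ktq a f u) {a₀ : ℝ}
    (ha₀ : 0 < a₀) (ha : ∀ x ∈ Ω, ∀ y ∈ Ω, a₀ ≤ a x y) {x₀ : RN N} (hx₀ : x₀ ∈ Ω) {R : ℝ}
    (hR : 0 < R) (h2R : 2 * R < Metric.infDist x₀ (frontier Ω)) {μ δ C₁ C k' ε : ℝ} (hC : 1 ≤ C)
    (hk'0 : 0 ≤ k')
    (hcore : ∀ {l l' : ℝ} {k₁ b₁ k₂ b₂ : RN N → RN N → ℝ} {g u : RN N → ℝ}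
        {x₀ : RN N} {R k' kt : ℝ},
      IsLocalSolution p (s * p) |Λ₁| (1 / (|Λ₁| + 1)) q (t * q) (|Λ₂| * (|M| + 1)) (a₀ / (|Λ₂| + 1))
        l l' k₁ b₁ k₂ b₂ g u x₀ R →
      IsScale p (s * p) |Λ₁| q (t * q) (|Λ₂| * (|M| + 1)) μ δ C₁ b₁ b₂ g u x₀ R k' kt →
      C ^ p * (R ^ (-(N : ℝ)) * (excess p u k' x₀ (2 * R)
          + (R / 2) ^ (s * p - t * q) * excess q u k' x₀ (2 * R))) ≤ kt ^ p →
        ∀ᵐ x ∂(volume.restrict (Metric.ball x₀ R)), u x ≤ k' + kt)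
    (hε : R ^ (t * q) ≤ R ^ ((t * q / (q - 1) + N * ε) / q * (q - 1)))
    (hgr : ∀ u' : RN N → ℝ, Measurable u' → (∀ᵐ x, |u' x| = |u x|) →
      IsGrowthControlled t q μ δ C₁ c₂ l k' u' x₀ R) :
    SupEstimate s p t q a k' (c₁ ^ (1 / (q - 1))) ε (t * q / (q - 1)) C u x₀ R := by
  have hball := closedBall_subset_of_lt_infDist_frontier h.isOpen hx₀ (by linarith) h2R
  have hm := h.solution.memSobolev.memLp.aestronglyMeasurable
  rw [Measure.restrict_univ] at hm
  obtain ⟨w, hw, hae⟩ := hm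
  have hw' := hw.measurable
  have key : ∀ {f' : RN N → ℝ → ℝ} {v v' : RN N → ℝ},
      SolvesDoublePhase s p t q Λ₁ Λ₂ M c₁ c₂ l Ω Ksp Ktq a f' v → Measurable v' →
      v =ᵐ[volume] v' → (∀ᵐ x, |v' x| = |u x|) →
      eLpNorm (fun x => max (v x) 0) ⊤ (volume.restrict (Metric.ball x₀ R))
        ≤ supBound s p t q a k' (c₁ ^ (1 / (q - 1))) ε (t * q / (q - 1)) C v x₀ R := by
    intro f' v v' hv hv' hvv hvu
    rw [supBound_congr hvv, eLpNorm_congr_ae (g := fun x => max (v' x) 0)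
      ((ae_restrict_of_ae hvv).mono fun x hx => by simp only [hx])]
    exact (hv.congr hvv).eLpNorm_posPart_le hE hv' ha₀ ha hR hball hC hk'0 hcore hε
      (hgr v' hv' hvu)
  refine supEstimate_of_posPart (key h hw' hae (hae.mono fun x hx => by rw [hx])) ?_
  refine key h.neg (v' := fun x => -w x) hw'.neg (hae.mono fun x hx => by simp only [hx])
    (hae.mono fun x hx => by rw [abs_neg, hx])

end

/-! ### The three growth regimes -/

section

variable {N : ℕ}

theorem isGrowthControlled_of_bound {t q μ δ C₁ c₂ l k' b : ℝ} {u : RN N → ℝ} {x₀ : RN N} {R : ℝ}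
    (hμ : 0 < μ) (hb : 0 ≤ b) (hbC : b ≤ C₁ * R ^ (-(t * q)))
    (h : ∀ x, k' < u x → c₂ * |u x| ^ (l - 1) ≤ b * u x ^ (q - 1)) :
    IsGrowthControlled t q μ δ C₁ c₂ l k' u x₀ R := by
  refine ⟨b, fun _ => 0, measurable_const, fun _ => le_rfl, hb, hbC, ?_, fun x _ hx => ?_⟩
  · have h1 : 0 < 1 / μ := by positivity
    simp [ENNReal.zero_rpow_of_pos (inv_pos.2 hμ), ENNReal.zero_rpow_of_pos hμ]
  · rw [add_zero]; exact h x hx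

theorem exists_supEstimate_of_bound {s p t q a₀ : ℝ} (Λ₁ Λ₂ M C₁ : ℝ)
    (hE : Exponents N s p t q) (ha₀ : 0 < a₀) (hC₁ : 0 ≤ C₁) :
    ∃ μ : ℝ, 0 < μ ∧ ∃ δ C : ℝ, 1 ≤ C ∧ ∀ {c₁ c₂ l k' : ℝ} {Ω : Set (RN N)}
      {Ksp Ktq a : RN N → RN N → ℝ} {f : RN N → ℝ → ℝ} {u : RN N → ℝ}, 0 ≤ k' →
      SolvesDoublePhase s p t q Λ₁ Λ₂ M c₁ c₂ l Ω Ksp Ktq a f u →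
      (∀ x ∈ Ω, ∀ y ∈ Ω, a₀ ≤ a x y) → ∀ x₀ ∈ Ω, ∀ R : ℝ, 0 < R →
        2 * R < Metric.infDist x₀ (frontier Ω) →
        (∀ u' : RN N → ℝ, IsGrowthControlled t q μ δ C₁ c₂ l k' u' x₀ R) →
        SupEstimate s p t q a k' (c₁ ^ (1 / (q - 1))) (t * q / N) (t * q / (q - 1)) C u x₀ R := by
  have hN := hE.one_le_dim
  have hNr : (0 : ℝ) < N := by exact_mod_cast hN
  have hp := hE.one_lt_p
  have hq : 1 < q := lt_of_lt_of_le hp hE.p_le_q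
  have htq := hE.tq_pos
  have htN := hE.tq_le_N
  have hκN : t * q / 2 < N := by linarith
  have hμ : 0 < t * q / 2 / N / 2 := by positivity
  have hμκ : t * q / 2 / N / 2 < t * q / 2 / N := half_lt_self (by positivity)
  obtain ⟨δ, hδ, hcore⟩ := exists_ae_le hN hq (by positivity : 0 < t * q / 2) hκN hμ hμκ
    (by positivity : 0 < a₀ / (|Λ₂| + 1))
  obtain ⟨C, hC, hcore⟩ := hcore (p := p) (τ₁ := s * p) (τ₂ := t * q) (Λ₁ := |Λ₁|)
    (lam₁ := 1 / (|Λ₁| + 1)) (Λ₂ := |Λ₂| * (|M| + 1)) (C₁ := C₁) hp hE.p_le_q (by linarith) hE.tq_le_sp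
    (by have := hE.s_lt_one; nlinarith) (by have := hE.t_lt_one; nlinarith) (abs_nonneg _)
    (by positivity) (by positivity) hC₁
  refine ⟨_, hμ, δ, C, hC, ?_⟩
  intro c₁ c₂ l k' Ω Ksp Ktq a f u hk' h ha x₀ hx₀ R hR h2R hgr
  refine h.supEstimate hE ha₀ ha hx₀ hR h2R hC hk' hcore (le_of_eq ?_) fun u' _ _ => hgr u'
  congr 1
  have : q - 1 ≠ 0 := by linarith
  have : q ≠ 0 := by linarith
  field_simp
  ring

theorem exists_supEstimate_of_c₂_eq_zero (s p t q Λ₁ Λ₂ M a₀ : ℝ) (hE : Exponents N s p t q)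
    (ha₀ : 0 < a₀) :
    ∃ C : ℝ, 1 ≤ C ∧
      ∀ (c₁ l : ℝ) (Ω : Set (RN N)) (Ksp Ktq a : RN N → RN N → ℝ) (f : RN N → ℝ → ℝ)
        (u : RN N → ℝ),
        SolvesDoublePhase s p t q Λ₁ Λ₂ M c₁ 0 l Ω Ksp Ktq a f u →
        (∀ x ∈ Ω, ∀ y ∈ Ω, a₀ ≤ a x y) →
        ∀ x₀ ∈ Ω, ∀ R : ℝ, 0 < R → 2 * R < Metric.infDist x₀ (frontier Ω) →
          SupEstimate s p t q a 0 (c₁ ^ (1 / (q - 1))) (t * q / N) (t * q / (q - 1)) C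
            u x₀ R := by
  obtain ⟨μ, hμ, δ, C, hC, h⟩ := exists_supEstimate_of_bound Λ₁ Λ₂ M 0 hE ha₀ le_rfl
  refine ⟨C, hC, fun c₁ l Ω Ksp Ktq a f u hs ha x₀ hx₀ R hR h2R => ?_⟩
  refine h le_rfl hs ha x₀ hx₀ R hR h2R fun u' => isGrowthControlled_of_bound hμ le_rfl
    (by simp) fun x _ => by simp

theorem exists_supEstimate_of_l_le_q (s p t q Λ₁ Λ₂ M a₀ c₂ : ℝ) (hE : Exponents N s p t q)
    (ha₀ : 0 < a₀) (hc₂ : 0 < c₂) :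
    ∃ C : ℝ, 1 ≤ C ∧
      ∀ (c₁ l : ℝ) (Ω : Set (RN N)) (Ksp Ktq a : RN N → RN N → ℝ) (f : RN N → ℝ → ℝ)
        (u : RN N → ℝ), l ≤ q →
        SolvesDoublePhase s p t q Λ₁ Λ₂ M c₁ c₂ l Ω Ksp Ktq a f u →
        (∀ x ∈ Ω, ∀ y ∈ Ω, a₀ ≤ a x y) →
        ∀ x₀ ∈ Ω, ∀ R : ℝ, 0 < R → 2 * R < min (Metric.infDist x₀ (frontier Ω)) 1 →
          SupEstimate s p t q a 1 (c₁ ^ (1 / (q - 1))) (t * q / N) (t * q / (q - 1)) C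
            u x₀ R := by
  obtain ⟨μ, hμ, δ, C, hC, h⟩ := exists_supEstimate_of_bound Λ₁ Λ₂ M c₂ hE ha₀ hc₂.le
  refine ⟨C, hC, fun c₁ l Ω Ksp Ktq a f u hl hs ha x₀ hx₀ R hR h2R => ?_⟩
  obtain ⟨h2R, hR1⟩ := lt_min_iff.1 h2R
  have htq := hE.tq_pos
  refine h zero_le_one hs ha x₀ hx₀ R hR h2R fun u' => isGrowthControlled_of_bound hμ hc₂.le ?_
    fun x hx => ?_
  · refine le_mul_of_one_le_right hc₂.le ?_
    rw [Real.rpow_neg hR.le]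
    exact (one_le_inv₀ (by positivity)).2 (Real.rpow_le_one hR.le (by linarith) htq.le)
  · rw [abs_of_pos (by linarith)]
    exact mul_le_mul_of_nonneg_left
      (Real.rpow_le_rpow_of_exponent_le hx.le (by linarith)) hc₂.le

theorem isGrowthControlled_of_supercritical {t q μ δ c₂ l Q : ℝ} {u : RN N → ℝ} {x₀ : RN N} {R : ℝ}
    (hμ : 0 < μ) (hql : q < l) (hQ : 0 < Q) (hμQ : l - q = μ * Q) (hc₂ : 0 < c₂)
    (hu : Measurable u) {Ω : Set (RN N)} (hΩ : Metric.ball x₀ (2 * R) ⊆ Ω)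
    (hfin : eLpNorm u (ENNReal.ofReal Q) (volume.restrict Ω) < ⊤)
    (hsmall : c₂ * (eLpNorm u (ENNReal.ofReal Q) (volume.restrict Ω)).toReal ^ (l - q)
      ≤ δ * R ^ (N * μ - t * q)) :
    IsGrowthControlled t q μ δ 0 c₂ l 0 u x₀ R := by
  set m := eLpNorm u (ENNReal.ofReal Q) (volume.restrict Ω) with hm
  refine ⟨0, fun x => c₂ * |u x| ^ (l - q),
    (by fun_prop : Measurable fun x => |u x| ^ (l - q)).const_mul c₂, fun x => by positivity, le_rfl,
    by simp, le_trans ?_ (ENNReal.ofReal_le_ofReal hsmall), fun x _ hx => ?_⟩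
  · have e1 : ∀ x, ENNReal.ofReal (c₂ * |u x| ^ (l - q)) ^ (1 / μ)
        = ENNReal.ofReal (c₂ ^ (1 / μ)) * ENNReal.ofReal (|u x| ^ Q) := fun x => by
      rw [ENNReal.ofReal_rpow_of_nonneg (by positivity) (by positivity),
        Real.mul_rpow hc₂.le (by positivity), ← Real.rpow_mul (abs_nonneg _), hμQ,
        ← ENNReal.ofReal_mul (by positivity)]
      congr 3
      field_simp
    simp_rw [e1]
    rw [lintegral_const_mul' _ _ ENNReal.ofReal_ne_top, ENNReal.mul_rpow_of_nonneg _ _ hμ.le,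
      ENNReal.ofReal_rpow_of_nonneg (by positivity) hμ.le, ← Real.rpow_mul hc₂.le,
      one_div_mul_cancel hμ.ne', Real.rpow_one, ENNReal.ofReal_mul hc₂.le]
    refine mul_le_mul' le_rfl ?_
    have e2 : ∫⁻ x in Ω, ENNReal.ofReal (|u x| ^ Q) = m ^ Q :=
      (eLpNorm_rpow_eq_lintegral u hQ).symm
    calc (∫⁻ x in Metric.ball x₀ (2 * R), ENNReal.ofReal (|u x| ^ Q)) ^ μ
        ≤ (∫⁻ x in Ω, ENNReal.ofReal (|u x| ^ Q)) ^ μ :=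
          ENNReal.rpow_le_rpow (lintegral_mono_set hΩ) hμ.le
      _ = m ^ (l - q) := by rw [e2, ← ENNReal.rpow_mul, hμQ, mul_comm]
      _ = ENNReal.ofReal (m.toReal ^ (l - q)) := by
          rw [← ENNReal.ofReal_rpow_of_nonneg ENNReal.toReal_nonneg (by linarith),
            ENNReal.ofReal_toReal hfin.ne]
  · simp only [abs_of_pos hx, zero_add]
    rw [mul_assoc, ← Real.rpow_add hx]
    refine le_of_eq ?_
    congr 2
    ring

theorem exists_supEstimate_of_q_lt_l (t q Λ₂ a₀ c₂ l α : ℝ) (ha₀ : 0 < a₀) (hc₂ : 0 < c₂)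
    (hql : q < l) (hα : 0 < α) (hαt : α ≤ t) (hαN : α * q < N)
    (hl : ENNReal.ofReal l < critExp N α q) :
    ∃ Rt : ℝ≥0∞ → ℝ, (∀ m, 0 < Rt m) ∧
      ∀ (s p Λ₁ M : ℝ), Exponents N s p t q →
        ∃ C : ℝ, 1 ≤ C ∧
          ∀ (c₁ : ℝ) (Ω : Set (RN N)) (Ksp Ktq a : RN N → RN N → ℝ) (f : RN N → ℝ → ℝ)
            (u : RN N → ℝ),
            SolvesDoublePhase s p t q Λ₁ Λ₂ M c₁ c₂ l Ω Ksp Ktq a f u →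
            (∀ x ∈ Ω, ∀ y ∈ Ω, a₀ ≤ a x y) →
            ∀ x₀ ∈ Ω, ∀ R : ℝ, 0 < R →
              2 * R < min (Metric.infDist x₀ (frontier Ω))
                (Rt (eLpNorm u (critExp N α q) (volume.restrict Ω))) →
              SupEstimate s p t q a 0 (c₁ ^ (1 / (q - 1)))
                (1 - l * ((N : ℝ) - α * q) / (N * q)) (t * q / (q - 1)) C u x₀ R := by
  by_cases hq : 1 < q
  swap
  · refine ⟨fun _ => 1, fun _ => one_pos, fun s p Λ₁ M hE => ?_⟩
    exact absurd (lt_of_lt_of_le hE.one_lt_p hE.p_le_q) hq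
  have hαq : 0 < α * q := mul_pos hα (by linarith)
  have hNr : (0 : ℝ) < N := by linarith
  have hN : 1 ≤ N := by exact_mod_cast hNr
  have hNα : 0 < (N : ℝ) - α * q := by linarith
  rw [critExp, if_pos hαN] at hl ⊢
  set Q := (N : ℝ) * q / (N - α * q) with hQ
  have hQ0 : 0 < Q := by positivity
  have hlQ : l < Q := (ENNReal.ofReal_lt_ofReal_iff hQ0).1 hl
  have hlN : l * (N - α * q) < N * q := (lt_div_iff₀ hNα).1 hlQ
  set μ := (l - q) / Q with hμ
  have hμ0 : 0 < μ := div_pos (by linarith) hQ0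
  have hμQ : l - q = μ * Q := by rw [hμ]; field_simp
  have hμN : N * μ = (l - q) * (N - α * q) / q := by rw [hμ, hQ]; field_simp
  have hNμ : N * μ < α * q := by
    rw [hμN, div_lt_iff₀ (by linarith)]; nlinarith
  have hμκ : μ < α * q / N := by
    rw [lt_div_iff₀ hNr]; linarith
  obtain ⟨δ, hδ, hcore⟩ := exists_ae_le hN hq hαq hαN hμ0 hμκ
    (by positivity : 0 < a₀ / (|Λ₂| + 1))
  have hαtq : α * q ≤ t * q := mul_le_mul_of_nonneg_right hαt (by linarith)
  set e := t * q - N * μ with he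
  have he0 : 0 < e := by linarith
  refine ⟨fun m => min 1 ((δ / (c₂ * m.toReal ^ (l - q) + 1)) ^ (1 / e)), fun m => by positivity, ?_⟩
  intro s p Λ₁ M hE
  have hp := hE.one_lt_p
  obtain ⟨C, hC, hcore⟩ := hcore (p := p) (τ₁ := s * p) (τ₂ := t * q) (Λ₁ := |Λ₁|)
    (lam₁ := 1 / (|Λ₁| + 1)) (Λ₂ := |Λ₂| * (|M| + 1)) (C₁ := 0) hp hE.p_le_q hαtq hE.tq_le_sp
    (by have := hE.s_lt_one; nlinarith) (by have := hE.t_lt_one; nlinarith) (abs_nonneg _)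
    (by positivity) (by positivity) le_rfl
  refine ⟨C, hC, fun c₁ Ω Ksp Ktq a f u h ha x₀ hx₀ R hR h2R => ?_⟩
  obtain ⟨h2R, hRt⟩ := lt_min_iff.1 h2R
  obtain ⟨hR1, hRt⟩ := lt_min_iff.1 hRt
  have hball := closedBall_subset_of_lt_infDist_frontier h.isOpen hx₀ (by linarith) h2R
  refine h.supEstimate hE ha₀ ha hx₀ hR h2R hC le_rfl hcore ?_ fun u' hu' hae => ?_
  · refine Real.rpow_le_rpow_of_exponent_ge hR (by linarith) ?_
    have h1 : (N : ℝ) * (1 - l * (N - α * q) / (N * q)) ≤ t * q := by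
      have h2 : (N : ℝ) * (1 - l * (N - α * q) / (N * q)) = N - l / q * (N - α * q) := by
        have : q ≠ 0 := by linarith
        field_simp
      have h3 : 1 ≤ l / q := by rw [le_div_iff₀ (by linarith)]; linarith
      rw [h2]; nlinarith
    have hq1 : 0 < q - 1 := by linarith
    have hq0 : 0 < q := by linarith
    have h4 : (t * q / (q - 1) + N * (1 - l * (N - α * q) / (N * q))) / q * (q - 1)
        = (t * q + N * (1 - l * (N - α * q) / (N * q)) * (q - 1)) / q := by
      generalize (N : ℝ) * (1 - l * (N - α * q) / (N * q)) = A
      field_simp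
    rw [h4, div_le_iff₀ hq0]
    nlinarith
  · have hnorm : eLpNorm u' (ENNReal.ofReal Q) (volume.restrict Ω)
        = eLpNorm u (ENNReal.ofReal Q) (volume.restrict Ω) :=
      eLpNorm_congr_norm_ae ((ae_restrict_of_ae hae).mono fun x hx => by
        rwa [Real.norm_eq_abs, Real.norm_eq_abs])
    have hmeas := h.solution.memSobolev.memLp.aestronglyMeasurable
    rw [Measure.restrict_univ] at hmeas
    obtain ⟨w, hw, hwae⟩ := hmeas
    have hfinw : eLpNorm w (ENNReal.ofReal Q) (volume.restrict Ω) < ⊤ := by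
      have := (h.congr hwae).memSobolevLoc.lintegral_lt_top hN hq hE.t_pos hE.t_lt_one hαq hαN hαtq
        hw.measurable h.isBounded
      exact ((memLp_ofReal_iff hQ0 hw.aestronglyMeasurable).2 this).2
    have hfin : eLpNorm u (ENNReal.ofReal Q) (volume.restrict Ω) < ⊤ := by
      rwa [eLpNorm_congr_ae (ae_restrict_of_ae hwae)]
    refine isGrowthControlled_of_supercritical hμ0 hql hQ0 hμQ hc₂ hu'
      (Metric.ball_subset_closedBall.trans hball) (hnorm ▸ hfin) ?_
    rw [hnorm]
    set m := (eLpNorm u (ENNReal.ofReal Q) (volume.restrict Ω)).toReal with hm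
    have hm0 : 0 ≤ m := ENNReal.toReal_nonneg
    have h5 : R ^ e ≤ δ / (c₂ * m ^ (l - q) + 1) := by
      have := Real.rpow_le_rpow hR.le (by linarith :
        R ≤ (δ / (c₂ * m ^ (l - q) + 1)) ^ (1 / e)) he0.le
      rwa [← Real.rpow_mul (by positivity), one_div_mul_cancel he0.ne', Real.rpow_one] at this
    have h6 : 0 < R ^ e := Real.rpow_pos_of_pos hR _
    rw [le_div_iff₀ (by positivity)] at h5
    rw [show (N : ℝ) * μ - t * q = -e by rw [he]; ring, Real.rpow_neg hR.le, ← div_eq_mul_inv,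
      le_div_iff₀ h6]
    nlinarith

end

/-! ### Local boundedness -/

section

variable {N : ℕ} {u : RN N → ℝ} {s p t q Λ₁ Λ₂ M c₁ c₂ l : ℝ} {Ω : Set (RN N)}
  {Ksp Ktq a : RN N → RN N → ℝ} {f : RN N → ℝ → ℝ}

theorem abs_max_sub_le {x k : ℝ} (hk : 0 ≤ k) : |max (x - k) 0| ≤ |x| := by
  rw [abs_of_nonneg (le_max_right _ _)]
  exact max_le (by linarith [le_abs_self x]) (abs_nonneg _)

theorem SolvesDoublePhase.supBound_lt_top (hE : Exponents N s p t q)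
    (h : SolvesDoublePhase s p t q Λ₁ Λ₂ M c₁ c₂ l Ω Ksp Ktq a f u) {x₀ : RN N} {R : ℝ} (hR : 0 < R)
    {k : ℝ} (hk : 0 ≤ k) (θ ε ρ C : ℝ) :
    supBound s p t q a k θ ε ρ C u x₀ R < ⊤ := by
  have hp := hE.one_lt_p
  have hq : 1 < q := lt_of_lt_of_le hp hE.p_le_q
  have hmono : ∀ {r : ℝ}, 1 < r → ∀ y, |max (u y - k) 0| ^ (r - 1) ≤ |u y| ^ (r - 1) := fun hr y =>
    Real.rpow_le_rpow (abs_nonneg _) (abs_max_sub_le hk) (by linarith)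
  have hNr : (0 : ℝ) ≤ N := Nat.cast_nonneg N
  have hsp : 0 < s * p := mul_pos hE.s_pos (by linarith)
  have htq := hE.tq_pos
  have h₁ : tail s p (fun x => max (u x - k) 0) x₀ R < ⊤ := by
    obtain ⟨T, -, hT⟩ := lintegral_weight_mul_lt_top (u := u) (A := fun _ _ => 1) (e := p - 1)
      (P := (N : ℝ) + s * p) (by positivity) (fun _ _ => zero_le_one)
      (by simpa only [one_mul, iSup_const] using h.solution.memTail.tail_lt_top) x₀ le_rfl hR
    refine ENNReal.rpow_lt_top_of_nonneg (one_div_nonneg.2 (by linarith))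
      (ENNReal.mul_lt_top ENNReal.ofReal_lt_top ?_).ne
    refine lt_of_le_of_lt (lintegral_mono fun y => ENNReal.ofReal_le_ofReal ?_)
      ((hT x₀ x₀ (Metric.mem_closedBall_self le_rfl)).trans_lt ENNReal.ofReal_lt_top)
    rw [one_mul]
    exact div_le_div_of_nonneg_right (hmono hp y) (by positivity)
  have h₂ : weightedTail a t q (fun x => max (u x - k) 0) x₀ R < ⊤ := by
    obtain ⟨T, -, hT⟩ := lintegral_weight_mul_lt_top (u := u) (A := a) (e := q - 1)
      (P := (N : ℝ) + t * q) (by positivity) (fun x y => (h.weight.pos x y).le)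
      h.solution.memWeightedTail.tail_lt_top x₀ le_rfl hR
    refine ENNReal.rpow_lt_top_of_nonneg (one_div_nonneg.2 (by linarith))
      (ENNReal.mul_lt_top ENNReal.ofReal_lt_top ?_).ne
    refine lt_of_le_of_lt (iSup_le fun z => le_trans (lintegral_mono fun y =>
      ENNReal.ofReal_le_ofReal ?_) (hT z x₀ (Metric.mem_closedBall_self le_rfl)))
      ENNReal.ofReal_lt_top
    exact mul_le_mul_of_nonneg_left (div_le_div_of_nonneg_right (hmono hq y) (by positivity))
      (h.weight.pos z y).le
  have hL : ∀ {r : ℝ}, 1 < r → MemLp u (ENNReal.ofReal r) (volume.restrict (Metric.ball x₀ (2 * R))) →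
      eLpNorm (fun x => max (u x - k) 0) (ENNReal.ofReal r)
        (volume.restrict (Metric.ball x₀ (2 * R))) ^ r < ⊤ := fun hr hu =>
    ENNReal.rpow_lt_top_of_nonneg (by linarith) ((eLpNorm_mono fun x => by
      rw [Real.norm_eq_abs, Real.norm_eq_abs]; exact abs_max_sub_le hk).trans_lt hu.2).ne
  have h₃ := hL hp (h.solution.memSobolev.memLp.mono_measure
    (Measure.restrict_mono (subset_univ _) le_rfl))
  have h₄ := hL hq (h.memSobolevLoc _ Metric.isOpen_ball Metric.isBounded_ball).memLp
  unfold supBound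
  refine ENNReal.add_lt_top.2 ⟨ENNReal.add_lt_top.2 ⟨ENNReal.add_lt_top.2
    ⟨ENNReal.add_lt_top.2 ⟨h₁, h₂⟩, ENNReal.ofReal_lt_top⟩, ENNReal.ofReal_lt_top⟩,
    ENNReal.mul_lt_top ENNReal.ofReal_lt_top (ENNReal.rpow_lt_top_of_nonneg
      (one_div_nonneg.2 (by linarith)) (ENNReal.mul_lt_top ENNReal.ofReal_lt_top
        (ENNReal.add_lt_top.2 ⟨h₃, ENNReal.mul_lt_top ENNReal.ofReal_lt_top h₄⟩)).ne)⟩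

theorem SolvesDoublePhase.memLp_top_ball (hE : Exponents N s p t q)
    (h : SolvesDoublePhase s p t q Λ₁ Λ₂ M c₁ c₂ l Ω Ksp Ktq a f u) {x₀ : RN N} {R : ℝ} (hR : 0 < R)
    {k θ ε ρ C : ℝ} (hk : 0 ≤ k) (hs : SupEstimate s p t q a k θ ε ρ C u x₀ R) :
    MemLp u ⊤ (volume.restrict (Metric.ball x₀ R)) := by
  have hm := h.solution.memSobolev.memLp.aestronglyMeasurable
  rw [Measure.restrict_univ] at hm
  exact ⟨hm.restrict, hs.2.2.trans_lt (max_lt (h.supBound_lt_top hE hR hk θ ε ρ C)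
    (h.neg.supBound_lt_top hE hR hk θ ε ρ C))⟩

theorem memLp_top_union {X : Type*} [MeasurableSpace X] {ν : Measure X} {v : X → ℝ} {A B : Set X}
    (hA : MemLp v ⊤ (ν.restrict A)) (hB : MemLp v ⊤ (ν.restrict B)) :
    MemLp v ⊤ (ν.restrict (A ∪ B)) := by
  refine ⟨aestronglyMeasurable_union_iff.2 ⟨hA.1, hB.1⟩, ?_⟩
  have h1 := hA.2
  have h2 := hB.2
  rw [eLpNorm_exponent_top] at h1 h2 ⊢
  refine lt_of_le_of_lt (essSup_le_of_ae_le (max (eLpNormEssSup v (ν.restrict A))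
    (eLpNormEssSup v (ν.restrict B))) ?_) (max_lt h1 h2)
  refine (ae_restrict_union_iff A B _).2 ⟨?_, ?_⟩
  · exact ae_le_eLpNormEssSup.mono fun x hx => hx.trans (le_max_left _ _)
  · exact ae_le_eLpNormEssSup.mono fun x hx => hx.trans (le_max_right _ _)

theorem IsWeight.exists_lower_bound (ha : IsWeight M a) (hΩ : Bornology.IsBounded Ω) :
    ∃ a₀ : ℝ, 0 < a₀ ∧ ∀ x ∈ Ω, ∀ y ∈ Ω, a₀ ≤ a x y := by
  have hc : IsCompact (closure Ω ×ˢ closure Ω) := hΩ.isCompact_closure.prod hΩ.isCompact_closure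
  obtain ⟨a₀, h0, h⟩ := hc.exists_forall_le' (a := 0) ha.cont.continuousOn fun z _ => ha.pos z.1 z.2
  exact ⟨a₀, h0, fun x hx y hy => h (x, y) ⟨subset_closure hx, subset_closure hy⟩⟩

theorem infDist_frontier_pos (hN : 1 ≤ N) (hΩ : IsOpen Ω) (hb : Bornology.IsBounded Ω) {x : RN N}
    (hx : x ∈ Ω) : 0 < Metric.infDist x (frontier Ω) := by
  have : Nonempty (Fin N) := ⟨⟨0, hN⟩⟩
  have hne : (frontier Ω).Nonempty := nonempty_frontier_iff.2 ⟨⟨x, hx⟩, fun h =>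
    NormedSpace.unbounded_univ ℝ (RN N) (h ▸ hb)⟩
  refine (isClosed_frontier.notMem_iff_infDist_pos hne).1 fun hf => ?_
  rw [hΩ.frontier_eq] at hf
  exact hf.2 hx

theorem SolvesDoublePhase.exists_ball_memLp_top (hE : Exponents N s p t q)
    (h : SolvesDoublePhase s p t q Λ₁ Λ₂ M c₁ c₂ l Ω Ksp Ktq a f u) {x₀ : RN N} (hx₀ : x₀ ∈ Ω) :
    ∃ R : ℝ, 0 < R ∧ MemLp u ⊤ (volume.restrict (Metric.ball x₀ R)) := by
  obtain ⟨a₀, ha₀, ha⟩ := h.weight.exists_lower_bound h.isBounded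
  have hd := infDist_frontier_pos hE.one_le_dim h.isOpen h.isBounded hx₀
  have hq : 1 < q := lt_of_lt_of_le hE.one_lt_p hE.p_le_q
  have hNr : (0 : ℝ) < N := by exact_mod_cast hE.one_le_dim
  have htq := hE.tq_pos
  rcases h.c₂_nonneg.eq_or_lt with hc₂ | hc₂
  · subst hc₂
    obtain ⟨C, -, hC⟩ := exists_supEstimate_of_c₂_eq_zero s p t q Λ₁ Λ₂ M a₀ hE ha₀
    refine ⟨Metric.infDist x₀ (frontier Ω) / 3, by positivity, ?_⟩
    exact h.memLp_top_ball hE (by positivity) le_rfl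
      (hC c₁ l Ω Ksp Ktq a f u h ha x₀ hx₀ _ (by positivity) (by linarith))
  rcases le_or_gt l q with hlq | hlq
  · obtain ⟨C, -, hC⟩ := exists_supEstimate_of_l_le_q s p t q Λ₁ Λ₂ M a₀ c₂ hE ha₀ hc₂
    have hm : 0 < min (Metric.infDist x₀ (frontier Ω)) 1 := lt_min hd one_pos
    refine ⟨min (Metric.infDist x₀ (frontier Ω)) 1 / 3, by positivity, ?_⟩
    exact h.memLp_top_ball hE (by positivity) zero_le_one
      (hC c₁ l Ω Ksp Ktq a f u hlq h ha x₀ hx₀ _ (by positivity) (by linarith))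
  · have hα : ∃ α : ℝ, 0 < α ∧ α ≤ t ∧ α * q < N ∧ ENNReal.ofReal l < critExp N α q := by
      by_cases htN : t * q < N
      · exact ⟨t, hE.t_pos, le_rfl, htN, h.l_lt_critExp⟩
      · have htN' : t * q = N := le_antisymm hE.tq_le_N (not_lt.1 htN)
        have hl0 : 0 < l := by linarith
        have hθ : 0 < 1 - q / (2 * l) := by rw [sub_pos, div_lt_one (by linarith)]; linarith
        have hθ1 : 0 < q / (2 * l) := by positivity
        have e : t * (1 - q / (2 * l)) * q = N - N * (q / (2 * l)) := by rw [← htN']; ring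
        have hlt : t * (1 - q / (2 * l)) * q < N := by
          rw [e]
          have := mul_pos hNr hθ1
          linarith
        refine ⟨t * (1 - q / (2 * l)), mul_pos hE.t_pos hθ, ?_, hlt, ?_⟩
        · exact mul_le_of_le_one_right hE.t_pos.le (by linarith)
        · rw [critExp, if_pos hlt, e, sub_sub_cancel]
          have : (N : ℝ) * q / (N * (q / (2 * l))) = 2 * l := by
            have : q ≠ 0 := by linarith
            field_simp
          rw [this]
          exact (ENNReal.ofReal_lt_ofReal_iff (by linarith)).2 (by linarith)
    obtain ⟨α, hα0, hαt, hαN, hlα⟩ := hα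
    obtain ⟨Rt, hRt, hC⟩ :=
      exists_supEstimate_of_q_lt_l t q Λ₂ a₀ c₂ l α ha₀ hc₂ hlq hα0 hαt hαN hlα
    obtain ⟨C, -, hC⟩ := hC s p Λ₁ M hE
    have hm : 0 < min (Metric.infDist x₀ (frontier Ω))
      (Rt (eLpNorm u (critExp N α q) (volume.restrict Ω))) := lt_min hd (hRt _)
    refine ⟨min (Metric.infDist x₀ (frontier Ω))
      (Rt (eLpNorm u (critExp N α q) (volume.restrict Ω))) / 3, by positivity, ?_⟩
    exact h.memLp_top_ball hE (by positivity) le_rfl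
      (hC c₁ Ω Ksp Ktq a f u h ha x₀ hx₀ _ (by positivity) (by linarith))

theorem SolvesDoublePhase.memLp_top_of_isCompact (hE : Exponents N s p t q)
    (h : SolvesDoublePhase s p t q Λ₁ Λ₂ M c₁ c₂ l Ω Ksp Ktq a f u) {K : Set (RN N)}
    (hK : IsCompact K) (hKΩ : K ⊆ Ω) : MemLp u ⊤ (volume.restrict K) := by
  refine hK.induction_on (p := fun S => MemLp u ⊤ (volume.restrict S)) ?_ ?_ ?_ ?_
  · rw [Measure.restrict_empty]
    exact ⟨aestronglyMeasurable_zero_measure u, by simp⟩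
  · exact fun S T hST hT => hT.mono_measure (Measure.restrict_mono hST le_rfl)
  · exact fun S T hS hT => memLp_top_union hS hT
  · intro x hx
    obtain ⟨R, hR, hm⟩ := h.exists_ball_memLp_top hE (hKΩ hx)
    exact ⟨Metric.ball x R, mem_nhdsWithin_of_mem_nhds (Metric.ball_mem_nhds x hR), hm⟩

end

theorem theorem1p4 :
    -- local boundedness
    (∀ (N : ℕ) (s p t q Λ₁ Λ₂ M c₁ c₂ l : ℝ), Exponents N s p t q →
      ∀ (Ω : Set (RN N)) (Ksp Ktq a : RN N → RN N → ℝ) (f : RN N → ℝ → ℝ) (u : RN N → ℝ),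
        SolvesDoublePhase s p t q Λ₁ Λ₂ M c₁ c₂ l Ω Ksp Ktq a f u →
        ∀ K : Set (RN N), IsCompact K → K ⊆ Ω → MemLp u ⊤ (volume.restrict K)) ∧
    -- the case c₂ = 0
    (∀ (N : ℕ) (s p t q Λ₁ Λ₂ M a₀ : ℝ), Exponents N s p t q → 0 < a₀ →
      ∃ C : ℝ, 1 ≤ C ∧
        ∀ (c₁ l : ℝ) (Ω : Set (RN N)) (Ksp Ktq a : RN N → RN N → ℝ) (f : RN N → ℝ → ℝ)
          (u : RN N → ℝ),
          SolvesDoublePhase s p t q Λ₁ Λ₂ M c₁ 0 l Ω Ksp Ktq a f u →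
          (∀ x ∈ Ω, ∀ y ∈ Ω, a₀ ≤ a x y) →
          ∀ x₀ ∈ Ω, ∀ R : ℝ, 0 < R → 2 * R < Metric.infDist x₀ (frontier Ω) →
            SupEstimate s p t q a 0 (c₁ ^ (1 / (q - 1))) (t * q / N) (t * q / (q - 1)) C
              u x₀ R) ∧
    -- the case c₂ > 0 and 1 < l ≤ q
    (∀ (N : ℕ) (s p t q Λ₁ Λ₂ M a₀ c₂ : ℝ), Exponents N s p t q → 0 < a₀ → 0 < c₂ →
      ∃ C : ℝ, 1 ≤ C ∧
        ∀ (c₁ l : ℝ) (Ω : Set (RN N)) (Ksp Ktq a : RN N → RN N → ℝ) (f : RN N → ℝ → ℝ)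
          (u : RN N → ℝ), l ≤ q →
          SolvesDoublePhase s p t q Λ₁ Λ₂ M c₁ c₂ l Ω Ksp Ktq a f u →
          (∀ x ∈ Ω, ∀ y ∈ Ω, a₀ ≤ a x y) →
          ∀ x₀ ∈ Ω, ∀ R : ℝ, 0 < R → 2 * R < min (Metric.infDist x₀ (frontier Ω)) 1 →
            SupEstimate s p t q a 1 (c₁ ^ (1 / (q - 1))) (t * q / N) (t * q / (q - 1)) C
              u x₀ R) ∧
    -- the case c₂ > 0 and q < l < q_t^*
    (∀ (N : ℕ) (t q Λ₂ a₀ c₂ l α : ℝ), 0 < a₀ → 0 < c₂ → q < l →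
      0 < α → α ≤ t → α * q < N → ENNReal.ofReal l < critExp N α q →
      ∃ Rt : ℝ≥0∞ → ℝ, (∀ m, 0 < Rt m) ∧
        ∀ (s p Λ₁ M : ℝ), Exponents N s p t q →
          ∃ C : ℝ, 1 ≤ C ∧
            ∀ (c₁ : ℝ) (Ω : Set (RN N)) (Ksp Ktq a : RN N → RN N → ℝ) (f : RN N → ℝ → ℝ)
              (u : RN N → ℝ),
              SolvesDoublePhase s p t q Λ₁ Λ₂ M c₁ c₂ l Ω Ksp Ktq a f u →
              (∀ x ∈ Ω, ∀ y ∈ Ω, a₀ ≤ a x y) →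
              ∀ x₀ ∈ Ω, ∀ R : ℝ, 0 < R →
                2 * R < min (Metric.infDist x₀ (frontier Ω))
                  (Rt (eLpNorm u (critExp N α q) (volume.restrict Ω))) →
                SupEstimate s p t q a 0 (c₁ ^ (1 / (q - 1)))
                  (1 - l * ((N : ℝ) - α * q) / (N * q)) (t * q / (q - 1)) C u x₀ R) := by
  exact ⟨fun _ _ _ _ _ _ _ _ _ _ _ hE _ _ _ _ _ _ h _ hK hKΩ => h.memLp_top_of_isCompact hE hK hKΩ,
    fun _ s p t q Λ₁ Λ₂ M a₀ hE ha₀ =>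
      exists_supEstimate_of_c₂_eq_zero s p t q Λ₁ Λ₂ M a₀ hE ha₀,
    fun _ s p t q Λ₁ Λ₂ M a₀ c₂ hE ha₀ hc₂ =>
      exists_supEstimate_of_l_le_q s p t q Λ₁ Λ₂ M a₀ c₂ hE ha₀ hc₂,
    fun _ t q Λ₂ a₀ c₂ l α ha₀ hc₂ hql hα hαt hαN hl =>
      exists_supEstimate_of_q_lt_l t q Λ₂ a₀ c₂ l α ha₀ hc₂ hql hα hαt hαN hl⟩
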